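/- Let $q,r$ be complex-valued functions in the Schwartz class $\mathcal S(\mathbb R)$ and consider, for $\zeta\in\mathbb C$, the linear system $$\frac{d}{dx}\begin{bmatrix}\alpha\\ \beta\end{bmatrix}=\begin{bmatrix}-i\zeta^2-\frac i2 q(x)r(x)&\zeta q(x)\\ \zeta r(x)&i\zeta^2+\frac i2 q(x)r(x)\end{bmatrix}\begin{bmatrix}\alpha\\ \beta\end{bmatrix},\qquad x\in\mathbb R.\tag{1}$$ Overbars do not denote complex conjugation. The Jost solutions to (1) are the solutions with $$\psi=\begin{bmatrix}o(1)\\ e^{i\zeta^2x}(1+o(1))\end{bmatrix},\quad \bar\psi=\begin{bmatrix}e^{-i\zeta^2x}(1+o(1))\\ o(1)\end{bmatrix}\quad(x\to+\infty),$$ $$\phi=\begin{bmatrix}e^{-i\zeta^2x}(1+o(1))\\ o(1)\end{bmatrix},\quad \bar\phi=\begin{bmatrix}o(1)\\ e^{i\zeta^2x}(1+o(1))\end{bmatrix}\quad(x\to-\infty),$$ where $\psi,\phi$ are considered for $\operatorname{Im}\zeta^2\ge0$ and $\bar\psi,\bar\phi$ for $\operatorname{Im}\zeta^2\le0$; subscripts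 $1,2$ denote components. With the ($x$-independent) Wronskian $[f;g]=f_1g_2-g_1f_2$ put $$T=\frac1{[\phi;\psi]},\quad \bar T=\frac1{[\bar\psi;\bar\phi]},\quad R=\frac{[\phi;\bar\psi]}{[\psi;\phi]},\quad \bar R=\frac{[\bar\phi;\psi]}{[\bar\psi;\bar\phi]}.$$ Write $\lambda=\zeta^2$, $\zeta=\sqrt\lambda$ (principal root). Assume that $T$ and $\bar T$ have no poles at real $\lambda$, i.e. $[\phi;\psi]\neq0$ and $[\bar\psi;\bar\phi]\ne0$ for all $\lambda\in\mathbb R$. *Bound-state data.* Let $\lambda_1,\dots,\lambda_N$ be the distinct poles of $T$, as a function of $\lambda$, in $\operatorname{Im}\lambda>0$, with multiplicities $m_1,\dots,m_N$. At $\lambda_j$ write $T=\sum_{k=1}^{m_j}t_{jk}(\lambda-\lambda_j)^{-k}+O(1)$, and let $\gamma_{j0},\dots,\gamma_{j(m_j-1)}$ be the constants with $$\frac{d^k}{d\lambda^k}\begin{bmatrix}\phi_1\\ \phi_2/\zeta\end{bmatrix}=\sum_{l=0}^k\binom kl\gamma_{j(k-l)}\frac{d^l}{d\lambda^l}\begin{bmatrix}\zeta\psi_1\\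 \psi_2\end{bmatrix}\quad\text{at }\lambda=\lambda_j,\ 0\le k\le m_j-1,\ x\in\mathbb R.$$ Put $c_{jk}=-i\sum_{l=0}^{m_j-1-k}t_{j(k+l+1)}\gamma_{jl}/l!$. Let $A$ be the block diagonal matrix of the $m_j\times m_j$ upper triangular Jordan blocks with eigenvalues $\lambda_j$, let $B$ be the column vector with blocks $(0,\dots,0,1)^{T}$ and $C$ the row vector with blocks $(c_{j(m_j-1)},\dots,c_{j0})$. Define $(\bar A,\bar B,\bar C)$ in the same way from the poles $\bar\lambda_j$ of $\bar T$ in $\operatorname{Im}\lambda<0$, where the dependency constants $\bar\gamma_{jk}$ relate $(\bar\phi_1/\zeta,\bar\phi_2)$ to $(\bar\psi_1,\zeta\bar\psi_2)$ and $\bar c_{jk}=+i\sum_l\bar t_{j(k+l+1)}\bar\gamma_{jl}/l!$. *Marchenko system.* Put $$\Omega(y)=\frac1{2\pi}\int_{-\infty}^\infty\frac{R(\zeta)}\zeta e^{i\lambda y}\,d\lambda+C e^{iAy}B,\qquad \bar\Omega(y)=\frac1{2\pi}\int_{-\infty}^\infty\frac{\bar R(\zeta)}\zeta e^{-i\lambda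 y}\,d\lambda+\bar C e^{-i\bar Ay}\bar B.$$ Let $\mathcal K(x,y)=\begin{bmatrix}\bar K_1&K_1\\ \bar K_2&K_2\end{bmatrix}$, with entries integrable in $y\in(x,\infty)$ for every $x\in\mathbb R$, be the solution of $$0=\mathcal K(x,y)+\begin{bmatrix}0&\bar\Omega(x+y)\\ \Omega(x+y)&0\end{bmatrix}+\int_x^\infty\begin{bmatrix}-iK_1(x,z)\Omega'(z+y)&\bar K_1(x,z)\bar\Omega(z+y)\\ K_2(x,z)\Omega(z+y)&i\bar K_2(x,z)\bar\Omega'(z+y)\end{bmatrix}dz,\qquad x<y.$$ Then the limits $K_1(x,x):=\lim_{y\to x^+}K_1(x,y)$ and $\bar K_2(x,x):=\lim_{y\to x^+}\bar K_2(x,y)$ exist for every $x\in\mathbb R$, and with $P(x):=K_1(x,x)\bar K_2(x,x)$ the following hold. (a) $P$ is integrable on $\mathbb R$, and $E(x):=\exp\big(\frac i2\int_{-\infty}^xq(y)r(y)\,dy\big)$ and $\mu:=\int_{-\infty}^\infty q(y)r(y)\,dy$ are given by $$E(x)=\exp\Big(2i\int_{-\infty}^xP(z)\,dz\Big),\qquad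 \mu=4\int_{-\infty}^\infty P(z)\,dz.$$ (b) $q(x)=-2K_1(x,x)$ and $r(x)=-2\bar K_2(x,x)$ for all $x\in\mathbb R$. (c) The Jost solution $\psi(\zeta,x)$ exists for all $\zeta$ with $\operatorname{Im}\zeta^2\ge0$ and $$\psi_1(\zeta,x)=\zeta\int_x^\infty K_1(x,y)e^{i\zeta^2y}\,dy,\qquad \psi_2(\zeta,x)=e^{i\zeta^2x}+\int_x^\infty K_2(x,y)e^{i\zeta^2y}\,dy,$$ and the Jost solution $\bar\psi(\zeta,x)$ exists for all $\zeta$ with $\operatorname{Im}\zeta^2\le0$ and $$\bar\psi_1(\zeta,x)=e^{-i\zeta^2x}+\int_x^\infty\bar K_1(x,y)e^{-i\zeta^2y}\,dy,\qquad \bar\psi_2(\zeta,x)=\zeta\int_x^\infty\bar K_2(x,y)e^{-i\zeta^2y}\,dy.$$ -/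

import Mathlib

open Set Filter Topology MeasureTheory

noncomputable section

namespace GI

/-! The linear system and its Jost solutions -/

/-- The coefficient matrix of the linear system with spectral parameter `ζ`. -/
def coeffMatrix (q r : ℝ → ℂ) (ζ : ℂ) (x : ℝ) : Matrix (Fin 2) (Fin 2) ℂ :=
  !![-Complex.I * ζ ^ 2 - Complex.I / 2 * q x * r x, ζ * q x;
     ζ * r x, Complex.I * ζ ^ 2 + Complex.I / 2 * q x * r x]

/-- `f` is a column-vector solution on the whole line of the linear system. -/
def IsSolution (q r : ℝ → ℂ) (ζ : ℂ) (f : ℝ → Fin 2 → ℂ) : Prop :=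
  ∀ x : ℝ, HasDerivAt f ((coeffMatrix q r ζ x).mulVec (f x)) x

/-- `f = (o(1), e^{iζ²x}(1 + o(1)))` as `x → +∞`. -/
def IsJostPsi (q r : ℝ → ℂ) (ζ : ℂ) (f : ℝ → Fin 2 → ℂ) : Prop :=
  IsSolution q r ζ f ∧
  Tendsto (fun x : ℝ => f x 0) atTop (𝓝 0) ∧
  Tendsto (fun x : ℝ => Complex.exp (-Complex.I * ζ ^ 2 * x) * f x 1) atTop (𝓝 1)

/-- `f = (e^{-iζ²x}(1 + o(1)), o(1))` as `x → +∞`. -/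
def IsJostPsiBar (q r : ℝ → ℂ) (ζ : ℂ) (f : ℝ → Fin 2 → ℂ) : Prop :=
  IsSolution q r ζ f ∧
  Tendsto (fun x : ℝ => Complex.exp (Complex.I * ζ ^ 2 * x) * f x 0) atTop (𝓝 1) ∧
  Tendsto (fun x : ℝ => f x 1) atTop (𝓝 0)

/-- `f = (e^{-iζ²x}(1 + o(1)), o(1))` as `x → -∞`. -/
def IsJostPhi (q r : ℝ → ℂ) (ζ : ℂ) (f : ℝ → Fin 2 → ℂ) : Prop :=
  IsSolution q r ζ f ∧
  Tendsto (fun x : ℝ => Complex.exp (Complex.I * ζ ^ 2 * x) * f x 0) atBot (𝓝 1) ∧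
  Tendsto (fun x : ℝ => f x 1) atBot (𝓝 0)

/-- `f = (o(1), e^{iζ²x}(1 + o(1)))` as `x → -∞`. -/
def IsJostPhiBar (q r : ℝ → ℂ) (ζ : ℂ) (f : ℝ → Fin 2 → ℂ) : Prop :=
  IsSolution q r ζ f ∧
  Tendsto (fun x : ℝ => f x 0) atBot (𝓝 0) ∧
  Tendsto (fun x : ℝ => Complex.exp (-Complex.I * ζ ^ 2 * x) * f x 1) atBot (𝓝 1)

/-- The Jost solution `ψ(ζ, ·)`; meaningful for `Im ζ² ≥ 0`, where it is the unique function with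
the property `IsJostPsi`. -/
def psi (q r : ℝ → ℂ) (ζ : ℂ) : ℝ → Fin 2 → ℂ := Classical.epsilon (IsJostPsi q r ζ)

/-- The Jost solution `ψ̄(ζ, ·)`; meaningful for `Im ζ² ≤ 0` (the bar is not a conjugation). -/
def psiBar (q r : ℝ → ℂ) (ζ : ℂ) : ℝ → Fin 2 → ℂ := Classical.epsilon (IsJostPsiBar q r ζ)

/-- The Jost solution `φ(ζ, ·)`; meaningful for `Im ζ² ≥ 0`. -/
def phi (q r : ℝ → ℂ) (ζ : ℂ) : ℝ → Fin 2 → ℂ := Classical.epsilon (IsJostPhi q r ζ)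

/-- The Jost solution `φ̄(ζ, ·)`; meaningful for `Im ζ² ≤ 0`. -/
def phiBar (q r : ℝ → ℂ) (ζ : ℂ) : ℝ → Fin 2 → ℂ := Classical.epsilon (IsJostPhiBar q r ζ)

/-! Scattering coefficients -/

/-- The Wronskian of two column-vector solutions. As the coefficient matrix has zero trace it does
not depend on `x`, and it is evaluated at `x = 0`. -/
def wronskian (f g : ℝ → Fin 2 → ℂ) : ℂ := f 0 0 * g 0 1 - g 0 0 * f 0 1

/-- `T(ζ) = 1 / [φ; ψ]`. -/
def T (q r : ℝ → ℂ) (ζ : ℂ) : ℂ := 1 / wronskian (phi q r ζ) (psi q r ζ)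

/-- `T̄(ζ) = 1 / [ψ̄; φ̄]`. -/
def TBar (q r : ℝ → ℂ) (ζ : ℂ) : ℂ := 1 / wronskian (psiBar q r ζ) (phiBar q r ζ)

/-- The right reflection coefficient `R(ζ) = [φ; ψ̄] / [ψ; φ]`. -/
def R (q r : ℝ → ℂ) (ζ : ℂ) : ℂ :=
  wronskian (phi q r ζ) (psiBar q r ζ) / wronskian (psi q r ζ) (phi q r ζ)

/-- The right reflection coefficient `R̄(ζ) = [φ̄; ψ] / [ψ̄; φ̄]`. -/
def RBar (q r : ℝ → ℂ) (ζ : ℂ) : ℂ :=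
  wronskian (phiBar q r ζ) (psi q r ζ) / wronskian (psiBar q r ζ) (phiBar q r ζ)

/-- `ζ = √l`, the principal square root of the parameter `l = ζ²`. -/
def zeta (l : ℂ) : ℂ := l ^ (1 / 2 : ℂ)

/-- The transmission coefficients have no poles at real values of `ζ²`
(there are no spectral singularities). -/
def NoSpectralSingularity (q r : ℝ → ℂ) : Prop :=
  ∀ l : ℝ, wronskian (phi q r (zeta l)) (psi q r (zeta l)) ≠ 0 ∧
    wronskian (psiBar q r (zeta l)) (phiBar q r (zeta l)) ≠ 0

/-- The Fourier transform of `R(ζ) / ζ`. -/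
def RHat (q r : ℝ → ℂ) (y : ℝ) : ℂ :=
  1 / (2 * Real.pi) * ∫ l : ℝ, R q r (zeta l) / zeta l * Complex.exp (Complex.I * l * y)

/-- The Fourier transform of `R̄(ζ) / ζ`, with the opposite sign in the exponent. -/
def RBarHat (q r : ℝ → ℂ) (y : ℝ) : ℂ :=
  1 / (2 * Real.pi) * ∫ l : ℝ, RBar q r (zeta l) / zeta l * Complex.exp (-Complex.I * l * y)

/-! Bound states and matrix triplets -/

/-- Locations `lam j` of the poles (in the parameter `l = ζ²`), their multiplicities, and constants
`c j k`, `0 ≤ k < mult j`. -/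
structure BoundStateData where
  N : ℕ
  lam : Fin N → ℂ
  mult : Fin N → ℕ
  c : (j : Fin N) → Fin (mult j) → ℂ

namespace BoundStateData

/-- The index set of the triplet; it has `∑ j, mult j` elements. -/
abbrev Index (D : BoundStateData) : Type := Σ j : Fin D.N, Fin (D.mult j)

/-- The upper triangular Jordan block of size `m` with eigenvalue `l`. -/
def jordanBlock (l : ℂ) (m : ℕ) : Matrix (Fin m) (Fin m) ℂ :=
  Matrix.of fun a b => if a = b then l else if (a : ℕ) + 1 = b then 1 else 0

/-- The block diagonal matrix of the Jordan blocks. -/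
def matA (D : BoundStateData) : Matrix D.Index D.Index ℂ :=
  Matrix.blockDiagonal' fun j => jordanBlock (D.lam j) (D.mult j)

/-- The column vector with blocks `(0, …, 0, 1)`. -/
def vecB (D : BoundStateData) : D.Index → ℂ :=
  fun p => if (p.2 : ℕ) + 1 = D.mult p.1 then 1 else 0

/-- The row vector with blocks `(c j (m - 1), …, c j 1, c j 0)`. -/
def vecC (D : BoundStateData) : D.Index → ℂ := fun p => D.c p.1 p.2.rev

/-- The scalar `C e^{wA} B`. -/
def expSandwich (D : BoundStateData) (w : ℂ) : ℂ :=
  dotProduct D.vecC ((NormedSpace.exp (w • D.matA)).mulVec D.vecB)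

/-- `D` lists the poles in the region `H` of the function `τ` of `l`, with their multiplicities and
the normalization constants `c j k`. The latter are built from the Laurent coefficients `t k` of `τ`
at the pole and from the dependency constants `γ k`, which express the proportionality of `Φ` and
`Ψ` at the pole, up to order `mult j - 1` in `l`, for all `x`. -/
def Represents (D : BoundStateData) (H : Set ℂ) (τ : ℂ → ℂ) (Φ Ψ : ℂ → ℝ → Fin 2 → ℂ) (s : ℂ) :
    Prop :=
  Function.Injective D.lam ∧
  Set.range D.lam = {l | l ∈ H ∧ meromorphicOrderAt τ l < 0} ∧
  ∀ j : Fin D.N,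
    meromorphicOrderAt τ (D.lam j) = ((-(D.mult j : ℤ) : ℤ) : WithTop ℤ) ∧
    ∃ t γ : ℕ → ℂ,
      (∃ g : ℂ → ℂ, AnalyticAt ℂ g (D.lam j) ∧
        ∀ᶠ l in 𝓝[≠] (D.lam j),
          τ l = (∑ k ∈ Finset.Icc 1 (D.mult j), t k / (l - D.lam j) ^ k) + g l) ∧
      (∀ (x : ℝ) (i : Fin 2) (k : ℕ), k < D.mult j →
        iteratedDeriv k (fun l : ℂ => Φ l x i) (D.lam j) =
          ∑ n ∈ Finset.range (k + 1),
            (k.choose n : ℂ) * γ (k - n) * iteratedDeriv n (fun l : ℂ => Ψ l x i) (D.lam j)) ∧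
      ∀ k : Fin (D.mult j),
        D.c j k =
          s * ∑ n ∈ Finset.range (D.mult j - k), t (k + n + 1) * γ n / (n.factorial : ℂ)

end BoundStateData

/-- `D` is the bound-state information attached to the poles of `T` in `Im ζ² > 0`; the dependency
constants relate `(φ₁, φ₂ / ζ)` to `(ζ ψ₁, ψ₂)`, four functions of `l = ζ²`. -/
def IsBoundStateInfo (q r : ℝ → ℂ) (D : BoundStateData) : Prop :=
  D.Represents {l | 0 < l.im} (fun l => T q r (zeta l))
    (fun l x => ![phi q r (zeta l) x 0, phi q r (zeta l) x 1 / zeta l])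
    (fun l x => ![zeta l * psi q r (zeta l) x 0, psi q r (zeta l) x 1])
    (-Complex.I)

/-- `D` is the bound-state information attached to the poles of `T̄` in `Im ζ² < 0`; the dependency
constants relate `(φ̄₁ / ζ, φ̄₂)` to `(ψ̄₁, ζ ψ̄₂)`. -/
def IsBoundStateInfoBar (q r : ℝ → ℂ) (D : BoundStateData) : Prop :=
  D.Represents {l | l.im < 0} (fun l => TBar q r (zeta l))
    (fun l x => ![phiBar q r (zeta l) x 0 / zeta l, phiBar q r (zeta l) x 1])
    (fun l x => ![psiBar q r (zeta l) x 0, zeta l * psiBar q r (zeta l) x 1])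
    Complex.I

/-! The Marchenko system -/

/-- `Ω(y) = R̂(y) + C e^{iAy} B`. -/
def Om (q r : ℝ → ℂ) (D : BoundStateData) (y : ℝ) : ℂ :=
  RHat q r y + D.expSandwich (Complex.I * y)

/-- `Ω̄(y)`, the Fourier transform of `R̄(ζ) / ζ` plus `C̄ e^{-iĀy} B̄`. -/
def OmBar (q r : ℝ → ℂ) (D : BoundStateData) (y : ℝ) : ℂ :=
  RBarHat q r y + D.expSandwich (-Complex.I * y)

/-- `K` solves the Marchenko system with kernel functions `ω`, `ωbar`, where
`K x y = !![K̄₁, K₁; K̄₂, K₂]`: its entries are integrable in `y` on `(x, ∞)`, and the system holds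
for `x < y`. -/
def IsMarchenkoSolution (ω ωbar : ℝ → ℂ) (K : ℝ → ℝ → Matrix (Fin 2) (Fin 2) ℂ) : Prop :=
  (∀ (x : ℝ) (i j : Fin 2), IntegrableOn (fun y => K x y i j) (Ioi x)) ∧
  ∀ x y : ℝ, x < y →
    0 = K x y + !![0, ωbar (x + y); ω (x + y), 0] +
      !![∫ z in Ioi x, -Complex.I * K x z 0 1 * deriv ω (z + y),
         ∫ z in Ioi x, K x z 0 0 * ωbar (z + y);
         ∫ z in Ioi x, K x z 1 1 * ω (z + y),
         ∫ z in Ioi x, Complex.I * K x z 1 0 * deriv ωbar (z + y)]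

/-! Quantities built from the potentials -/

/-- `E(x) = exp((i/2) ∫_{-∞}^x q r)`. -/
def E (q r : ℝ → ℂ) (x : ℝ) : ℂ := Complex.exp (Complex.I / 2 * ∫ y in Iic x, q y * r y)

/-- `μ = ∫ q r` over the real line. -/
def mu (q r : ℝ → ℂ) : ℂ := ∫ y : ℝ, q y * r y

end GI

end

namespace AKNS

open scoped BoundedContinuousFunction SchwartzMap

/-! ### The transformation kernel -/

/-! With λ = ζ², the system is a disguised pair of AKNS systems u' = -iλu + Qv, v' = iλv + Ru. Let
`potLow` = -(i/2)r' - r²q/4 and `potUp` = (i/2)q' - q²r/4. The AKNS Jost solutions for the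
potentials (q, `potLow`) and (`potUp`, r) are related by an explicit substitution (`jost_gauge`),
and ψ takes one component from each: ψ₁ is ζ times the first component for (q, `potLow`), and ψ₂ is
the second component for (`potUp`, r) (`psi_spec`). In the same way ψ̄ comes from (r, `potUp`) and
(`potLow`, q) at -λ.

An AKNS Jost solution is e^{iλx} times a one-sided Laplace transform of a continuous kernel, plus 1
in the second component (`exists_kernel`, `IsKernel.lap_one`, `IsKernel.lap_two`), and at s = 0 the
first kernel equals -Q/2 (`kerOne_zero`). So once the entries of the Marchenko solution are known to
be these kernels (`eq_ker`), the diagonal values are -q/2 and -r/2, their product is qr/4, and (a),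
(b), (c) can be read off. Everything else serves this identification.

The kernels solve Marchenko equations. On the real line the left Jost solution divided by the
Wronskian a(λ) is a combination of the right ones (`leftOne_div`, `leftTwo_div`), with a reflection
coefficient of size O(λ⁻²). In the upper half-plane the quotient is meromorphic; near a zero of a it
equals Γ/a times the right Jost solution, up to an analytic term. Multiplying by an exponential and
by (1 - iελ)⁻², which makes the contour integrals converge absolutely, applying the residue theorem
(`integral_eq_sum_circleIntegral`) and letting ε → 0 yields the equation
(`marchenko_of_scattering`). The matrix triplet term is the sum of the residues: the dependency
constants are the Taylor data of Γ, and the exponential of a Jordan block reproduces the derivatives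
of the exponential in λ (`exists_depFun`).

The substitution preserves a and multiplies both the reflection coefficient and Γ by a constant
times λ (`reflCoef_gauge`, `scat_pair`). Hence the Marchenko kernel of one system is a multiple of
the derivative of the other's (`Scat.isKernelFun_deriv`). This is why Ω' and Ω̄' occur, and why the
two rows of the system are the Marchenko systems of the pairs (q, `potLow`) and (r, `potUp`).

Uniqueness uses neither smallness nor symmetry of the data. The kernels solve the equations on every
half-line (x', ∞) with x' > x. Pairing them with a homogeneous solution on (x, ∞) and transposing
the integral operators cancels every integral over (x', ∞); what is left is a Volterra inequality on
(x, x'], so the homogeneous solution is zero (`eq_zero_of_homogeneous_marchenko`). -/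

/-- A decreasing integrable majorant of `1 / (1 + u ^ 2)`. -/
noncomputable def majorant (u : ℝ) : ℝ := (1 + (max u 0) ^ 2)⁻¹

lemma majorant_pos (u : ℝ) : 0 < majorant u := by unfold majorant; positivity

lemma majorant_le_one (u : ℝ) : majorant u ≤ 1 := by
  unfold majorant
  exact inv_le_one_of_one_le₀ (by nlinarith [sq_nonneg (max u 0)])

lemma antitone_majorant : Antitone majorant := by
  intro a b hab
  unfold majorant
  have : max a 0 ≤ max b 0 := max_le_max_right 0 hab
  have h0 : 0 ≤ max a 0 := le_max_right a 0
  gcongr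

@[fun_prop]
lemma continuous_majorant : Continuous majorant := by
  unfold majorant
  refine Continuous.inv₀ (by fun_prop) fun u => by positivity

lemma inv_one_add_sq_le_majorant (u : ℝ) : (1 + u ^ 2)⁻¹ ≤ majorant u := by
  unfold majorant
  have : (max u 0) ^ 2 ≤ u ^ 2 := by
    rcases le_total u 0 with h | h
    · simp [h, sq_nonneg]
    · simp [h]
  gcongr

/-- A shift by x costs only a factor quadratic in x. This keeps integrability in s for very negative
x too, where the majorant equals 1 on a long initial interval. -/
lemma majorant_add_half_le (x : ℝ) {s : ℝ} (hs : 0 ≤ s) :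
    majorant (x + s / 2) ≤ 8 * (1 + x ^ 2) * (1 + s ^ 2)⁻¹ := by
  unfold majorant
  set M := max (x + s / 2) 0 with hM
  have h1 : x + s / 2 ≤ M := le_max_left _ _
  have h0 : 0 ≤ M := le_max_right _ _
  rw [← div_eq_mul_inv, inv_eq_one_div, div_le_div_iff₀ (by positivity) (by positivity)]
  have h2 : s ≤ 2 * (M + |x|) := by linarith [neg_abs_le x]
  have h3 : s ^ 2 ≤ (2 * (M + |x|)) ^ 2 := by gcongr
  have h4 : |x| ^ 2 = x ^ 2 := sq_abs x
  nlinarith [sq_nonneg (M - |x|), mul_nonneg (sq_nonneg x) (sq_nonneg M)]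

lemma integrableOn_majorant (x : ℝ) : IntegrableOn (fun s => majorant (x + s / 2)) (Ioi 0) := by
  refine Integrable.mono' ((integrable_inv_one_add_sq.const_mul (8 * (1 + x ^ 2))).integrableOn)
    (by fun_prop) ?_
  filter_upwards [ae_restrict_mem measurableSet_Ioi] with s hs
  rw [Real.norm_of_nonneg (majorant_pos _).le]
  exact majorant_add_half_le x (le_of_lt hs)

/-- `q` is a continuous potential which is bounded by `G / (1 + x ^ 2)`. -/
structure Pot (G : ℝ) (q : ℝ → ℂ) : Prop where
  cont : Continuous q
  bound : ∀ x, ‖q x‖ ≤ G * (1 + x ^ 2)⁻¹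

namespace Pot

variable {G : ℝ} {q : ℝ → ℂ}

lemma nonneg (h : Pot G q) : 0 ≤ G := by
  have := (norm_nonneg _).trans (h.bound 0)
  simpa using this

lemma mono {G' : ℝ} (h : Pot G q) (hG : G ≤ G') : Pot G' q :=
  ⟨h.cont, fun x => (h.bound x).trans (by gcongr)⟩

lemma integrable (h : Pot G q) : Integrable q :=
  (integrable_inv_one_add_sq.const_mul G).mono' h.cont.aestronglyMeasurable
    (Eventually.of_forall h.bound)

lemma norm_le (h : Pot G q) (x : ℝ) : ‖q x‖ ≤ G := by
  refine (h.bound x).trans ?_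
  have : (1 + x ^ 2)⁻¹ ≤ 1 := inv_le_one_of_one_le₀ (by nlinarith [sq_nonneg x])
  nlinarith [h.nonneg]

end Pot

/-! ### Weighted contraction for the kernel equations -/

/-- The weight for the contraction argument. -/
noncomputable def weight (G : ℝ) (p : ℝ × ℝ) : ℝ :=
  majorant (p.1 + max p.2 0 / 2) * Real.exp (-2 * G * Real.arctan p.1)

lemma weight_pos (G : ℝ) (p : ℝ × ℝ) : 0 < weight G p :=
  mul_pos (majorant_pos _) (Real.exp_pos _)

@[fun_prop]
lemma continuous_weight (G : ℝ) : Continuous (weight G) := by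
  unfold weight
  fun_prop

lemma weight_le {G : ℝ} (hG : 0 ≤ G) (p : ℝ × ℝ) :
    weight G p ≤ Real.exp (Real.pi * G) * majorant (p.1 + max p.2 0 / 2) := by
  unfold weight
  rw [mul_comm]
  have := Real.neg_pi_div_two_lt_arctan p.1
  have h : Real.exp (-2 * G * Real.arctan p.1) ≤ Real.exp (Real.pi * G) :=
    Real.exp_le_exp.2 (by nlinarith)
  have := (majorant_pos (p.1 + max p.2 0 / 2)).le
  gcongr

lemma majorant_le_weight {G : ℝ} (hG : 0 ≤ G) (p : ℝ × ℝ) :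
    majorant (p.1 + max p.2 0 / 2) ≤ Real.exp (Real.pi * G) * weight G p := by
  unfold weight
  have := Real.arctan_lt_pi_div_two p.1
  have h1 : 1 ≤ Real.exp (Real.pi * G) * Real.exp (-2 * G * Real.arctan p.1) := by
    rw [← Real.exp_add]
    apply Real.one_le_exp
    nlinarith
  nlinarith [majorant_pos (p.1 + max p.2 0 / 2)]

/-- The exponential factor of the weight is chosen so that differentiating it produces the bound
G/(1 + t²) of the potentials. Integrating a potential against the weight therefore gives back at
most half of the weight, and this half is the contraction constant. -/
lemma hasDerivAt_exp_arctan (G x : ℝ) :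
    HasDerivAt (fun t => -(1 / 2) * Real.exp (-2 * G * Real.arctan t))
      (G * (1 + x ^ 2)⁻¹ * Real.exp (-2 * G * Real.arctan x)) x := by
  have h := (((Real.hasDerivAt_arctan x).const_mul (-2 * G)).exp).const_mul (-(1 / 2))
  convert! h using 1
  ring

lemma continuous_exp_arctan (G : ℝ) : Continuous
    fun t => G * (1 + t ^ 2)⁻¹ * Real.exp (-2 * G * Real.arctan t) := by
  have : Continuous fun t : ℝ => (1 + t ^ 2)⁻¹ :=
    Continuous.inv₀ (by fun_prop) fun u => by positivity
  fun_prop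

lemma tendsto_exp_arctan (G : ℝ) :
    Tendsto (fun t => -(1 / 2) * Real.exp (-2 * G * Real.arctan t)) atTop
      (𝓝 (-(1 / 2) * Real.exp (-2 * G * (Real.pi / 2)))) :=
  ((((Real.tendsto_arctan_atTop.mono_right nhdsWithin_le_nhds).const_mul (-2 * G)).rexp).const_mul
    (-(1 / 2)))

lemma integrableOn_exp_arctan {G : ℝ} (hG : 0 ≤ G) (x : ℝ) :
    IntegrableOn (fun t => G * (1 + t ^ 2)⁻¹ * Real.exp (-2 * G * Real.arctan t)) (Ioi x) :=
  integrableOn_Ioi_deriv_of_nonneg' (fun t _ => hasDerivAt_exp_arctan G t)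
    (fun t _ => by positivity) (tendsto_exp_arctan G)

lemma integral_exp_arctan_le {G : ℝ} (hG : 0 ≤ G) (x : ℝ) :
    ∫ t in Ioi x, G * (1 + t ^ 2)⁻¹ * Real.exp (-2 * G * Real.arctan t) ≤
      1 / 2 * Real.exp (-2 * G * Real.arctan x) := by
  rw [integral_Ioi_of_hasDerivAt_of_nonneg' (fun t _ => hasDerivAt_exp_arctan G t)
    (fun t _ => by positivity) (tendsto_exp_arctan G)]
  have := Real.exp_pos (-2 * G * (Real.pi / 2))
  linarith

/-- The integral operator along the lines `s = const`. -/
noncomputable def opTwo (r : ℝ → ℂ) (f : ℝ × ℝ → ℂ) (p : ℝ × ℝ) : ℂ :=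
  -∫ t in Ioi p.1, r t * f (t, p.2)

/-- The integral operator along the lines `x + s / 2 = const`. -/
noncomputable def opOne (q : ℝ → ℂ) (f : ℝ × ℝ → ℂ) (p : ℝ × ℝ) : ℂ :=
  -∫ τ in (0 : ℝ)..(max p.2 0 / 2), q (p.1 + τ) * f (p.1 + τ, max p.2 0 - 2 * τ)

section Operators

variable {G M : ℝ} {q r : ℝ → ℂ} {f : ℝ × ℝ → ℂ}

/-- Along s = const the argument of the majorant increases with t, so that factor may be frozen at
the starting point; only the exponential factor is left to integrate. -/
lemma opTwo_integrand_le (hr : Pot G r) (hfb : ∀ p, ‖f p‖ ≤ M * weight G p) {x t : ℝ}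
    (hxt : x ≤ t) (s : ℝ) : ‖r t * f (t, s)‖ ≤ M * majorant (x + max s 0 / 2) *
      (G * (1 + t ^ 2)⁻¹ * Real.exp (-2 * G * Real.arctan t)) := by
  have hM : 0 ≤ M := by
    have := (norm_nonneg _).trans (hfb 0)
    exact nonneg_of_mul_nonneg_left this (weight_pos _ _)
  have hG := hr.nonneg
  rw [norm_mul]
  calc ‖r t‖ * ‖f (t, s)‖ ≤ (G * (1 + t ^ 2)⁻¹) * (M * weight G (t, s)) := by
        gcongr
        · exact hr.bound t
        · exact hfb _
    _ ≤ (G * (1 + t ^ 2)⁻¹) * (M * (majorant (x + max s 0 / 2) *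
          Real.exp (-2 * G * Real.arctan t))) := by
        unfold weight
        gcongr
        exact antitone_majorant (by simpa using hxt)
    _ = _ := by ring

lemma opTwo_integrableOn (hr : Pot G r) (hf : Continuous f) (hfb : ∀ p, ‖f p‖ ≤ M * weight G p)
    (p : ℝ × ℝ) : IntegrableOn (fun t => r t * f (t, p.2)) (Ioi p.1) := by
  have hc := hr.cont
  refine Integrable.mono' ((integrableOn_exp_arctan hr.nonneg p.1).const_mul
    (M * majorant (p.1 + max p.2 0 / 2))) (by fun_prop) ?_
  filter_upwards [ae_restrict_mem measurableSet_Ioi] with t ht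
  exact opTwo_integrand_le hr hfb (le_of_lt ht) _

lemma norm_opTwo_le (hr : Pot G r) (hfb : ∀ p, ‖f p‖ ≤ M * weight G p)
    (p : ℝ × ℝ) : ‖opTwo r f p‖ ≤ M / 2 * weight G p := by
  have hM : 0 ≤ M := by
    have := (norm_nonneg _).trans (hfb 0)
    exact nonneg_of_mul_nonneg_left this (weight_pos _ _)
  unfold opTwo
  rw [norm_neg]
  refine (norm_integral_le_of_norm_le ((integrableOn_exp_arctan hr.nonneg p.1).const_mul
    (M * majorant (p.1 + max p.2 0 / 2))) ?_).trans ?_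
  · filter_upwards [ae_restrict_mem measurableSet_Ioi] with t ht
    exact opTwo_integrand_le hr hfb (le_of_lt ht) _
  · rw [integral_const_mul]
    have := integral_exp_arctan_le hr.nonneg p.1
    unfold weight
    calc _ ≤ M * majorant (p.1 + max p.2 0 / 2) * (1 / 2 * Real.exp (-2 * G * Real.arctan p.1)) := by
          have := majorant_pos (p.1 + max p.2 0 / 2)
          gcongr
      _ = _ := by ring

lemma continuous_opTwo (hr : Pot G r) (hf : Continuous f)
    (hfb : ∀ p, ‖f p‖ ≤ M * weight G p) : Continuous (opTwo r f) := by
  have hc := hr.cont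
  -- Splitting at 0 separates the moving end point from the infinite range: the first integral is
  -- continuous by domination, the second as an integral of a continuous function over a moving
  -- interval.
  have h1 : opTwo r f = fun p => -((∫ t in Ioi (0 : ℝ), r t * f (t, p.2)) -
      ∫ t in (0 : ℝ)..p.1, r t * f (t, p.2)) := by
    ext p
    unfold opTwo
    rw [← intervalIntegral.integral_interval_add_Ioi (opTwo_integrableOn hr hf hfb (0, p.2))
      (opTwo_integrableOn hr hf hfb p)]
    simp
  rw [h1]
  have h2 : Continuous fun p : ℝ × ℝ => ∫ t in Ioi (0 : ℝ), r t * f (t, p.2) := by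
    refine continuous_of_dominated (bound := fun t => M * 1 *
      (G * (1 + t ^ 2)⁻¹ * Real.exp (-2 * G * Real.arctan t))) (fun p => by fun_prop) ?_ ?_ ?_
    · intro p
      filter_upwards [ae_restrict_mem measurableSet_Ioi] with t ht
      refine (opTwo_integrand_le hr hfb (le_of_lt ht) _).trans ?_
      have hM : 0 ≤ M := by
        have := (norm_nonneg _).trans (hfb 0)
        exact nonneg_of_mul_nonneg_left this (weight_pos _ _)
      have hG := hr.nonneg
      gcongr
      exact majorant_le_one _
    · exact (integrableOn_exp_arctan hr.nonneg 0).const_mul _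
    · exact Eventually.of_forall fun t => by fun_prop
  have h3 : Continuous fun p : ℝ × ℝ => ∫ t in (0 : ℝ)..p.1, r t * f (t, p.2) :=
    intervalIntegral.continuous_parametric_intervalIntegral_of_continuous
      (f := fun (p : ℝ × ℝ) t => r t * f (t, p.2)) (by fun_prop) continuous_fst
  fun_prop

/-- The majorant factor is constant along this line, because x + s/2 is. The estimate for the other
operator is applied at its own starting point for each τ. -/
lemma opOne_integrand_le (hq : Pot G q) (hfb : ∀ p, ‖f p‖ ≤ M * weight G p) (p : ℝ × ℝ) {τ : ℝ}
    (hτ : τ ≤ max p.2 0 / 2) : ‖q (p.1 + τ) * f (p.1 + τ, max p.2 0 - 2 * τ)‖ ≤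
      M * majorant (p.1 + max p.2 0 / 2) *
      (G * (1 + (p.1 + τ) ^ 2)⁻¹ * Real.exp (-2 * G * Real.arctan (p.1 + τ))) := by
  have h := opTwo_integrand_le (M := M) (f := f) hq hfb (le_refl (p.1 + τ)) (max p.2 0 - 2 * τ)
  rw [max_eq_left (a := max p.2 0 - 2 * τ) (by linarith)] at h
  rwa [show p.1 + τ + (max p.2 0 - 2 * τ) / 2 = p.1 + max p.2 0 / 2 by ring] at h

lemma norm_opOne_le (hq : Pot G q) (hfb : ∀ p, ‖f p‖ ≤ M * weight G p)
    (p : ℝ × ℝ) : ‖opOne q f p‖ ≤ M / 2 * weight G p := by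
  have hM : 0 ≤ M := by
    have := (norm_nonneg _).trans (hfb 0)
    exact nonneg_of_mul_nonneg_left this (weight_pos _ _)
  have h0 : 0 ≤ max p.2 0 / 2 := by positivity
  have hcont := continuous_exp_arctan G
  unfold opOne
  rw [norm_neg]
  refine (intervalIntegral.norm_integral_le_of_norm_le h0 (g := fun τ =>
    M * majorant (p.1 + max p.2 0 / 2) *
      (G * (1 + (p.1 + τ) ^ 2)⁻¹ * Real.exp (-2 * G * Real.arctan (p.1 + τ)))) ?_ ?_).trans ?_
  · exact Eventually.of_forall fun τ hτ => opOne_integrand_le hq hfb p hτ.2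
  · exact (continuous_const.mul (hcont.comp (by fun_prop : Continuous fun τ => p.1 + τ))
      ).intervalIntegrable _ _
  · rw [intervalIntegral.integral_const_mul,
      intervalIntegral.integral_comp_add_left
        (fun t => G * (1 + t ^ 2)⁻¹ * Real.exp (-2 * G * Real.arctan t)),
      intervalIntegral.integral_eq_sub_of_hasDerivAt (fun t _ => hasDerivAt_exp_arctan G t)
        (hcont.intervalIntegrable _ _)]
    have := Real.exp_pos (-2 * G * Real.arctan (p.1 + max p.2 0 / 2))
    unfold weight
    calc _ ≤ M * majorant (p.1 + max p.2 0 / 2) * (1 / 2 * Real.exp (-2 * G * Real.arctan p.1)) := by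
          have := majorant_pos (p.1 + max p.2 0 / 2)
          gcongr
          simp only [add_zero]
          linarith
      _ = _ := by ring

lemma continuous_opOne (hq : Continuous q) (hf : Continuous f) : Continuous (opOne q f) := by
  refine Continuous.neg ?_
  exact intervalIntegral.continuous_parametric_intervalIntegral_of_continuous
      (f := fun (p : ℝ × ℝ) τ => q (p.1 + τ) * f (p.1 + τ, max p.2 0 - 2 * τ))
      (by fun_prop) (by fun_prop)

lemma opTwo_sub {g : ℝ × ℝ → ℂ} (hr : Pot G r) (hf : Continuous f)
    (hfb : ∀ p, ‖f p‖ ≤ M * weight G p) {M' : ℝ} (hg : Continuous g)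
    (hgb : ∀ p, ‖g p‖ ≤ M' * weight G p) (p : ℝ × ℝ) :
    opTwo r f p - opTwo r g p = opTwo r (f - g) p := by
  simp only [opTwo, Pi.sub_apply, mul_sub]
  rw [integral_sub (opTwo_integrableOn hr hf hfb p) (opTwo_integrableOn hr hg hgb p)]
  ring

lemma opOne_sub {g : ℝ × ℝ → ℂ} (hq : Continuous q) (hf : Continuous f) (hg : Continuous g)
    (p : ℝ × ℝ) : opOne q f p - opOne q g p = opOne q (f - g) p := by
  simp only [opOne, Pi.sub_apply, mul_sub]
  rw [intervalIntegral.integral_sub]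
  · ring
  · exact Continuous.intervalIntegrable (by fun_prop) _ _
  · exact Continuous.intervalIntegrable (by fun_prop) _ _

end Operators

/-- Existence of the transformation kernel of an AKNS system. -/
theorem exists_kernel {G : ℝ} {q r : ℝ → ℂ} (hq : Pot G q) (hr : Pot G r) :
    ∃ (k₁ k₂ : ℝ × ℝ → ℂ) (C : ℝ), Continuous k₁ ∧ Continuous k₂ ∧
      (∀ x s, 0 ≤ s → ‖k₁ (x, s)‖ ≤ C * majorant (x + s / 2)) ∧
      (∀ x s, 0 ≤ s → ‖k₂ (x, s)‖ ≤ C * majorant (x + s / 2)) ∧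
      (∀ x s, 0 ≤ s → k₁ (x, s) = -(1 / 2) * q (x + s / 2) -
        ∫ τ in (0 : ℝ)..(s / 2), q (x + τ) * k₂ (x + τ, s - 2 * τ)) ∧
      (∀ x s, 0 ≤ s → k₂ (x, s) = -∫ t in Ioi x, r t * k₁ (t, s)) := by
  have hG := hq.nonneg
  have hqc := hq.cont
  -- The unknown is the kernel divided by the weight, so the contraction takes place in the ordinary
  -- space of bounded continuous functions. The maxima with 0 extend the equations to s < 0, which
  -- makes the whole plane available.
  set W : ℝ × ℝ → ℂ := fun p => (weight G p : ℂ) with hW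
  have hWc : Continuous W := Complex.continuous_ofReal.comp (continuous_weight G)
  have hW0 : ∀ p, W p ≠ 0 := fun p => by simp [hW, (weight_pos G p).ne']
  have hWn : ∀ p, ‖W p‖ = weight G p := fun p => by
    simp [hW, abs_of_pos (weight_pos G p)]
  let S : ℝ × ℝ → ℂ := fun p => -(1 / 2) * q (p.1 + max p.2 0 / 2)
  have hSc : Continuous S := by fun_prop
  have hSb : ∀ p, ‖S p‖ ≤ G * Real.exp (Real.pi * G) * weight G p := by
    intro p
    have h1 : ‖S p‖ = 1 / 2 * ‖q (p.1 + max p.2 0 / 2)‖ := by simp [S]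
    rw [h1]
    have h2 := hq.bound (p.1 + max p.2 0 / 2)
    have h3 := inv_one_add_sq_le_majorant (p.1 + max p.2 0 / 2)
    have h4 := majorant_le_weight hG p
    have h5 : ‖q (p.1 + max p.2 0 / 2)‖ ≤ G * (Real.exp (Real.pi * G) * weight G p) :=
      h2.trans (by gcongr; exact h3.trans h4)
    have h6 := norm_nonneg (q (p.1 + max p.2 0 / 2))
    rw [mul_assoc]
    linarith
  have hb1 : ∀ (κ : (ℝ × ℝ) →ᵇ ℂ × ℂ) p, ‖W p * (κ p).1‖ ≤ ‖κ‖ * weight G p := fun κ p => by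
    rw [norm_mul, hWn, mul_comm]
    exact mul_le_mul_of_nonneg_right ((norm_fst_le _).trans (κ.norm_coe_le_norm p))
      (weight_pos G p).le
  have hb2 : ∀ (κ : (ℝ × ℝ) →ᵇ ℂ × ℂ) p, ‖W p * (κ p).2‖ ≤ ‖κ‖ * weight G p := fun κ p => by
    rw [norm_mul, hWn, mul_comm]
    exact mul_le_mul_of_nonneg_right ((norm_snd_le _).trans (κ.norm_coe_le_norm p))
      (weight_pos G p).le
  have hc1 : ∀ (κ : (ℝ × ℝ) →ᵇ ℂ × ℂ), Continuous fun p => W p * (κ p).1 := fun κ => by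
    fun_prop
  have hc2 : ∀ (κ : (ℝ × ℝ) →ᵇ ℂ × ℂ), Continuous fun p => W p * (κ p).2 := fun κ => by
    fun_prop
  let F : ((ℝ × ℝ) →ᵇ ℂ × ℂ) → (ℝ × ℝ) → ℂ × ℂ := fun κ p =>
    ((W p)⁻¹ * (S p + opOne q (fun p => W p * (κ p).2) p),
      (W p)⁻¹ * opTwo r (fun p => W p * (κ p).1) p)
  have hFc : ∀ κ, Continuous (F κ) := fun κ => by
    have h1 := continuous_opOne hqc (hc2 κ)
    have h2 := continuous_opTwo hr (hc1 κ) (hb1 κ)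
    have h3 := hWc.inv₀ hW0
    exact (h3.mul (hSc.add h1)).prodMk (h3.mul h2)
  have key : ∀ (p : ℝ × ℝ) (z : ℂ) (B : ℝ), ‖z‖ ≤ B * weight G p → ‖(W p)⁻¹ * z‖ ≤ B := by
    intro p z B h
    rw [norm_mul, norm_inv, hWn, inv_mul_le_iff₀ (weight_pos G p), mul_comm]
    exact h
  have hFb : ∀ κ p, ‖F κ p‖ ≤ G * Real.exp (Real.pi * G) + ‖κ‖ / 2 := fun κ p => by
    refine norm_prod_le_iff.2 ⟨key _ _ _ ?_, key _ _ _ ?_⟩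
    · refine (norm_add_le _ _).trans ?_
      rw [add_mul]
      exact add_le_add (hSb p) (norm_opOne_le hq (hb2 κ) p)
    · refine (norm_opTwo_le hr (hb1 κ) p).trans ?_
      have := (weight_pos G p).le
      gcongr
      have : 0 ≤ G * Real.exp (Real.pi * G) := by positivity
      linarith
  let Φ : ((ℝ × ℝ) →ᵇ ℂ × ℂ) → ((ℝ × ℝ) →ᵇ ℂ × ℂ) := fun κ =>
    BoundedContinuousFunction.ofNormedAddCommGroup (F κ) (hFc κ) _ (hFb κ)
  have hΦ : ContractingWith (1 / 2) Φ := by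
    refine ⟨by norm_num, LipschitzWith.of_dist_le_mul fun κ κ' => ?_⟩
    rw [BoundedContinuousFunction.dist_le (by positivity)]
    intro p
    have hd : ‖κ - κ'‖ / 2 = ((1 / 2 : NNReal) : ℝ) * dist κ κ' := by
      rw [dist_eq_norm]; push_cast; ring
    rw [← hd, dist_eq_norm]
    change ‖F κ p - F κ' p‖ ≤ _
    refine norm_prod_le_iff.2 ⟨?_, ?_⟩
    · have h1 : (F κ p - F κ' p).1 = (W p)⁻¹ * opOne q (fun p => W p * ((κ - κ') p).2) p := by
        have := opOne_sub hqc (hc2 κ) (hc2 κ') p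
        simp only [F, Prod.fst_sub]
        rw [← mul_sub, add_sub_add_left_eq_sub, this]
        congr 2
        ext p
        simp [mul_sub]
      rw [h1]
      exact key _ _ _ (norm_opOne_le hq (hb2 _) p)
    · have h1 : (F κ p - F κ' p).2 = (W p)⁻¹ * opTwo r (fun p => W p * ((κ - κ') p).1) p := by
        have := opTwo_sub hr (hc1 κ) (hb1 κ) (hc1 κ') (hb1 κ') p
        simp only [F, Prod.snd_sub]
        rw [← mul_sub, this]
        congr 2
        ext p
        simp [mul_sub]
      rw [h1]
      exact key _ _ _ (norm_opTwo_le hr (hb1 _) p)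
  obtain ⟨κ, hκ, -, -⟩ := hΦ.exists_fixedPoint 0 (edist_ne_top _ _)
  have hfix : ∀ p, F κ p = κ p := fun p => by
    have := congrArg (fun g : (ℝ × ℝ) →ᵇ ℂ × ℂ => g p) hκ
    exact this
  have hfix1 : ∀ p, W p * (κ p).1 = S p + opOne q (fun p => W p * (κ p).2) p := fun p => by
    rw [← hfix p]
    simp only [F]
    rw [mul_inv_cancel_left₀ (hW0 p)]
  have hfix2 : ∀ p, W p * (κ p).2 = opTwo r (fun p => W p * (κ p).1) p := fun p => by
    rw [← hfix p]
    simp only [F]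
    rw [mul_inv_cancel_left₀ (hW0 p)]
  have hbd : ∀ x s, 0 ≤ s → ‖κ‖ * weight G (x, s) ≤
      ‖κ‖ * Real.exp (Real.pi * G) * majorant (x + s / 2) := fun x s hs => by
    have := weight_le hG (x, s)
    simp only [max_eq_left hs] at this
    rw [mul_assoc]
    gcongr
  refine ⟨fun p => W p * (κ p).1, fun p => W p * (κ p).2, ‖κ‖ * Real.exp (Real.pi * G),
    hc1 κ, hc2 κ, fun x s hs => (hb1 κ _).trans (hbd x s hs),
    fun x s hs => (hb2 κ _).trans (hbd x s hs), ?_, ?_⟩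
  · intro x s hs
    have := hfix1 (x, s)
    simp only [this, S, opOne, max_eq_left hs]
    ring
  · intro x s hs
    have := hfix2 (x, s)
    simp only [this, opTwo]

/-! ### Laplace transforms of the kernel -/

lemma norm_cexp_I_mul (z : ℂ) (s : ℝ) : ‖Complex.exp (Complex.I * z * s)‖ = Real.exp (-(z.im * s)) := by
  rw [Complex.norm_exp]
  congr 1
  simp

lemma norm_cexp_I_mul_le_one {z : ℂ} (hz : 0 ≤ z.im) {s : ℝ} (hs : 0 ≤ s) :
    ‖Complex.exp (Complex.I * z * s)‖ ≤ 1 := by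
  rw [norm_cexp_I_mul, Real.exp_le_one_iff]
  have := mul_nonneg hz hs
  linarith

lemma hasDerivAt_integral_Ioi {f : ℝ → ℂ} (hf : Continuous f)
    (hi : ∀ x, IntegrableOn f (Ioi x)) (x : ℝ) :
    HasDerivAt (fun x => ∫ t in Ioi x, f t) (-f x) x := by
  have h1 : (fun x => ∫ t in Ioi x, f t) =
      fun x => (∫ t in Ioi (0 : ℝ), f t) - ∫ t in (0 : ℝ)..x, f t := by
    ext x
    rw [← intervalIntegral.integral_interval_add_Ioi (hi 0) (hi x)]
    ring
  rw [h1]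
  have := intervalIntegral.integral_hasDerivAt_right (hf.intervalIntegrable 0 x)
    hf.aestronglyMeasurable.stronglyMeasurableAtFilter hf.continuousAt
  simpa using this.const_sub (∫ t in Ioi (0 : ℝ), f t)

lemma integral_Ioi_comp_sub {f : ℝ → ℂ} (c : ℝ) :
    ∫ s in Ioi c, f (s - c) = ∫ s in Ioi (0 : ℝ), f s := by
  have := (measurePreserving_sub_right volume c).setIntegral_preimage_emb
    (MeasurableEquiv.subRight c).measurableEmbedding f (Ioi 0)
  rw [← this]
  congr 1
  simp

lemma integral_Ioi_comp_add {f : ℝ → ℂ} (c : ℝ) :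
    ∫ s in Ioi (0 : ℝ), f (c + s) = ∫ s in Ioi c, f s := by
  rw [← integral_Ioi_comp_sub (f := fun s => f (c + s)) c]
  simp

/-- A continuous kernel with the decay of a transformation kernel. -/
structure Decay (C : ℝ) (k : ℝ × ℝ → ℂ) : Prop where
  cont : Continuous k
  bound : ∀ x s, 0 ≤ s → ‖k (x, s)‖ ≤ C * majorant (x + s / 2)

/-- The Laplace transform of `k (x, ·)`. -/
noncomputable def lap (k : ℝ × ℝ → ℂ) (z : ℂ) (x : ℝ) : ℂ :=
  ∫ s in Ioi (0 : ℝ), k (x, s) * Complex.exp (Complex.I * z * s)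

/-- The integral of the majorant. -/
noncomputable def tail (x : ℝ) : ℝ := ∫ s in Ioi (0 : ℝ), majorant (x + s / 2)

lemma antitone_tail : Antitone tail := fun x y h =>
  setIntegral_mono (integrableOn_majorant y) (integrableOn_majorant x)
    fun s => antitone_majorant (by simpa using h)

lemma tail_nonneg (x : ℝ) : 0 ≤ tail x :=
  integral_nonneg fun _ => (majorant_pos _).le

lemma tendsto_tail : Tendsto tail atTop (𝓝 0) := by
  have h0 : (0 : ℝ) = ∫ s in Ioi (0 : ℝ), (0 : ℝ) := by simp
  rw [h0]
  refine tendsto_integral_filter_of_dominated_convergence (fun s => majorant (0 + s / 2)) ?_ ?_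
    (integrableOn_majorant 0) ?_
  · exact Eventually.of_forall fun x => by fun_prop
  · filter_upwards [eventually_ge_atTop 0] with x hx
    refine Eventually.of_forall fun s => ?_
    rw [Real.norm_of_nonneg (majorant_pos _).le]
    exact antitone_majorant (by simpa using hx)
  · refine Eventually.of_forall fun s => ?_
    have h1 : Tendsto (fun x : ℝ => max (x + s / 2) 0) atTop atTop :=
      tendsto_atTop_mono (fun x => le_max_left _ _) (tendsto_atTop_add_const_right _ _ tendsto_id)
    have h2 : Tendsto (fun x : ℝ => 1 + (max (x + s / 2) 0) ^ 2) atTop atTop :=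
      tendsto_atTop_add_const_left _ _ ((tendsto_pow_atTop two_ne_zero).comp h1)
    exact h2.inv_tendsto_atTop

namespace Decay

variable {C : ℝ} {k : ℝ × ℝ → ℂ}

lemma nonneg (h : Decay C k) : 0 ≤ C :=
  nonneg_of_mul_nonneg_left ((norm_nonneg _).trans (h.bound 0 0 le_rfl)) (majorant_pos _)

lemma integrableOn (h : Decay C k) (x : ℝ) : IntegrableOn (fun s => k (x, s)) (Ioi 0) := by
  have := h.cont
  refine Integrable.mono' ((integrableOn_majorant x).const_mul C) (by fun_prop) ?_
  filter_upwards [ae_restrict_mem measurableSet_Ioi] with s hs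
  exact h.bound x s (le_of_lt hs)

lemma norm_mul_exp_le (h : Decay C k) {z : ℂ} (hz : 0 ≤ z.im) (x : ℝ) {s : ℝ} (hs : 0 ≤ s) :
    ‖k (x, s) * Complex.exp (Complex.I * z * s)‖ ≤ C * majorant (x + s / 2) := by
  rw [norm_mul]
  refine (mul_le_of_le_one_right (norm_nonneg _) (norm_cexp_I_mul_le_one hz hs)).trans
    (h.bound x s hs)

lemma integrableOn_mul_exp (h : Decay C k) {z : ℂ} (hz : 0 ≤ z.im) (x : ℝ) :
    IntegrableOn (fun s : ℝ => k (x, s) * Complex.exp (Complex.I * z * s)) (Ioi 0) := by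
  have := h.cont
  refine Integrable.mono' ((integrableOn_majorant x).const_mul C) (by fun_prop) ?_
  filter_upwards [ae_restrict_mem measurableSet_Ioi] with s hs
  exact h.norm_mul_exp_le hz x (le_of_lt hs)

lemma norm_lap_le (h : Decay C k) {z : ℂ} (hz : 0 ≤ z.im) (x : ℝ) : ‖lap k z x‖ ≤ C * tail x := by
  unfold lap tail
  rw [← integral_const_mul]
  refine norm_integral_le_of_norm_le ((integrableOn_majorant x).const_mul C) ?_
  filter_upwards [ae_restrict_mem measurableSet_Ioi] with s hs
  exact h.norm_mul_exp_le hz x (le_of_lt hs)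

lemma tendsto_lap (h : Decay C k) {z : ℂ} (hz : 0 ≤ z.im) : Tendsto (lap k z) atTop (𝓝 0) := by
  refine squeeze_zero_norm (h.norm_lap_le hz) ?_
  simpa using tendsto_tail.const_mul C

lemma continuousOn_lap (h : Decay C k) :
    ContinuousOn (fun p : ℂ × ℝ => lap k p.1 p.2) {p | 0 ≤ p.1.im} := by
  intro p hp
  have hk := h.cont
  refine continuousWithinAt_of_dominated (bound := fun s => C * majorant (p.2 - 1 + s / 2)) ?_ ?_
    ((integrableOn_majorant _).const_mul C) ?_
  · exact Eventually.of_forall fun p => by fun_prop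
  · have h1 : ∀ᶠ p' : ℂ × ℝ in 𝓝[{p | 0 ≤ p.1.im}] p, p.2 - 1 < p'.2 :=
      nhdsWithin_le_nhds (continuous_snd.continuousAt.eventually_const_lt (by simp))
    filter_upwards [h1, self_mem_nhdsWithin] with p' hp' hz
    filter_upwards [ae_restrict_mem measurableSet_Ioi] with s hs
    refine (h.norm_mul_exp_le hz p'.2 (le_of_lt hs)).trans ?_
    have := h.nonneg
    gcongr
    exact antitone_majorant (by linarith)
  · exact Eventually.of_forall fun s => (by fun_prop : Continuous fun p : ℂ × ℝ =>
      k (p.2, s) * Complex.exp (Complex.I * p.1 * s)).continuousWithinAt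

lemma continuousOn_lap_left (h : Decay C k) (x : ℝ) :
    ContinuousOn (fun z => lap k z x) {z | 0 ≤ z.im} :=
  h.continuousOn_lap.comp (f := fun z : ℂ => (z, x)) (by fun_prop) fun _ hz => hz

lemma continuous_lap (h : Decay C k) {z : ℂ} (hz : 0 ≤ z.im) : Continuous (lap k z) :=
  h.continuousOn_lap.comp_continuous (f := fun x : ℝ => (z, x)) (by fun_prop) fun _ => hz

lemma differentiableOn_lap (h : Decay C k) (x : ℝ) :
    DifferentiableOn ℂ (fun z => lap k z x) {z | 0 < z.im} := by
  intro z₀ hz₀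
  have hk := h.cont
  have hz₀' : 0 < z₀.im := hz₀
  refine DifferentiableAt.differentiableWithinAt ?_
  have hs : {z : ℂ | z₀.im / 2 < z.im} ∈ 𝓝 z₀ :=
    (isOpen_lt continuous_const Complex.continuous_im).mem_nhds (by simpa using hz₀')
  refine (hasDerivAt_integral_of_dominated_loc_of_deriv_le (μ := volume.restrict (Ioi 0))
    (F := fun (z : ℂ) (s : ℝ) => k (x, s) * Complex.exp (Complex.I * z * s))
    (F' := fun (z : ℂ) (s : ℝ) => k (x, s) * (Complex.exp (Complex.I * z * s) * (Complex.I * s)))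
    (bound := fun s => 2 / z₀.im * (C * majorant (x + s / 2)))
    hs ?_ (h.integrableOn_mul_exp hz₀'.le x) ?_ ?_ ?_ ?_).2.differentiableAt
  · exact Eventually.of_forall fun z => by fun_prop
  · fun_prop
  · filter_upwards [ae_restrict_mem measurableSet_Ioi] with s hs z hz
    have hs' : 0 < s := hs
    have hz' : z₀.im / 2 < z.im := hz
    have h1 := h.bound x s hs'.le
    rw [norm_mul, norm_mul, norm_cexp_I_mul, mul_comm]
    gcongr
    have h2 : ‖Complex.I * (s : ℂ)‖ = s := by simp [abs_of_pos hs']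
    rw [h2]
    -- The factor s created by differentiation is absorbed by the exponential decay, which is
    -- uniform on the half-plane Im z > Im z₀ / 2.
    have h3 : z₀.im / 2 * s ≤ Real.exp (z.im * s) :=
      (by nlinarith : z₀.im / 2 * s ≤ z.im * s + 1).trans (Real.add_one_le_exp _)
    rw [Real.exp_neg, inv_mul_le_iff₀ (Real.exp_pos _)]
    calc s = 2 / z₀.im * (z₀.im / 2 * s) := by field_simp
      _ ≤ 2 / z₀.im * Real.exp (z.im * s) := by gcongr
      _ = _ := by ring
  · exact ((integrableOn_majorant x).const_mul C).const_mul _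
  · refine Eventually.of_forall fun s z _ => ?_
    have h1 : HasDerivAt (fun z : ℂ => Complex.I * z * s) (Complex.I * s) z := by
      simpa using ((hasDerivAt_id z).const_mul Complex.I).mul_const (s : ℂ)
    exact h1.cexp.const_mul _

end Decay

/-! ### The Jost solution of the AKNS system -/

/-- The transformation kernel of the AKNS system with potentials `q`, `r`. -/
structure IsKernel (q r : ℝ → ℂ) (C : ℝ) (k₁ k₂ : ℝ × ℝ → ℂ) : Prop where
  decay₁ : Decay C k₁
  decay₂ : Decay C k₂
  eq₁ : ∀ x s, 0 ≤ s → k₁ (x, s) = -(1 / 2) * q (x + s / 2) -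
        ∫ τ in (0 : ℝ)..(s / 2), q (x + τ) * k₂ (x + τ, s - 2 * τ)
  eq₂ : ∀ x s, 0 ≤ s → k₂ (x, s) = -∫ t in Ioi x, r t * k₁ (t, s)

namespace IsKernel

variable {G C : ℝ} {q r : ℝ → ℂ} {k₁ k₂ : ℝ × ℝ → ℂ}

/-- Fubini applied to the second kernel equation. Together with `lap_one` this is the Volterra
system of the Jost solution. -/
lemma lap_two (hk : IsKernel q r C k₁ k₂) (hr : Pot G r) {z : ℂ} (hz : 0 ≤ z.im) (x : ℝ) :
    lap k₂ z x = -∫ t in Ioi x, r t * lap k₁ z t := by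
  have hrc := hr.cont
  have hkc := hk.decay₁.cont
  have hC := hk.decay₁.nonneg
  have h1 : lap k₂ z x = ∫ s in Ioi (0 : ℝ), -∫ t in Ioi x,
      r t * k₁ (t, s) * Complex.exp (Complex.I * z * s) := by
    unfold lap
    refine setIntegral_congr_fun measurableSet_Ioi fun s hs => ?_
    rw [hk.eq₂ x s (le_of_lt hs), integral_mul_const]
    ring
  have h2 : ∀ t, r t * lap k₁ z t = ∫ s in Ioi (0 : ℝ),
      r t * k₁ (t, s) * Complex.exp (Complex.I * z * s) := fun t => by
    unfold lap
    rw [← integral_const_mul]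
    simp only [mul_assoc]
  simp only [h2]
  rw [h1, integral_neg, integral_integral_swap]
  have hint : Integrable (fun p : ℝ × ℝ => C * majorant (x + p.1 / 2) * ‖r p.2‖)
      ((volume.restrict (Ioi 0)).prod (volume.restrict (Ioi x))) :=
    ((integrableOn_majorant x).const_mul C).mul_prod hr.integrable.norm.integrableOn
  refine hint.mono' (by fun_prop) ?_
  rw [Measure.prod_restrict]
  filter_upwards [ae_restrict_mem (measurableSet_Ioi.prod measurableSet_Ioi)] with p hp
  have hp1 : 0 < p.1 := hp.1
  have hp2 : x < p.2 := hp.2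
  simp only [Function.uncurry]
  rw [mul_assoc, norm_mul, mul_comm]
  gcongr
  refine (hk.decay₁.norm_mul_exp_le hz p.2 hp1.le).trans ?_
  gcongr
  exact antitone_majorant (by linarith)

/-- The integral term of the first kernel equation evaluates the kernel at s - 2τ. After the order
of integration is exchanged, the shift by 2τ becomes the oscillating factor e^{2izτ}; the source
-q(x + s/2)/2 gives the term with 1 after the substitution s = 2τ. -/
lemma lap_one (hk : IsKernel q r C k₁ k₂) (hq : Pot G q) {z : ℂ} (hz : 0 ≤ z.im) (x : ℝ) :
    lap k₁ z x = -∫ t in Ioi x, Complex.exp (2 * Complex.I * z * (t - x)) *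
      (q t * (1 + lap k₂ z t)) := by
  have hqc := hq.cont
  have hkc := hk.decay₂.cont
  have hC := hk.decay₂.nonneg
  have hqi : ∀ x, Integrable fun τ => q (x + τ) := fun x => hq.integrable.comp_add_left x
  -- The indicator encodes the triangle 2τ < s, so that both orders of integration run over the full
  -- quadrant.
  let H : ℝ → ℝ → ℂ := fun s τ => (Ioi (2 * τ)).indicator (fun s : ℝ =>
    q (x + τ) * k₂ (x + τ, s - 2 * τ) * Complex.exp (Complex.I * z * s)) s
  have hHb : ∀ s τ, 0 < s → 0 < τ → ‖H s τ‖ ≤ C * majorant (x + s / 2) * ‖q (x + τ)‖ := by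
    intro s τ hs hτ
    have hpos : 0 ≤ C * majorant (x + s / 2) := mul_nonneg hC (majorant_pos _).le
    by_cases h : 2 * τ < s
    · simp only [H, indicator_of_mem (mem_Ioi.2 h)]
      rw [norm_mul, norm_mul]
      have h1 := hk.decay₂.bound (x + τ) (s - 2 * τ) (by linarith)
      rw [show x + τ + (s - 2 * τ) / 2 = x + s / 2 by ring] at h1
      have h2 := norm_cexp_I_mul_le_one hz hs.le
      calc ‖q (x + τ)‖ * ‖k₂ (x + τ, s - 2 * τ)‖ * ‖Complex.exp (Complex.I * z * s)‖
          ≤ ‖q (x + τ)‖ * (C * majorant (x + s / 2)) * 1 := by gcongr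
        _ = _ := by ring
    · simp only [H, indicator_of_notMem (fun h' => h (mem_Ioi.1 h'))]
      rw [norm_zero]
      positivity
  have hHm : AEStronglyMeasurable (Function.uncurry H)
      ((volume.restrict (Ioi 0)).prod (volume.restrict (Ioi 0))) := by
    have : Function.uncurry H = {p : ℝ × ℝ | 2 * p.2 < p.1}.indicator (fun p : ℝ × ℝ =>
        q (x + p.2) * k₂ (x + p.2, p.1 - 2 * p.2) * Complex.exp (Complex.I * z * p.1)) := by
      ext p
      simp [Function.uncurry, H, indicator]
    rw [this]
    refine AEStronglyMeasurable.indicator ?_ (measurableSet_lt (by fun_prop) (by fun_prop))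
    exact Continuous.aestronglyMeasurable (by fun_prop)
  have hHi : Integrable (Function.uncurry H)
      ((volume.restrict (Ioi 0)).prod (volume.restrict (Ioi 0))) := by
    refine (((integrableOn_majorant x).const_mul C).mul_prod
      (hqi x).norm.integrableOn).mono' hHm ?_
    rw [Measure.prod_restrict]
    filter_upwards [ae_restrict_mem (measurableSet_Ioi.prod measurableSet_Ioi)] with p hp
    exact hHb _ _ hp.1 hp.2
  have hI1 : IntegrableOn (fun s : ℝ => -(1 / 2) * q (x + s / 2) *
      Complex.exp (Complex.I * z * s)) (Ioi 0) := by
    have hi : Integrable fun s : ℝ => -(1 / 2) * q (x + s / 2) := by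
      have := ((hqi x).comp_div (two_ne_zero)).const_mul (-(1 / 2) : ℂ)
      exact this
    refine hi.norm.integrableOn.mono' (by fun_prop) ?_
    filter_upwards [ae_restrict_mem measurableSet_Ioi] with s hs
    rw [norm_mul]
    exact mul_le_of_le_one_right (norm_nonneg _) (norm_cexp_I_mul_le_one hz (le_of_lt hs))
  have hI2 : ∀ s : ℝ, 0 < s → (∫ τ in (0 : ℝ)..(s / 2), q (x + τ) * k₂ (x + τ, s - 2 * τ)) *
      Complex.exp (Complex.I * z * s) = ∫ τ in Ioi (0 : ℝ), H s τ := by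
    intro s hs
    have h1 : ∀ τ, H s τ = (Iio (s / 2)).indicator (fun τ => q (x + τ) * k₂ (x + τ, s - 2 * τ) *
        Complex.exp (Complex.I * z * s)) τ := by
      intro τ
      by_cases h : 2 * τ < s
      · simp only [H]
        rw [indicator_of_mem (mem_Ioi.2 h), indicator_of_mem (mem_Iio.2 (by linarith))]
      · simp only [H]
        rw [indicator_of_notMem (fun h' => h (mem_Ioi.1 h')),
          indicator_of_notMem (fun h' => h (by have := mem_Iio.1 h'; linarith))]
    simp only [h1]
    rw [setIntegral_indicator measurableSet_Iio, Ioi_inter_Iio, integral_mul_const,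
      intervalIntegral.integral_of_le (by positivity), integral_Ioc_eq_integral_Ioo]
  have hI3 : ∀ τ : ℝ, 0 < τ → ∫ s in Ioi (0 : ℝ), H s τ =
      Complex.exp (2 * Complex.I * z * τ) * (q (x + τ) * lap k₂ z (x + τ)) := by
    intro τ hτ
    simp only [H]
    rw [setIntegral_indicator measurableSet_Ioi, Ioi_inter_Ioi, max_eq_right (by positivity)]
    unfold lap
    rw [← integral_Ioi_comp_sub (f := fun s => k₂ (x + τ, s) * Complex.exp (Complex.I * z * s))
      (2 * τ)]
    rw [← integral_const_mul, ← integral_const_mul]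
    congr 1
    ext s
    have : Complex.exp (Complex.I * z * s) = Complex.exp (2 * Complex.I * z * τ) *
        Complex.exp (Complex.I * z * ((s - 2 * τ : ℝ) : ℂ)) := by
      rw [← Complex.exp_add]
      congr 1
      push_cast
      ring
    rw [this]
    ring
  have h1 : lap k₁ z x = (∫ s in Ioi (0 : ℝ), -(1 / 2) * q (x + s / 2) *
      Complex.exp (Complex.I * z * s)) - ∫ s in Ioi (0 : ℝ), ∫ τ in Ioi (0 : ℝ), H s τ := by
    have hHi' : IntegrableOn (fun s => ∫ τ in Ioi (0 : ℝ), H s τ) (Ioi 0) := hHi.integral_prod_left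
    unfold lap
    rw [← integral_sub hI1 hHi']
    refine setIntegral_congr_fun measurableSet_Ioi fun s hs => ?_
    rw [hk.eq₁ x s (le_of_lt hs), ← hI2 s hs]
    ring
  have h2 : ∫ s in Ioi (0 : ℝ), -(1 / 2) * q (x + s / 2) * Complex.exp (Complex.I * z * s) =
      -∫ τ in Ioi (0 : ℝ), Complex.exp (2 * Complex.I * z * τ) * q (x + τ) := by
    have := integral_comp_mul_left_Ioi (fun s : ℝ => -(1 / 2) * q (x + s / 2) *
      Complex.exp (Complex.I * z * s)) 0 (b := 2) (by norm_num)
    rw [mul_zero] at this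
    have h3 : (2 : ℝ)⁻¹ • ∫ s in Ioi (0 : ℝ), -(1 / 2) * q (x + s / 2) *
        Complex.exp (Complex.I * z * s) = -(1 / 2) * ∫ τ in Ioi (0 : ℝ),
        Complex.exp (2 * Complex.I * z * τ) * q (x + τ) := by
      rw [← this, ← integral_const_mul]
      congr 1
      ext τ
      rw [show 2 * τ / 2 = τ by ring]
      push_cast
      rw [show Complex.I * z * (2 * τ) = 2 * Complex.I * z * τ by ring]
      ring
    rw [Complex.real_smul] at h3
    push_cast at h3
    linear_combination 2 * h3
  have hE : ∀ g : ℝ → ℂ, Integrable g → Continuous g → IntegrableOn (fun τ : ℝ =>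
      Complex.exp (2 * Complex.I * z * τ) * g τ) (Ioi 0) := by
    intro g hg hgc
    refine hg.norm.integrableOn.mono' (by fun_prop) ?_
    filter_upwards [ae_restrict_mem measurableSet_Ioi] with s hs
    rw [norm_mul]
    refine mul_le_of_le_one_left (norm_nonneg _) ?_
    have := norm_cexp_I_mul_le_one (z := 2 * z) (s := s) (by simpa using hz) (le_of_lt hs)
    rwa [show Complex.I * (2 * z) * s = 2 * Complex.I * z * s by ring] at this
  have hHi2 : IntegrableOn (fun τ : ℝ => Complex.exp (2 * Complex.I * z * τ) *
      (q (x + τ) * lap k₂ z (x + τ))) (Ioi 0) := by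
    have : IntegrableOn (fun τ => ∫ s in Ioi (0 : ℝ), H s τ) (Ioi 0) := hHi.integral_prod_right
    exact this.congr_fun (fun τ hτ => hI3 τ hτ) measurableSet_Ioi
  rw [h1, h2, integral_integral_swap hHi, setIntegral_congr_fun measurableSet_Ioi hI3,
    ← neg_add', ← integral_add (hE _ (hqi x) (by fun_prop)) hHi2,
    ← integral_Ioi_comp_add x]
  congr 1
  refine setIntegral_congr_fun measurableSet_Ioi fun τ _ => ?_
  push_cast
  rw [show (x : ℂ) + τ - x = τ by ring]
  ring

end IsKernel

/-! ### Schwartz potentials -/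

/-- The pointwise product of Schwartz functions. -/
noncomputable def mulS (f g : 𝓢(ℝ, ℂ)) : 𝓢(ℝ, ℂ) :=
  SchwartzMap.pairing (ContinuousLinearMap.mul ℂ ℂ) f g

@[simp] lemma mulS_apply (f g : 𝓢(ℝ, ℂ)) (x : ℝ) : mulS f g x = f x * g x := rfl

/-- The derivative of a Schwartz function. -/
noncomputable def derivS (f : 𝓢(ℝ, ℂ)) : 𝓢(ℝ, ℂ) := SchwartzMap.derivCLM ℂ ℂ f

lemma hasDerivAt_schwartz (f : 𝓢(ℝ, ℂ)) (x : ℝ) : HasDerivAt f (derivS f x) x :=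
  f.hasDerivAt x

/-- The odd reflection `x ↦ -f (-x)`. -/
noncomputable def reflS (f : 𝓢(ℝ, ℂ)) : 𝓢(ℝ, ℂ) :=
  -SchwartzMap.compCLMOfContinuousLinearEquiv ℂ (ContinuousLinearEquiv.neg ℝ) f

@[simp] lemma reflS_apply (f : 𝓢(ℝ, ℂ)) (x : ℝ) : reflS f x = -f (-x) := rfl

lemma derivS_reflS (f : 𝓢(ℝ, ℂ)) (x : ℝ) : derivS (reflS f) x = derivS f (-x) := by
  have h1 := hasDerivAt_schwartz (reflS f) x
  have h2 : HasDerivAt (fun x => -f (-x)) (derivS f (-x)) x := by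
    simpa using! ((hasDerivAt_schwartz f (-x)).scomp x (hasDerivAt_neg x)).neg
  exact h1.unique h2

lemma exists_pot (q : 𝓢(ℝ, ℂ)) : ∃ G, Pot G q := by
  obtain ⟨C₀, h₀⟩ := q.decay 0 0
  obtain ⟨C₂, h₂⟩ := q.decay 2 0
  refine ⟨C₀ + C₂, q.continuous, fun x => ?_⟩
  have h3 := h₀.2 x
  have h4 := h₂.2 x
  simp only [pow_zero, one_mul, norm_iteratedFDeriv_zero, Real.norm_eq_abs, sq_abs] at h3 h4
  rw [← div_eq_mul_inv, le_div_iff₀ (by positivity)]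
  linarith

lemma exists_pot₂ (q r : 𝓢(ℝ, ℂ)) : ∃ G, Pot G q ∧ Pot G r := by
  obtain ⟨G, h⟩ := exists_pot q
  obtain ⟨G', h'⟩ := exists_pot r
  exact ⟨max G G', h.mono (le_max_left _ _), h'.mono (le_max_right _ _)⟩

lemma exists_isKernel (q r : 𝓢(ℝ, ℂ)) : ∃ (k : (ℝ × ℝ → ℂ) × (ℝ × ℝ → ℂ)) (C : ℝ),
    IsKernel q r C k.1 k.2 := by
  obtain ⟨G, hq, hr⟩ := exists_pot₂ q r
  obtain ⟨k₁, k₂, C, h1, h2, h3, h4, h5, h6⟩ := exists_kernel hq hr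
  exact ⟨⟨k₁, k₂⟩, C, ⟨h1, h3⟩, ⟨h2, h4⟩, h5, h6⟩

/-- The first component of the transformation kernel. -/
noncomputable def kerOne (q r : 𝓢(ℝ, ℂ)) : ℝ × ℝ → ℂ := (exists_isKernel q r).choose.1

/-- The second component of the transformation kernel. -/
noncomputable def kerTwo (q r : 𝓢(ℝ, ℂ)) : ℝ × ℝ → ℂ := (exists_isKernel q r).choose.2

lemma isKernel_ker (q r : 𝓢(ℝ, ℂ)) : ∃ C, IsKernel q r C (kerOne q r) (kerTwo q r) :=
  (exists_isKernel q r).choose_spec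

/-- `e^{-izx}` times the first component of the Jost solution. -/
noncomputable def mOne (q r : 𝓢(ℝ, ℂ)) (z : ℂ) (x : ℝ) : ℂ := lap (kerOne q r) z x

/-- `e^{-izx}` times the second component of the Jost solution. -/
noncomputable def mTwo (q r : 𝓢(ℝ, ℂ)) (z : ℂ) (x : ℝ) : ℂ := 1 + lap (kerTwo q r) z x

/-- The first component of the Jost solution `∼ (0, e^{izx})` at `+∞`. -/
noncomputable def jostOne (q r : 𝓢(ℝ, ℂ)) (z : ℂ) (x : ℝ) : ℂ :=
  Complex.exp (Complex.I * z * x) * mOne q r z x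

/-- The second component of the Jost solution `∼ (0, e^{izx})` at `+∞`. -/
noncomputable def jostTwo (q r : 𝓢(ℝ, ℂ)) (z : ℂ) (x : ℝ) : ℂ :=
  Complex.exp (Complex.I * z * x) * mTwo q r z x

/-- `(u, v)` solves the AKNS system with potentials `q`, `r`. -/
structure Sol (q r : ℝ → ℂ) (z : ℂ) (u v : ℝ → ℂ) : Prop where
  deriv₁ : ∀ x, HasDerivAt u (-Complex.I * z * u x + q x * v x) x
  deriv₂ : ∀ x, HasDerivAt v (Complex.I * z * v x + r x * u x) x

section Jost

variable (q r : 𝓢(ℝ, ℂ)) {z : ℂ}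

/-- The source of the reconstruction formulas: at s = 0 the integral term of the kernel equation is
empty. -/
lemma kerOne_zero (x : ℝ) : kerOne q r (x, 0) = -(1 / 2) * q x := by
  obtain ⟨C, h⟩ := isKernel_ker q r
  simpa using h.eq₁ x 0 le_rfl

lemma continuous_mOne (hz : 0 ≤ z.im) : Continuous (mOne q r z) := by
  obtain ⟨C, h⟩ := isKernel_ker q r
  exact h.decay₁.continuous_lap hz

lemma continuous_mTwo (hz : 0 ≤ z.im) : Continuous (mTwo q r z) := by
  obtain ⟨C, h⟩ := isKernel_ker q r
  exact continuous_const.add (h.decay₂.continuous_lap hz)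

lemma continuousOn_mOne (x : ℝ) : ContinuousOn (fun z => mOne q r z x) {z | 0 ≤ z.im} := by
  obtain ⟨C, h⟩ := isKernel_ker q r
  exact h.decay₁.continuousOn_lap_left x

lemma continuousOn_mTwo (x : ℝ) : ContinuousOn (fun z => mTwo q r z x) {z | 0 ≤ z.im} := by
  obtain ⟨C, h⟩ := isKernel_ker q r
  exact continuousOn_const.add (h.decay₂.continuousOn_lap_left x)

lemma differentiableOn_mOne (x : ℝ) : DifferentiableOn ℂ (fun z => mOne q r z x) {z | 0 < z.im} := by
  obtain ⟨C, h⟩ := isKernel_ker q r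
  exact h.decay₁.differentiableOn_lap x

lemma differentiableOn_mTwo (x : ℝ) : DifferentiableOn ℂ (fun z => mTwo q r z x) {z | 0 < z.im} := by
  obtain ⟨C, h⟩ := isKernel_ker q r
  exact (differentiableOn_const _).add (h.decay₂.differentiableOn_lap x)

lemma tendsto_mOne (hz : 0 ≤ z.im) : Tendsto (mOne q r z) atTop (𝓝 0) := by
  obtain ⟨C, h⟩ := isKernel_ker q r
  exact h.decay₁.tendsto_lap hz

lemma tendsto_mTwo (hz : 0 ≤ z.im) : Tendsto (mTwo q r z) atTop (𝓝 1) := by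
  obtain ⟨C, h⟩ := isKernel_ker q r
  simpa using! (h.decay₂.tendsto_lap hz).const_add 1

/-- The bound is uniform over the closed half-plane of z; all the high-frequency estimates start
from it. -/
lemma exists_norm_m_le (x₀ : ℝ) : ∃ M, 0 ≤ M ∧ ∀ z : ℂ, 0 ≤ z.im → ∀ x, x₀ ≤ x →
    ‖mOne q r z x‖ ≤ M ∧ ‖mTwo q r z x‖ ≤ M := by
  obtain ⟨C, h⟩ := isKernel_ker q r
  have hC := h.decay₁.nonneg
  have h0 := tail_nonneg x₀
  refine ⟨1 + C * tail x₀, by positivity, fun z hz x hx => ?_⟩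
  have h1 : C * tail x ≤ C * tail x₀ := mul_le_mul_of_nonneg_left (antitone_tail hx) hC
  constructor
  · exact (h.decay₁.norm_lap_le hz x).trans (by linarith)
  · refine (norm_add_le _ _).trans ?_
    rw [norm_one]
    have := h.decay₂.norm_lap_le hz x
    linarith

lemma mTwo_eq (hz : 0 ≤ z.im) (x : ℝ) : mTwo q r z x = 1 - ∫ t in Ioi x, r t * mOne q r z t := by
  obtain ⟨C, h⟩ := isKernel_ker q r
  obtain ⟨G, hr⟩ := exists_pot r
  unfold mTwo mOne
  rw [h.lap_two hr hz]
  ring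

lemma mOne_eq (hz : 0 ≤ z.im) (x : ℝ) : mOne q r z x = -∫ t in Ioi x,
    Complex.exp (2 * Complex.I * z * (t - x)) * (q t * mTwo q r z t) := by
  obtain ⟨C, h⟩ := isKernel_ker q r
  obtain ⟨G, hr⟩ := exists_pot q
  unfold mTwo mOne
  rw [h.lap_one hr hz]

variable {q r} in
lemma integrableOn_mul_of_bound (g : 𝓢(ℝ, ℂ)) {h : ℝ → ℂ} (hc : Continuous h) {x M : ℝ}
    (hb : ∀ t, x < t → ‖h t‖ ≤ M) : IntegrableOn (fun t => g t * h t) (Ioi x) := by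
  refine (g.integrable.norm.mul_const M).integrableOn.mono' (by fun_prop) ?_
  filter_upwards [ae_restrict_mem measurableSet_Ioi] with t ht
  rw [norm_mul]
  gcongr
  exact hb t ht

lemma norm_osc_le_one (hz : 0 ≤ z.im) {x t : ℝ} (ht : x ≤ t) :
    ‖Complex.exp (2 * Complex.I * z * (t - x))‖ ≤ 1 := by
  have := norm_cexp_I_mul_le_one (z := 2 * z) (s := t - x) (by simpa using hz) (by linarith)
  push_cast at this
  rwa [show Complex.I * (2 * z) * ((t : ℂ) - x) = 2 * Complex.I * z * (t - x) by ring] at this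

lemma integrableOn_osc (hz : 0 ≤ z.im) (g : 𝓢(ℝ, ℂ)) {h : ℝ → ℂ} (hc : Continuous h) {x M : ℝ}
    (hb : ∀ t, x < t → ‖h t‖ ≤ M) : IntegrableOn (fun t : ℝ =>
      Complex.exp (2 * Complex.I * z * (t - x)) * (g t * h t)) (Ioi x) := by
  refine (integrableOn_mul_of_bound g hc hb).norm.mono' (by fun_prop) ?_
  filter_upwards [ae_restrict_mem measurableSet_Ioi] with t ht
  rw [norm_mul]
  exact mul_le_of_le_one_left (norm_nonneg _) (norm_osc_le_one hz (le_of_lt ht))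

lemma norm_osc_le (hz : 0 ≤ z.im) (g : 𝓢(ℝ, ℂ)) {h : ℝ → ℂ} {x M : ℝ} (hM : 0 ≤ M)
    (hb : ∀ t, x < t → ‖h t‖ ≤ M) : ‖∫ t in Ioi x,
      Complex.exp (2 * Complex.I * z * (t - x)) * (g t * h t)‖ ≤ M * ∫ t, ‖g t‖ := by
  have h1 : ‖∫ t in Ioi x, Complex.exp (2 * Complex.I * z * (t - x)) * (g t * h t)‖ ≤
      ∫ t in Ioi x, M * ‖g t‖ := by
    refine norm_integral_le_of_norm_le (g.integrable.norm.const_mul M).integrableOn ?_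
    filter_upwards [ae_restrict_mem measurableSet_Ioi] with t ht
    rw [norm_mul, norm_mul]
    calc _ ≤ 1 * (‖g t‖ * M) := by
          gcongr
          · exact norm_osc_le_one hz (le_of_lt ht)
          · exact hb t ht
      _ = _ := by ring
  refine h1.trans ?_
  rw [integral_const_mul]
  gcongr
  · exact Eventually.of_forall fun t => norm_nonneg _
  · exact g.integrable.norm
  · exact Measure.restrict_le_self

lemma hasDerivAt_mTwo (hz : 0 ≤ z.im) (x : ℝ) :
    HasDerivAt (mTwo q r z) (r x * mOne q r z x) x := by
  have hc := continuous_mOne q r hz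
  have h1 : mTwo q r z = fun x => 1 - ∫ t in Ioi x, r t * mOne q r z t :=
    funext (mTwo_eq q r hz)
  rw [h1]
  have h2 : ∀ x, IntegrableOn (fun t => r t * mOne q r z t) (Ioi x) := fun x => by
    obtain ⟨M, -, hM⟩ := exists_norm_m_le q r x
    exact integrableOn_mul_of_bound r hc fun t ht => (hM z hz t ht.le).1
  simpa using (hasDerivAt_integral_Ioi (by fun_prop) h2 x).const_sub 1

lemma hasDerivAt_mOne (hz : 0 ≤ z.im) (x : ℝ) :
    HasDerivAt (mOne q r z) (-2 * Complex.I * z * mOne q r z x + q x * mTwo q r z x) x := by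
  have hc := continuous_mTwo q r hz
  -- Writing e^{2iz(t - x)} as a product leaves an integral that depends on x only through its end
  -- point.
  set f : ℝ → ℂ := fun t => Complex.exp (2 * Complex.I * z * t) * (q t * mTwo q r z t) with hf
  have hfx : ∀ x t : ℝ, f t = Complex.exp (2 * Complex.I * z * x) *
      (Complex.exp (2 * Complex.I * z * (t - x)) * (q t * mTwo q r z t)) := fun x t => by
    rw [← mul_assoc, ← Complex.exp_add, hf]
    ring_nf
  have hfi : ∀ x, IntegrableOn f (Ioi x) := fun x => by
    obtain ⟨M, -, hM⟩ := exists_norm_m_le q r x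
    have := (integrableOn_osc hz q hc fun t ht => (hM z hz t (le_of_lt ht)).2).const_mul
      (Complex.exp (2 * Complex.I * z * x))
    exact IntegrableOn.congr_fun this (fun t _ => (hfx x t).symm) measurableSet_Ioi
  have h1 : mOne q r z = fun x : ℝ => -(Complex.exp (-2 * Complex.I * z * x) * ∫ t in Ioi x, f t) := by
    ext x
    rw [mOne_eq q r hz, setIntegral_congr_fun measurableSet_Ioi (fun t _ => hfx x t),
      integral_const_mul, ← mul_assoc, ← Complex.exp_add]
    simp
  have h2 : HasDerivAt (fun x : ℝ => Complex.exp (-2 * Complex.I * z * x))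
      (Complex.exp (-2 * Complex.I * z * x) * (-2 * Complex.I * z)) x := by
    have : HasDerivAt (fun x : ℝ => -2 * Complex.I * z * (x : ℂ)) (-2 * Complex.I * z) x := by
      simpa using (Complex.ofRealCLM.hasDerivAt (x := x)).const_mul (-2 * Complex.I * z)
    exact this.cexp
  have h3 := (h2.mul (hasDerivAt_integral_Ioi (by fun_prop) hfi x)).neg
  have h4 : mOne q r z x = -(Complex.exp (-2 * Complex.I * z * x) * ∫ t in Ioi x, f t) :=
    congrFun h1 x
  rw [h4, h1]
  refine h3.congr_deriv ?_
  have h5 : Complex.exp (-2 * Complex.I * z * x) * Complex.exp (2 * Complex.I * z * x) = 1 := by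
    rw [← Complex.exp_add]; simp
  simp only [hf]
  linear_combination (q x * mTwo q r z x) * h5

lemma hasDerivAt_cexp_I_mul (z : ℂ) (x : ℝ) : HasDerivAt
    (fun x : ℝ => Complex.exp (Complex.I * z * x))
    (Complex.exp (Complex.I * z * x) * (Complex.I * z)) x := by
  have : HasDerivAt (fun x : ℝ => Complex.I * z * (x : ℂ)) (Complex.I * z) x := by
    simpa using (Complex.ofRealCLM.hasDerivAt (x := x)).const_mul (Complex.I * z)
  exact this.cexp

lemma sol_jost (hz : 0 ≤ z.im) : Sol q r z (jostOne q r z) (jostTwo q r z) where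
  deriv₁ x := by
    refine ((hasDerivAt_cexp_I_mul z x).mul (hasDerivAt_mOne q r hz x)).congr_deriv ?_
    simp only [jostOne, jostTwo]
    ring
  deriv₂ x := by
    refine ((hasDerivAt_cexp_I_mul z x).mul (hasDerivAt_mTwo q r hz x)).congr_deriv ?_
    simp only [jostOne, jostTwo]
    ring

/-! ### High-frequency bounds -/

/-- Integration by parts in an oscillatory integral. -/
lemma osc_eq (hz : 0 ≤ z.im) (g : 𝓢(ℝ, ℂ)) (x : ℝ) :
    2 * Complex.I * z * ∫ t in Ioi x, Complex.exp (2 * Complex.I * z * (t - x)) *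
        (g t * mTwo q r z t) =
      -(g x * mTwo q r z x) -
      ((∫ t in Ioi x, Complex.exp (2 * Complex.I * z * (t - x)) * (derivS g t * mTwo q r z t)) +
      ∫ t in Ioi x, Complex.exp (2 * Complex.I * z * (t - x)) * (mulS g r t * mOne q r z t)) := by
  obtain ⟨M, hM0, hM⟩ := exists_norm_m_le q r x
  have hc1 := continuous_mOne q r hz
  have hc2 := continuous_mTwo q r hz
  have hi0 := integrableOn_osc hz g hc2 fun t ht => (hM z hz t (le_of_lt ht)).2
  have hi1 := integrableOn_osc hz (derivS g) hc2 fun t ht => (hM z hz t (le_of_lt ht)).2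
  have hi2 := integrableOn_osc hz (mulS g r) hc1 fun t ht => (hM z hz t (le_of_lt ht)).1
  have hu : ∀ t : ℝ, HasDerivAt (fun t : ℝ => Complex.exp (2 * Complex.I * z * (t - x)))
      (Complex.exp (2 * Complex.I * z * (t - x)) * (2 * Complex.I * z)) t := fun t => by
    have : HasDerivAt (fun t : ℝ => 2 * Complex.I * z * ((t : ℂ) - x)) (2 * Complex.I * z) t := by
      simpa using ((Complex.ofRealCLM.hasDerivAt (x := t)).sub_const (x : ℂ)).const_mul
        (2 * Complex.I * z)
    exact this.cexp
  have hv : ∀ t : ℝ, HasDerivAt (fun t : ℝ => g t * mTwo q r z t)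
      (derivS g t * mTwo q r z t + g t * (r t * mOne q r z t)) t := fun t =>
    (hasDerivAt_schwartz g t).mul (hasDerivAt_mTwo q r hz t)
  have key := integral_Ioi_deriv_mul_eq_sub (a := x) (a' := g x * mTwo q r z x) (b' := 0)
    (fun t _ => hu t) (fun t _ => hv t) ?_ ?_ ?_
  · have e : ∀ t : ℝ, Complex.exp (2 * Complex.I * z * (t - x)) * (2 * Complex.I * z) *
        (g t * mTwo q r z t) + Complex.exp (2 * Complex.I * z * (t - x)) *
        (derivS g t * mTwo q r z t + g t * (r t * mOne q r z t)) =
        2 * Complex.I * z * (Complex.exp (2 * Complex.I * z * (t - x)) * (g t * mTwo q r z t)) +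
        (Complex.exp (2 * Complex.I * z * (t - x)) * (derivS g t * mTwo q r z t) +
        Complex.exp (2 * Complex.I * z * (t - x)) * (mulS g r t * mOne q r z t)) := fun t => by
      simp only [mulS_apply]; ring
    simp only [e] at key
    rw [integral_add (f := fun t : ℝ => 2 * Complex.I * z *
        (Complex.exp (2 * Complex.I * z * (t - x)) * (g t * mTwo q r z t)))
      (g := fun t : ℝ => Complex.exp (2 * Complex.I * z * (t - x)) * (derivS g t * mTwo q r z t) +
        Complex.exp (2 * Complex.I * z * (t - x)) * (mulS g r t * mOne q r z t))
      (hi0.const_mul _) (hi1.add hi2), integral_const_mul, integral_add hi1 hi2] at key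
    linear_combination key
  · refine IntegrableOn.congr_fun ((hi0.const_mul (2 * Complex.I * z)).add (hi1.add hi2))
      (fun t _ => ?_) measurableSet_Ioi
    simp only [mulS_apply, Pi.add_apply, Pi.mul_apply]
    ring
  · have : Continuous fun t : ℝ => Complex.exp (2 * Complex.I * z * (t - x)) *
      (g t * mTwo q r z t) := by fun_prop
    have h2 := (this.tendsto x).mono_left (nhdsWithin_le_nhds (s := Ioi x))
    simpa using! h2
  · have h0 : Tendsto (fun t : ℝ => M * ‖g t‖) atTop (𝓝 0) := by
      have := (g.tendsto_cocompact.mono_left (atTop_le_cocompact (α := ℝ))).norm.const_mul M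
      simpa using this
    refine squeeze_zero_norm' ?_ h0
    filter_upwards [eventually_ge_atTop x] with t ht
    simp only [Pi.mul_apply, norm_mul]
    calc _ ≤ 1 * (‖g t‖ * M) := by
          gcongr
          · exact norm_osc_le_one hz ht
          · exact (hM z hz t ht).2
      _ = _ := by ring

/-- One integration by parts trades the factor z for a boundary term and for integrals of q' and qr,
all bounded uniformly in z. -/
lemma exists_norm_mOne_le (x₀ : ℝ) : ∃ C, 0 ≤ C ∧ ∀ z : ℂ, 0 ≤ z.im → ∀ x, x₀ ≤ x →
    ‖z‖ * ‖mOne q r z x‖ ≤ C := by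
  obtain ⟨M, hM0, hM⟩ := exists_norm_m_le q r x₀
  obtain ⟨G, hG⟩ := exists_pot q
  have hG0 := hG.nonneg
  have i1 : 0 ≤ ∫ t, ‖derivS q t‖ := integral_nonneg fun t => norm_nonneg _
  have i2 : 0 ≤ ∫ t, ‖mulS q r t‖ := integral_nonneg fun t => norm_nonneg _
  refine ⟨G * M + M * (∫ t, ‖derivS q t‖) + M * ∫ t, ‖mulS q r t‖, by positivity,
    fun z hz x hx => ?_⟩
  have h1 := osc_eq q r hz q x
  have h2 := mOne_eq q r hz x
  have h3 : 2 * Complex.I * z * mOne q r z x = q x * mTwo q r z x +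
      ((∫ t in Ioi x, Complex.exp (2 * Complex.I * z * (t - x)) * (derivS q t * mTwo q r z t)) +
      ∫ t in Ioi x, Complex.exp (2 * Complex.I * z * (t - x)) * (mulS q r t * mOne q r z t)) := by
    rw [h2]; linear_combination -h1
  have h4 : ‖2 * Complex.I * z * mOne q r z x‖ = 2 * (‖z‖ * ‖mOne q r z x‖) := by
    simp only [norm_mul, Complex.norm_I, Complex.norm_ofNat]; ring
  have h5 : ‖q x * mTwo q r z x‖ ≤ G * M := by
    rw [norm_mul]
    exact mul_le_mul (hG.norm_le x) (hM z hz x hx).2 (norm_nonneg _) hG0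
  have h6 := norm_osc_le hz (derivS q) hM0 fun t (ht : x < t) => (hM z hz t (hx.trans ht.le)).2
  have h7 := norm_osc_le hz (mulS q r) hM0 fun t (ht : x < t) => (hM z hz t (hx.trans ht.le)).1
  have h8 : 2 * (‖z‖ * ‖mOne q r z x‖) ≤ G * M + (M * (∫ t, ‖derivS q t‖) +
      M * ∫ t, ‖mulS q r t‖) := by
    rw [← h4, h3]
    exact (norm_add_le _ _).trans (add_le_add h5 ((norm_add_le _ _).trans (add_le_add h6 h7)))
  have : 0 ≤ ‖z‖ * ‖mOne q r z x‖ := by positivity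
  linarith

lemma exists_norm_mTwo_sub_one_le (x : ℝ) : ∃ C, ∀ z : ℂ, 0 ≤ z.im →
    ‖z‖ * ‖mTwo q r z x - 1‖ ≤ C := by
  obtain ⟨C, hC0, hC⟩ := exists_norm_mOne_le q r x
  refine ⟨C * ∫ t, ‖r t‖, fun z hz => ?_⟩
  have h1 : ‖z‖ * ‖mTwo q r z x - 1‖ = ‖∫ t in Ioi x, z * (r t * mOne q r z t)‖ := by
    rw [integral_const_mul, norm_mul, mTwo_eq q r hz, sub_sub_cancel_left, norm_neg]
  rw [h1]
  have h2 : ‖∫ t in Ioi x, z * (r t * mOne q r z t)‖ ≤ ∫ t in Ioi x, C * ‖r t‖ := by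
    refine norm_integral_le_of_norm_le (r.integrable.norm.const_mul C).integrableOn ?_
    filter_upwards [ae_restrict_mem measurableSet_Ioi] with t ht
    have := hC z hz t (le_of_lt ht)
    rw [norm_mul, norm_mul]
    calc _ = (‖z‖ * ‖mOne q r z t‖) * ‖r t‖ := by ring
      _ ≤ _ := by gcongr
  refine h2.trans ?_
  rw [integral_const_mul]
  gcongr
  · exact Eventually.of_forall fun t => norm_nonneg _
  · exact r.integrable.norm
  · exact Measure.restrict_le_self

/-- The next order of the expansion. Once the boundary term is subtracted, the integral with q' is
integrated by parts a second time, while the integral with qr already contains a factor `mOne`,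
which is O(1/z). This order is needed for the integrability of the reflection coefficient. -/
lemma exists_norm_mOne_sub_le (x : ℝ) : ∃ C, ∀ z : ℂ, 0 ≤ z.im →
    ‖z‖ * ‖2 * Complex.I * z * mOne q r z x - q x * mTwo q r z x‖ ≤ C := by
  obtain ⟨M, hM0, hM⟩ := exists_norm_m_le q r x
  obtain ⟨C, hC0, hC⟩ := exists_norm_mOne_le q r x
  refine ⟨‖derivS q x‖ * M + M * (∫ t, ‖derivS (derivS q) t‖) + M * (∫ t, ‖mulS (derivS q) r t‖) +
    C * ∫ t, ‖mulS q r t‖, fun z hz => ?_⟩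
  have h1 := osc_eq q r hz q x
  have h2 := mOne_eq q r hz x
  have h1' := osc_eq q r hz (derivS q) x
  set A := ∫ t in Ioi x, Complex.exp (2 * Complex.I * z * (t - x)) * (derivS q t * mTwo q r z t)
  set B := ∫ t in Ioi x, Complex.exp (2 * Complex.I * z * (t - x)) * (mulS q r t * mOne q r z t)
    with hB
  have h3 : 2 * Complex.I * z * mOne q r z x - q x * mTwo q r z x = A + B := by
    rw [h2]; linear_combination -h1
  have hzB : z * B = ∫ t in Ioi x, Complex.exp (2 * Complex.I * z * (t - x)) *
      (mulS q r t * (z * mOne q r z t)) := by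
    rw [hB, ← integral_const_mul]
    congr 1
    ext t
    ring
  have h4 : ‖2 * Complex.I * z * A‖ = 2 * ‖z * A‖ := by
    simp only [norm_mul, Complex.norm_I, Complex.norm_ofNat]; ring
  have h5 : ‖derivS q x * mTwo q r z x‖ ≤ ‖derivS q x‖ * M := by
    rw [norm_mul]
    exact mul_le_mul_of_nonneg_left (hM z hz x le_rfl).2 (norm_nonneg _)
  have h6 := norm_osc_le hz (derivS (derivS q)) hM0 fun t (ht : x < t) => (hM z hz t ht.le).2
  have h7 := norm_osc_le hz (mulS (derivS q) r) hM0 fun t (ht : x < t) => (hM z hz t ht.le).1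
  have h8 : ‖z * B‖ ≤ C * ∫ t, ‖mulS q r t‖ := by
    rw [hzB]
    refine norm_osc_le hz (mulS q r) hC0 fun t (ht : x < t) => ?_
    rw [norm_mul]
    exact hC z hz t ht.le
  have h9 : 2 * ‖z * A‖ ≤ ‖derivS q x‖ * M + (M * (∫ t, ‖derivS (derivS q) t‖) +
      M * (∫ t, ‖mulS (derivS q) r t‖)) := by
    rw [← h4, h1', ← neg_add', norm_neg]
    exact (norm_add_le _ _).trans (add_le_add h5 ((norm_add_le _ _).trans (add_le_add h6 h7)))
  rw [h3, ← norm_mul, mul_add]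
  have := norm_add_le (z * A) (z * B)
  have := norm_nonneg (z * A)
  linarith

end Jost

/-! ### A residue theorem for the upper half-plane -/

/-- Neighbourhoods of infinity in the closed upper half-plane. -/
noncomputable def upperInf : Filter ℂ := Bornology.cobounded ℂ ⊓ 𝓟 {z | 0 ≤ z.im}

lemma upperInf_le : upperInf ≤ Bornology.cobounded ℂ := inf_le_left

lemma eventually_upperInf {p : ℂ → Prop} : (∀ᶠ z in upperInf, p z) ↔
    ∃ M : ℝ, ∀ z : ℂ, 0 ≤ z.im → M ≤ ‖z‖ → p z := by
  rw [upperInf, eventually_inf_principal, ← comap_norm_atTop, eventually_comap]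
  simp only [eventually_atTop]
  constructor
  · rintro ⟨M, h⟩
    exact ⟨M, fun z hz hM => h _ hM z rfl hz⟩
  · rintro ⟨M, h⟩
    exact ⟨M, fun b hb z hz hz' => h z hz' (hz ▸ hb)⟩

lemma exists_bound_upperInf {G : ℂ → ℂ} (hG : G =O[upperInf] fun z => (‖z‖ ^ 2)⁻¹) :
    ∃ C M : ℝ, 0 ≤ C ∧ 0 < M ∧ ∀ z : ℂ, 0 ≤ z.im → M ≤ ‖z‖ → ‖G z‖ ≤ C * (‖z‖ ^ 2)⁻¹ := by
  obtain ⟨C, hC0, hC⟩ := hG.exists_nonneg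
  obtain ⟨M, hM⟩ := eventually_upperInf.1 hC.bound
  refine ⟨C, max M 1, hC0, by positivity, fun z hz hz' => ?_⟩
  have := hM z hz ((le_max_left _ _).trans hz')
  rwa [Real.norm_of_nonneg (by positivity)] at this

lemma integrable_of_isBigO_upperInf {G : ℂ → ℂ} (hc : Continuous fun x : ℝ => G x)
    (hG : G =O[upperInf] fun z => (‖z‖ ^ 2)⁻¹) : Integrable fun x : ℝ => G x := by
  obtain ⟨C, M, hC, hM, h⟩ := exists_bound_upperInf hG
  refine hc.locallyIntegrable.integrable_of_isBigO_cocompact (g := fun x : ℝ => (1 + x ^ 2)⁻¹) ?_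
    (integrable_inv_one_add_sq.integrableAtFilter _)
  rw [← Metric.cobounded_eq_cocompact]
  refine Asymptotics.IsBigO.of_bound (C * 2) ?_
  filter_upwards [eventually_cobounded_le_norm (max M 1)] with x hx
  have h1 : 1 ≤ |x| := (le_max_right _ _).trans hx
  have h2 : 1 ≤ x ^ 2 := by rw [← sq_abs]; nlinarith
  refine (h x (by simp) (by simpa using (le_max_left _ _).trans hx)).trans ?_
  rw [Real.norm_of_nonneg (by positivity)]
  simp only [Complex.norm_real, Real.norm_eq_abs, sq_abs]
  rw [mul_assoc]
  gcongr
  rw [inv_eq_one_div, ← div_eq_mul_inv, div_le_div_iff₀ (by positivity) (by positivity)]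
  linarith

/-- Cauchy's theorem on the rectangle with base [-N, N] and height N: the other three sides have
total length 4N, and the integrand is at most C/N² on them. -/
lemma integral_eq_zero_of_differentiableOn {G : ℂ → ℂ} (hc : ContinuousOn G {z | 0 ≤ z.im})
    (hd : DifferentiableOn ℂ G {z | 0 < z.im}) (hG : G =O[upperInf] fun z => (‖z‖ ^ 2)⁻¹) :
    ∫ x : ℝ, G x = 0 := by
  have hcr : Continuous fun x : ℝ => G x :=
    hc.comp_continuous Complex.continuous_ofReal fun x => by simp
  have hint := integrable_of_isBigO_upperInf hcr hG
  obtain ⟨C, M, hC, hM, h⟩ := exists_bound_upperInf hG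
  have hlim := intervalIntegral_tendsto_integral hint (l := atTop) (a := fun N : ℝ => -N)
    (b := fun N => N) tendsto_neg_atTop_atBot tendsto_id
  refine tendsto_nhds_unique hlim (squeeze_zero_norm' (a := fun N : ℝ => 4 * C * N⁻¹) ?_ ?_)
  · filter_upwards [eventually_ge_atTop M] with N hN
    have hN0 : 0 < N := hM.trans_le hN
    have hrect := Complex.integral_boundary_rect_eq_zero_of_continuousOn_of_differentiableOn G
      (-N : ℂ) (N + N * Complex.I) ?_ ?_
    · have hpt : ∀ z : ℂ, 0 ≤ z.im → N ≤ ‖z‖ → ‖G z‖ ≤ C * (N ^ 2)⁻¹ := by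
        intro z hz hzN
        refine (h z hz (hN.trans hzN)).trans ?_
        gcongr
      have h1 : ‖∫ x : ℝ in (-N)..N, G (x + N * Complex.I)‖ ≤ C * (N ^ 2)⁻¹ * |N - -N| := by
        refine intervalIntegral.norm_integral_le_of_norm_le_const fun x _ => hpt _ (by simp [hN0.le]) ?_
        have := Complex.abs_im_le_norm (x + N * Complex.I)
        simp only [Complex.add_im, Complex.ofReal_im, Complex.mul_im, Complex.ofReal_re,
          Complex.I_im, mul_one, Complex.I_re, mul_zero, add_zero, zero_add] at this
        exact (le_abs_self N).trans this
      have h2 : ∀ s : ℝ, |s| = N → ‖∫ y : ℝ in (0)..N, G (s + y * Complex.I)‖ ≤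
          C * (N ^ 2)⁻¹ * |N - 0| := by
        intro s hs
        refine intervalIntegral.norm_integral_le_of_norm_le_const fun y hy => hpt _ ?_ ?_
        · rw [uIoc_of_le hN0.le] at hy
          simp [hy.1.le]
        · have := Complex.abs_re_le_norm (s + y * Complex.I)
          simp only [Complex.add_re, Complex.ofReal_re, Complex.mul_re, Complex.I_re, mul_zero,
            Complex.ofReal_im, Complex.I_im, mul_one, sub_zero, add_zero] at this
          linarith
      have h3 := h2 N (abs_of_pos hN0)
      have h4 := h2 (-N) (by rw [abs_neg, abs_of_pos hN0])
      simp only [Complex.neg_re, Complex.ofReal_re, Complex.add_re, Complex.mul_re, Complex.I_re,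
        mul_zero, Complex.ofReal_im, Complex.I_im, mul_one, sub_zero, add_zero, Complex.neg_im,
        neg_zero, Complex.ofReal_zero, zero_mul, Complex.add_im, Complex.mul_im, zero_add,
        smul_eq_mul] at hrect
      have h5 : ∫ x : ℝ in (-N)..N, G x = (∫ x : ℝ in (-N)..N, G (x + N * Complex.I)) -
          Complex.I * (∫ y : ℝ in (0)..N, G (N + y * Complex.I)) +
          Complex.I * (∫ y : ℝ in (0)..N, G ((-N : ℝ) + y * Complex.I)) := by
        linear_combination hrect
      rw [h5]
      refine (norm_add_le _ _).trans ((add_le_add_left (norm_sub_le _ _) _).trans ?_)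
      simp only [norm_mul, Complex.norm_I, one_mul]
      rw [show N - -N = 2 * N by ring, abs_of_pos (by positivity)] at h1
      rw [sub_zero, abs_of_pos hN0] at h3 h4
      have h6 : C * (N ^ 2)⁻¹ * (2 * N) + C * (N ^ 2)⁻¹ * N + C * (N ^ 2)⁻¹ * N = 4 * C * N⁻¹ := by
        field_simp; ring
      linarith
    · refine hc.mono fun z hz => ?_
      have hz2 := hz.2
      simp only [Complex.neg_im, Complex.ofReal_im, neg_zero, Complex.add_im, Complex.mul_im,
        Complex.ofReal_re, Complex.I_im, mul_one, Complex.I_re, mul_zero, add_zero, zero_add,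
        mem_preimage, uIcc_of_le hN0.le] at hz2
      exact hz2.1
    · refine hd.mono fun z hz => ?_
      have hz2 := hz.2
      simp only [Complex.neg_im, Complex.ofReal_im, neg_zero, Complex.add_im, Complex.mul_im,
        Complex.ofReal_re, Complex.I_im, mul_one, Complex.I_re, mul_zero, add_zero, zero_add,
        mem_preimage, min_eq_left hN0.le, max_eq_right hN0.le] at hz2
      exact hz2.1
  · simpa using tendsto_inv_atTop_zero.const_mul (4 * C)

lemma isBigO_inv_sub (c : ℂ) : (fun z : ℂ => (z - c)⁻¹) =O[Bornology.cobounded ℂ] fun z => ‖z‖⁻¹ := by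
  refine Asymptotics.IsBigO.of_bound 2 ?_
  filter_upwards [eventually_cobounded_le_norm (max (2 * ‖c‖) 1)] with z hz
  have h1 : 2 * ‖c‖ ≤ ‖z‖ := (le_max_left _ _).trans hz
  have h2 : 1 ≤ ‖z‖ := (le_max_right _ _).trans hz
  have h3 : ‖z‖ - ‖c‖ ≤ ‖z - c‖ := norm_sub_norm_le z c
  rw [norm_inv, norm_inv, norm_norm, inv_eq_one_div, ← div_eq_mul_inv,
    div_le_div_iff₀ (by linarith) (by linarith)]
  linarith

lemma isBigO_inv_mul_inv (c d : ℂ) : (fun z : ℂ => (z - c)⁻¹ * (z - d)⁻¹) =O[Bornology.cobounded ℂ]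
    fun z => (‖z‖ ^ 2)⁻¹ := by
  refine ((isBigO_inv_sub c).mul (isBigO_inv_sub d)).congr_right fun z => ?_
  rw [sq, mul_inv]

lemma isBigO_inv_sub_inv (c d : ℂ) : (fun z : ℂ => (z - c)⁻¹ - (z - d)⁻¹) =O[Bornology.cobounded ℂ]
    fun z => (‖z‖ ^ 2)⁻¹ := by
  refine ((isBigO_inv_mul_inv c d).const_mul_left (c - d)).congr' ?_ EventuallyEq.rfl
  filter_upwards [eventually_cobounded_le_norm (max (‖c‖ + 1) (‖d‖ + 1))] with z hz
  have h1 : z - c ≠ 0 := by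
    rw [sub_ne_zero]; rintro rfl
    have := (le_max_left _ _).trans hz
    linarith
  have h2 : z - d ≠ 0 := by
    rw [sub_ne_zero]; rintro rfl
    have := (le_max_right _ _).trans hz
    linarith
  field_simp
  ring

lemma isBigO_pow_inv (c : ℂ) (k : ℕ) : (fun z : ℂ => ((z - c) ^ (k + 2))⁻¹)
    =O[Bornology.cobounded ℂ] fun z => (‖z‖ ^ 2)⁻¹ := by
  have h1 : (fun z : ℂ => (z - c)⁻¹) =O[Bornology.cobounded ℂ] fun _ => (1 : ℝ) := by
    refine (isBigO_inv_sub c).trans (Asymptotics.IsBigO.of_bound 1 ?_)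
    filter_upwards [eventually_cobounded_le_norm 1] with z hz
    rw [norm_inv, norm_norm, norm_one, mul_one]
    exact inv_le_one_of_one_le₀ hz
  refine ((h1.pow k).mul (isBigO_inv_mul_inv c c)).congr (fun z => ?_) fun z => ?_
  · rw [pow_add, mul_inv, inv_pow, sq, mul_inv]
  · simp

lemma tendsto_neg_upperInf : Tendsto (fun z : ℂ => -z) upperInf (Bornology.cobounded ℂ) :=
  Filter.tendsto_neg_cobounded.mono_left upperInf_le

lemma neg_sub_ne_zero_of_im {c z : ℂ} (hc : 0 < c.im) (hz : 0 ≤ z.im) : -z - c ≠ 0 := by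
  intro h
  have := congrArg Complex.im h
  simp at this
  linarith

/-- Functions analytic in the closed lower half-plane with sufficient decay have zero integral. -/
lemma integral_eq_zero_of_neg {G : ℂ → ℂ} (hd : DifferentiableOn ℂ (fun z => G (-z)) {z | 0 ≤ z.im})
    (hG : G =O[Bornology.cobounded ℂ] fun z => (‖z‖ ^ 2)⁻¹) : ∫ x : ℝ, G x = 0 := by
  have h1 := integral_eq_zero_of_differentiableOn (G := fun z => G (-z)) hd.continuousOn
    (hd.mono fun z (hz : 0 < z.im) => hz.le)
    ((hG.comp_tendsto tendsto_neg_upperInf).congr_right fun z => by simp)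
  rw [← h1, ← integral_neg_eq_self]
  simp

/-- The functions by which the principal parts are removed; they are integrable over the line. -/
noncomputable def polarPart (c : ℂ) (k : ℕ) (z : ℂ) : ℂ :=
  ((z - c) ^ (k + 1))⁻¹ - if k = 0 then (z - -Complex.I)⁻¹ else 0

lemma isBigO_polarPart (c : ℂ) (k : ℕ) : polarPart c k =O[Bornology.cobounded ℂ]
    fun z => (‖z‖ ^ 2)⁻¹ := by
  rcases k with _ | k
  · exact (isBigO_inv_sub_inv c (-Complex.I)).congr_left fun z => by simp [polarPart]
  · exact (isBigO_pow_inv c k).congr_left fun z => by simp [polarPart]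

lemma sub_neg_I_ne_zero {z : ℂ} (hz : 0 ≤ z.im) : z - -Complex.I ≠ 0 := by
  intro h
  have := congrArg Complex.im h
  simp at this
  linarith

lemma differentiableAt_polarPart {c z : ℂ} (k : ℕ) (hzc : z ≠ c) (hz : 0 ≤ z.im) :
    DifferentiableAt ℂ (polarPart c k) z := by
  have h0 := sub_ne_zero.2 hzc
  have h1 := sub_neg_I_ne_zero hz
  have h2 : DifferentiableAt ℂ (fun z : ℂ => ((z - c) ^ (k + 1))⁻¹) z :=
    DifferentiableAt.inv (by fun_prop) (pow_ne_zero _ h0)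
  have h3 : DifferentiableAt ℂ (fun z : ℂ => (z - -Complex.I)⁻¹) z :=
    DifferentiableAt.inv (by fun_prop) h1
  refine h2.sub ?_
  split_ifs
  · exact h3
  · exact differentiableAt_const _

/-- Powers beyond the first vanish by closing the contour in the lower half-plane. For the simple
pole, (z - c)⁻¹ - (z - i)⁻¹ vanishes in the same way, and the remainder (x - i)⁻¹ - (x + i)⁻¹ =
2i/(1 + x²) carries the value 2πi. -/
lemma integral_polarPart {c : ℂ} (hc : 0 < c.im) (k : ℕ) :
    ∫ x : ℝ, polarPart c k x = if k = 0 then 2 * Real.pi * Complex.I else 0 := by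
  rcases k with _ | k
  · have hd : DifferentiableOn ℂ (fun z : ℂ => (-z - c)⁻¹ - (-z - Complex.I)⁻¹) {z | 0 ≤ z.im} := by
      intro z hz
      have h1 := neg_sub_ne_zero_of_im hc hz
      have h2 := neg_sub_ne_zero_of_im (c := Complex.I) (by simp) hz
      have h3 : DifferentiableAt ℂ (fun z : ℂ => (-z - c)⁻¹) z := DifferentiableAt.inv (by fun_prop) h1
      have h4 : DifferentiableAt ℂ (fun z : ℂ => (-z - Complex.I)⁻¹) z :=
        DifferentiableAt.inv (by fun_prop) h2
      exact (h3.sub h4).differentiableWithinAt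
    have h1 := integral_eq_zero_of_neg (G := fun z => (z - c)⁻¹ - (z - Complex.I)⁻¹) hd
      (isBigO_inv_sub_inv c Complex.I)
    have hi1 : Integrable fun x : ℝ => ((x : ℂ) - c)⁻¹ - ((x : ℂ) - Complex.I)⁻¹ := by
      refine integrable_of_isBigO_upperInf (G := fun z : ℂ => (z - c)⁻¹ - (z - Complex.I)⁻¹) ?_
        ((isBigO_inv_sub_inv c Complex.I).mono upperInf_le)
      refine (Continuous.inv₀ (by fun_prop) fun x => ?_).sub
        (Continuous.inv₀ (by fun_prop) fun x => ?_)
      · intro h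
        have := congrArg Complex.im h
        simp at this
        linarith
      · intro h
        have := congrArg Complex.im h
        simp at this
    have hi2 : Integrable fun x : ℝ => 2 * Complex.I * (((1 + x ^ 2)⁻¹ : ℝ) : ℂ) :=
      integrable_inv_one_add_sq.ofReal.const_mul _
    have h2 : ∀ x : ℝ, polarPart c 0 x = ((x : ℂ) - c)⁻¹ - ((x : ℂ) - Complex.I)⁻¹ +
        2 * Complex.I * (((1 + x ^ 2)⁻¹ : ℝ) : ℂ) := by
      intro x
      have e1 : (x : ℂ) - Complex.I ≠ 0 := by
        intro h
        have := congrArg Complex.im h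
        simp at this
      have e2 : (x : ℂ) - -Complex.I ≠ 0 := sub_neg_I_ne_zero (by simp)
      have e3 : 1 + (x : ℂ) ^ 2 = (x - Complex.I) * (x - -Complex.I) := by
        linear_combination Complex.I_sq
      have e4 : ((x : ℂ) - Complex.I)⁻¹ - ((x : ℂ) - -Complex.I)⁻¹ =
          2 * Complex.I * (1 + (x : ℂ) ^ 2)⁻¹ := by
        rw [e3]
        field_simp
        ring
      simp only [polarPart, zero_add, pow_one, if_true]
      push_cast
      linear_combination e4
    simp only [h2]
    rw [integral_add hi1 hi2, h1, integral_const_mul, integral_complex_ofReal,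
      integral_univ_inv_one_add_sq]
    simp only [if_true]
    ring
  · have hd : DifferentiableOn ℂ (fun z : ℂ => ((-z - c) ^ (k + 2))⁻¹) {z | 0 ≤ z.im} := by
      intro z hz
      have h1 := neg_sub_ne_zero_of_im hc hz
      have h3 : DifferentiableAt ℂ (fun z : ℂ => ((-z - c) ^ (k + 2))⁻¹) z :=
        DifferentiableAt.inv (by fun_prop) (pow_ne_zero _ h1)
      exact h3.differentiableWithinAt
    have h1 := integral_eq_zero_of_neg (G := fun z => ((z - c) ^ (k + 2))⁻¹) hd (isBigO_pow_inv c k)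
    simpa [polarPart] using h1

lemma circleIntegral_eq_zero_of_differentiableAt {f : ℂ → ℂ} {c : ℂ} {R : ℝ} (hR : 0 ≤ R)
    (hf : ∀ z ∈ Metric.closedBall c R, DifferentiableAt ℂ f z) : ∮ z in C(c, R), f z = 0 :=
  Complex.circleIntegral_eq_zero_of_differentiable_on_off_countable hR countable_empty
    (fun z hz => (hf z hz).continuousAt.continuousWithinAt)
    fun z hz => hf z (Metric.ball_subset_closedBall hz.1)

lemma circleIntegrable_of_differentiableAt {f : ℂ → ℂ} {c : ℂ} {R : ℝ} (hR : 0 ≤ R)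
    (hf : ∀ z ∈ Metric.sphere c R, DifferentiableAt ℂ f z) : CircleIntegrable f c R :=
  ContinuousOn.circleIntegrable hR fun z hz => (hf z hz).continuousAt.continuousWithinAt

lemma circleIntegral_polarPart {c : ℂ} (k : ℕ) {R : ℝ} (hR : 0 < R)
    (hb : ∀ z ∈ Metric.closedBall c R, 0 < z.im) :
    ∮ z in C(c, R), polarPart c k z = if k = 0 then 2 * Real.pi * Complex.I else 0 := by
  have hne : ∀ z ∈ Metric.sphere c R, z ≠ c := fun z hz => ne_of_mem_of_not_mem hz (by simp [hR.ne])
  rcases k with _ | k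
  · have h1 : ∮ z in C(c, R), (z - -Complex.I)⁻¹ = 0 :=
      circleIntegral_eq_zero_of_differentiableAt hR.le fun z hz =>
        DifferentiableAt.inv (by fun_prop) (sub_neg_I_ne_zero (hb z hz).le)
    simp only [polarPart, zero_add, pow_one, if_true]
    rw [circleIntegral.integral_sub, h1, sub_zero, circleIntegral.integral_sub_center_inv c hR.ne']
    · exact circleIntegrable_of_differentiableAt hR.le fun z hz =>
        DifferentiableAt.inv (by fun_prop) (sub_ne_zero.2 (hne z hz))
    · exact circleIntegrable_of_differentiableAt hR.le fun z hz =>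
        DifferentiableAt.inv (by fun_prop)
          (sub_neg_I_ne_zero (hb z (Metric.sphere_subset_closedBall hz)).le)
  · have := circleIntegral.integral_sub_zpow_of_ne (n := -((k : ℤ) + 2)) (by omega) c c R
    simp only [polarPart, Nat.add_eq_zero_iff, one_ne_zero, and_false, if_false, sub_zero]
    rw [← this]
    congr 1

/-- The principal part of a meromorphic function. -/
lemma exists_principal_part {f : ℂ → ℂ} {c : ℂ} (hc : 0 < c.im) (hf : MeromorphicAt f c) :
    ∃ (n : ℕ) (p : ℕ → ℂ) (g : ℂ → ℂ), AnalyticAt ℂ g c ∧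
      ∀ᶠ z in 𝓝[≠] c, f z = ∑ k ∈ Finset.range n, p k * polarPart c k z + g z := by
  have key : ∀ (n : ℕ) (h : ℂ → ℂ), AnalyticAt ℂ h c → ∃ (p : ℕ → ℂ) (g : ℂ → ℂ), AnalyticAt ℂ g c ∧
      ∀ z, z ≠ c → ((z - c) ^ n)⁻¹ * h z = ∑ k ∈ Finset.range n, p k * ((z - c) ^ (k + 1))⁻¹ + g z := by
    intro n
    induction n with
    | zero => exact fun h hh => ⟨0, h, hh, fun z _ => by simp⟩
    | succ n ih =>
      intro h hh
      obtain ⟨s, hs⟩ := hh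
      -- `dslope` splits off one Taylor coefficient at a time; the value h(c) becomes the
      -- coefficient of the highest remaining power of (z - c)⁻¹.
      obtain ⟨p, g, hg, hpg⟩ := ih (dslope h c) ⟨_, hs.has_fpower_series_dslope_fslope⟩
      refine ⟨fun k => if k = n then h c else p k, g, hg, fun z hz => ?_⟩
      have h0 := sub_ne_zero.2 hz
      have h1 : h z = h c + (z - c) * dslope h c z := by
        rw [← smul_eq_mul, sub_smul_dslope]; ring
      rw [Finset.sum_range_succ]
      have h2 : ∑ k ∈ Finset.range n, (if k = n then h c else p k) * ((z - c) ^ (k + 1))⁻¹ =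
          ∑ k ∈ Finset.range n, p k * ((z - c) ^ (k + 1))⁻¹ :=
        Finset.sum_congr rfl fun k hk => by rw [if_neg (Finset.mem_range.1 hk).ne]
      have h3 := hpg z hz
      rw [h2]
      simp only [if_true]
      rw [h1]
      have h4 : ((z - c) ^ (n + 1))⁻¹ * ((z - c) * dslope h c z) = ((z - c) ^ n)⁻¹ * dslope h c z := by
        rw [pow_succ]; field_simp
      linear_combination h3 + h4
  obtain ⟨n, hn⟩ := hf
  obtain ⟨p, g, hg, hpg⟩ := key n _ hn
  have hI : AnalyticAt ℂ (fun z : ℂ => (z - -Complex.I)⁻¹) c :=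
    AnalyticAt.inv (by fun_prop) (sub_neg_I_ne_zero hc.le)
  -- The decay correction at -i contained in `polarPart` is analytic at c, so it is returned to the
  -- regular part.
  refine ⟨n, p, fun z => g z + ∑ k ∈ Finset.range n, p k *
    if k = 0 then (z - -Complex.I)⁻¹ else 0, ?_, ?_⟩
  · refine hg.add (Finset.analyticAt_fun_sum _ fun k _ => analyticAt_const.mul ?_)
    split_ifs
    · exact hI
    · exact analyticAt_const
  · filter_upwards [self_mem_nhdsWithin] with z hz
    have h0 : z - c ≠ 0 := sub_ne_zero.2 hz
    have h1 := hpg z hz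
    have h2 : ((z - c) ^ n)⁻¹ * ((z - c) ^ n • f z) = f z := by
      rw [smul_eq_mul, inv_mul_cancel_left₀ (pow_ne_zero _ h0)]
    rw [h2] at h1
    simp only [polarPart, mul_sub, Finset.sum_sub_distrib]
    rw [h1]
    ring

/-- The residue theorem for the upper half-plane, with the residues written as integrals over small
circles. -/
theorem integral_eq_sum_circleIntegral (S : Finset ℂ) {ρ : ℂ → ℝ} (hρ : ∀ c ∈ S, 0 < ρ c)
    (hball : ∀ c ∈ S, ∀ z ∈ Metric.closedBall c (ρ c), 0 < z.im)
    (hsep : ∀ c ∈ S, ∀ c' ∈ S, c' ∈ Metric.closedBall c (ρ c) → c' = c)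
    {G : ℂ → ℂ} (hc : ∀ z : ℂ, 0 ≤ z.im → z ∉ S → ContinuousWithinAt G {z | 0 ≤ z.im} z)
    (hd : ∀ z : ℂ, 0 < z.im → z ∉ S → DifferentiableAt ℂ G z)
    (hG : G =O[upperInf] fun z => (‖z‖ ^ 2)⁻¹) (hmer : ∀ c ∈ S, MeromorphicAt G c) :
    ∫ x : ℝ, G x = ∑ c ∈ S, ∮ z in C(c, ρ c), G z := by
  induction S using Finset.induction_on generalizing G with
  | empty =>
    rw [Finset.sum_empty]
    exact integral_eq_zero_of_differentiableOn (fun z hz => hc z hz (by simp))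
      (fun z hz => (hd z hz (by simp)).differentiableWithinAt) hG
  | insert c S hcS ih =>
    have hcm : c ∈ insert c S := Finset.mem_insert_self _ _
    have hρc := hρ c hcm
    have him : 0 < c.im := hball c hcm c (Metric.mem_closedBall_self hρc.le)
    obtain ⟨n, p, g, hg, hpg⟩ := exists_principal_part him (hmer c hcm)
    set Q : ℂ → ℂ := fun z => ∑ k ∈ Finset.range n, p k * polarPart c k z with hQ
    -- Subtracting the principal part and correcting the value at c leaves a function with one
    -- singular point fewer and the same decay, to which the induction hypothesis applies.
    set G' : ℂ → ℂ := Function.update (fun z => G z - Q z) c (g c) with hG'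
    have hG'ne : ∀ z, z ≠ c → G' z = G z - Q z := fun z hz => Function.update_of_ne hz _ _
    have hG'ev : ∀ z, z ≠ c → G' =ᶠ[𝓝 z] fun z => G z - Q z := fun z hz => by
      filter_upwards [isOpen_ne.mem_nhds hz] with w hw using hG'ne w hw
    have hQd : ∀ z : ℂ, 0 ≤ z.im → z ≠ c → DifferentiableAt ℂ Q z := fun z hz hzc =>
      DifferentiableAt.fun_sum fun k _ => (differentiableAt_polarPart k hzc hz).const_mul _
    have hG'c : AnalyticAt ℂ G' c := by
      refine hg.congr ?_
      rw [eventually_nhdsWithin_iff] at hpg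
      filter_upwards [hpg] with z hz
      by_cases hzc : z = c
      · subst hzc
        simp [hG']
      · rw [hG'ne z hzc, hz hzc]
        ring
    have hG'd : ∀ z : ℂ, 0 < z.im → z ∉ S → DifferentiableAt ℂ G' z := by
      intro z hz hzS
      by_cases hzc : z = c
      · rw [hzc]
        exact hG'c.differentiableAt
      · exact ((hd z hz (by simp [hzc, hzS])).sub (hQd z hz.le hzc)).congr_of_eventuallyEq
          (hG'ev z hzc)
    have hQO : Q =O[upperInf] fun z => (‖z‖ ^ 2)⁻¹ :=
      Asymptotics.IsBigO.fun_sum fun k _ =>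
        ((isBigO_polarPart c k).mono upperInf_le).const_mul_left _
    have hG'O : G' =O[upperInf] fun z => (‖z‖ ^ 2)⁻¹ := by
      refine (hG.sub hQO).congr' ?_ EventuallyEq.rfl
      refine eventually_upperInf.2 ⟨‖c‖ + 1, fun z _ hz => ?_⟩
      rw [hG'ne]
      rintro rfl
      linarith
    have hreal : ∀ x : ℝ, (x : ℂ) ≠ c := fun x h => by
      rw [← h] at him
      simp at him
    have hnotin : ∀ x : ℝ, (x : ℂ) ∉ insert c S := fun x h => by
      have := hball _ h _ (Metric.mem_closedBall_self (hρ _ h).le)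
      simp at this
    have hIH := ih (fun c' hc' => hρ c' (Finset.mem_insert_of_mem hc'))
      (fun c' hc' => hball c' (Finset.mem_insert_of_mem hc'))
      (fun c' hc' c'' hc'' => hsep c' (Finset.mem_insert_of_mem hc') c'' (Finset.mem_insert_of_mem hc''))
      (G := G') ?_ hG'd hG'O ?_
    · have hiG : Integrable fun x : ℝ => G x := by
        refine integrable_of_isBigO_upperInf ?_ hG
        have : ContinuousOn G ({z | 0 ≤ z.im} \ (insert c S : Finset ℂ)) := fun z hz =>
          (hc z hz.1 (by exact_mod_cast hz.2)).mono sdiff_subset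
        exact this.comp_continuous Complex.continuous_ofReal fun x =>
          ⟨by simp, by exact_mod_cast hnotin x⟩
      have hiP : ∀ k, Integrable fun x : ℝ => polarPart c k x := fun k => by
        refine integrable_of_isBigO_upperInf ?_ ((isBigO_polarPart c k).mono upperInf_le)
        exact continuous_iff_continuousAt.2 fun x =>
          (differentiableAt_polarPart k (hreal x) (by simp)).continuousAt.comp
            Complex.continuous_ofReal.continuousAt
      have hiQ : Integrable fun x : ℝ => Q x :=
        integrable_finsetSum _ fun k _ => (hiP k).const_mul _
      have h1 : ∫ x : ℝ, G' x = (∫ x : ℝ, G x) - ∫ x : ℝ, Q x := by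
        rw [← integral_sub hiG hiQ]
        exact integral_congr_ae (Eventually.of_forall fun x => hG'ne x (hreal x))
      -- The theorem for a single principal part: line and circle integrals agree term by term.
      have h2 : ∫ x : ℝ, Q x = ∮ z in C(c, ρ c), Q z := by
        have hsph : ∀ z ∈ Metric.sphere c (ρ c), z ≠ c := fun z hz =>
          ne_of_mem_of_not_mem hz (by simp [hρc.ne])
        have e1 : ∫ x : ℝ, Q x = ∑ k ∈ Finset.range n, p k * ∫ x : ℝ, polarPart c k x := by
          simp only [hQ]
          rw [integral_finsetSum _ fun k _ => (hiP k).const_mul _]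
          simp only [integral_const_mul]
        have e2 : ∮ z in C(c, ρ c), Q z =
            ∑ k ∈ Finset.range n, p k * ∮ z in C(c, ρ c), polarPart c k z := by
          simp only [hQ]
          rw [circleIntegral.integral_fun_sum]
          · simp only [circleIntegral.integral_const_mul]
          · intro k _
            exact circleIntegrable_of_differentiableAt hρc.le fun z hz =>
              (differentiableAt_polarPart k (hsph z hz)
                (hball c hcm z (Metric.sphere_subset_closedBall hz)).le).const_mul _
        rw [e1, e2]
        refine Finset.sum_congr rfl fun k _ => ?_
        rw [integral_polarPart him, circleIntegral_polarPart k hρc (hball c hcm)]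
      have h3 : ∀ c' ∈ insert c S, ∮ z in C(c', ρ c'), G' z =
          (∮ z in C(c', ρ c'), G z) - ∮ z in C(c', ρ c'), Q z := by
        intro c' hc'
        have hz : ∀ z ∈ Metric.sphere c' (ρ c'), z ∉ insert c S := by
          intro z hz hzS
          have := hsep c' hc' z hzS (Metric.sphere_subset_closedBall hz)
          rw [this] at hz
          simp [(hρ c' hc').ne] at hz
        have hpos : ∀ z ∈ Metric.sphere c' (ρ c'), 0 < z.im := fun z hz =>
          hball c' hc' z (Metric.sphere_subset_closedBall hz)
        have hzc : ∀ z ∈ Metric.sphere c' (ρ c'), z ≠ c := fun z h1 h2 =>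
          hz z h1 (by simp [h2])
        rw [← circleIntegral.integral_sub]
        · exact circleIntegral.integral_congr (hρ c' hc').le fun z h => hG'ne z (hzc z h)
        · exact circleIntegrable_of_differentiableAt (hρ c' hc').le fun z h =>
            hd z (hpos z h) (hz z h)
        · exact circleIntegrable_of_differentiableAt (hρ c' hc').le fun z h =>
            hQd z (hpos z h).le (hzc z h)
      have h4 : ∮ z in C(c, ρ c), G' z = 0 := by
        refine circleIntegral_eq_zero_of_differentiableAt hρc.le fun z hz => ?_
        refine hG'd z (hball c hcm z hz) fun hzS => hcS ?_
        rw [← hsep c hcm z (Finset.mem_insert_of_mem hzS) hz]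
        exact hzS
      have h5 : ∀ c' ∈ S, ∮ z in C(c', ρ c'), G' z = ∮ z in C(c', ρ c'), G z := by
        intro c' hc'
        have hc'm : c' ∈ insert c S := Finset.mem_insert_of_mem hc'
        rw [h3 c' hc'm, circleIntegral_eq_zero_of_differentiableAt (f := Q) (hρ c' hc'm).le,
          sub_zero]
        intro z hz
        refine hQd z (hball c' hc'm z hz).le ?_
        rintro rfl
        have := hsep c' hc'm z hcm hz
        exact hcS (this ▸ hc')
      rw [Finset.sum_insert hcS, ← Finset.sum_congr rfl h5, ← hIH, h1, h2]
      have := h3 c hcm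
      rw [h4] at this
      linear_combination this
    · intro z hz hzS
      by_cases hzc : z = c
      · rw [hzc]
        exact hG'c.continuousAt.continuousWithinAt
      · exact ((hc z hz (by simp [hzc, hzS])).sub
          (hQd z hz hzc).continuousAt.continuousWithinAt).congr_of_eventuallyEq
            ((hG'ev z hzc).filter_mono nhdsWithin_le_nhds) (hG'ne z hzc)
    · intro c' hc'
      have hc'm : c' ∈ insert c S := Finset.mem_insert_of_mem hc'
      have hne : c' ≠ c := fun h => hcS (h ▸ hc')
      have him' : 0 < c'.im := hball c' hc'm c' (Metric.mem_closedBall_self (hρ c' hc'm).le)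
      have hQa : AnalyticAt ℂ Q c' := by
        rw [Complex.analyticAt_iff_eventually_differentiableAt]
        filter_upwards [isOpen_ne.mem_nhds hne,
          (isOpen_lt continuous_const Complex.continuous_im).mem_nhds him'] with z h1 h2
        exact hQd z (le_of_lt h2) h1
      exact ((hmer c' hc'm).sub hQa.meromorphicAt).congr
        ((hG'ev c' hne).symm.filter_mono nhdsWithin_le_nhds)

/-! ### Exponential transforms -/

section ExpTransform

variable {Θ : Type*} [MeasurableSpace Θ]

/-- Weights and frequencies in the upper half-plane that define an exponential transform. -/
structure ExpData (ν : Measure Θ) (freq w : Θ → ℂ) : Prop where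
  meas : Measurable freq
  nonneg : ∀ θ, 0 ≤ (freq θ).im
  integrable : ∀ t : ℝ, Integrable (fun θ => w θ * Complex.exp (Complex.I * freq θ * t)) ν

/-- The exponential transform `t ↦ ∫ w e^{i freq t}`. -/
noncomputable def expT (ν : Measure Θ) (freq w : Θ → ℂ) (t : ℝ) : ℂ :=
  ∫ θ, w θ * Complex.exp (Complex.I * freq θ * t) ∂ν

namespace ExpData

variable {ν : Measure Θ} {freq w : Θ → ℂ}

/-- The frequencies have nonnegative imaginary part, so the integrand at an earlier time dominates
all later ones. This supplies the majorants for exponential transforms. -/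
lemma norm_mono (h : ExpData ν freq w) {s t : ℝ} (hst : s ≤ t) (θ : Θ) :
    ‖w θ * Complex.exp (Complex.I * freq θ * t)‖ ≤ ‖w θ * Complex.exp (Complex.I * freq θ * s)‖ := by
  rw [norm_mul, norm_mul, norm_cexp_I_mul, norm_cexp_I_mul]
  have := mul_le_mul_of_nonneg_left hst (h.nonneg θ)
  gcongr

lemma norm_expT_le (h : ExpData ν freq w) {s t : ℝ} (hst : s ≤ t) :
    ‖expT ν freq w t‖ ≤ ∫ θ, ‖w θ * Complex.exp (Complex.I * freq θ * s)‖ ∂ν :=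
  norm_integral_le_of_norm_le (h.integrable s).norm (Eventually.of_forall (h.norm_mono hst))

lemma continuous_expT (h : ExpData ν freq w) : Continuous (expT ν freq w) := by
  refine continuous_iff_continuousAt.2 fun t => ?_
  refine continuousAt_of_dominated (bound := fun θ =>
    ‖w θ * Complex.exp (Complex.I * freq θ * (t - 1 : ℝ))‖) ?_ ?_ (h.integrable _).norm ?_
  · exact Eventually.of_forall fun t => (h.integrable t).aestronglyMeasurable
  · filter_upwards [lt_mem_nhds (show t - 1 < t by linarith)] with s hs
    exact Eventually.of_forall (h.norm_mono hs.le)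
  · exact Eventually.of_forall fun θ => by fun_prop

lemma hasDerivAt_expT (h : ExpData ν freq w) (h' : ExpData ν freq fun θ => freq θ * w θ) (t : ℝ) :
    HasDerivAt (expT ν freq w) (Complex.I * expT ν freq (fun θ => freq θ * w θ) t) t := by
  have h1 : Complex.I * expT ν freq (fun θ => freq θ * w θ) t = ∫ θ, w θ *
      (Complex.exp (Complex.I * freq θ * t) * (Complex.I * freq θ)) ∂ν := by
    unfold expT
    rw [← integral_const_mul]
    congr 1
    ext θ
    ring
  rw [h1]
  refine (hasDerivAt_integral_of_dominated_loc_of_deriv_le (s := Ioi (t - 1))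
    (F := fun (t : ℝ) θ => w θ * Complex.exp (Complex.I * freq θ * t))
    (F' := fun (t : ℝ) θ => w θ * (Complex.exp (Complex.I * freq θ * t) * (Complex.I * freq θ)))
    (bound := fun θ => ‖freq θ * w θ * Complex.exp (Complex.I * freq θ * (t - 1 : ℝ))‖)
    (Ioi_mem_nhds (by linarith)) (Eventually.of_forall fun t => (h.integrable t).aestronglyMeasurable)
    (h.integrable t) ?_ ?_ (h'.integrable _).norm ?_).2
  · refine ((h'.integrable t).const_mul Complex.I).aestronglyMeasurable.congr
      (Eventually.of_forall fun θ => ?_)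
    ring
  · refine Eventually.of_forall fun θ s hs => ?_
    refine le_trans (le_of_eq ?_) (h'.norm_mono (le_of_lt hs) θ)
    simp only [norm_mul, Complex.norm_I]
    ring
  · exact Eventually.of_forall fun θ s _ => (hasDerivAt_cexp_I_mul (freq θ) s).const_mul _

variable {C : ℝ} {k : ℝ × ℝ → ℂ}

lemma integrable_prod (h : ExpData ν freq w) (hk : Decay C k) (x t : ℝ) :
    Integrable (fun p : Θ × ℝ => w p.1 * Complex.exp (Complex.I * freq p.1 * t) *
      (k (x, p.2) * Complex.exp (Complex.I * freq p.1 * p.2))) (ν.prod (volume.restrict (Ioi 0))) := by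
  have hm := h.meas
  have hkm := hk.cont.measurable
  refine ((h.integrable t).norm.mul_prod ((integrableOn_majorant x).const_mul C)).mono' ?_ ?_
  · refine AEStronglyMeasurable.mul ?_ ?_
    · exact (h.integrable t).aestronglyMeasurable.comp_fst
    · exact Measurable.aestronglyMeasurable (by fun_prop)
  · have : ∀ᵐ p : Θ × ℝ ∂(ν.prod (volume.restrict (Ioi 0))), p.2 ∈ Ioi (0 : ℝ) := by
      refine Measure.quasiMeasurePreserving_snd.ae (p := fun s => s ∈ Ioi (0 : ℝ)) ?_
      exact ae_restrict_mem measurableSet_Ioi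
    filter_upwards [this] with p hp
    rw [norm_mul]
    gcongr
    exact hk.norm_mul_exp_le (h.nonneg _) x (le_of_lt hp)

lemma integrable_mul_lap (h : ExpData ν freq w) (hk : Decay C k) (δ : ℂ) (x t : ℝ) :
    Integrable (fun θ => w θ * Complex.exp (Complex.I * freq θ * t) *
      (δ + lap k (freq θ) x)) ν := by
  have h1 := (h.integrable_prod hk x t).integral_prod_left
  refine ((h.integrable t).mul_const δ).add h1 |>.congr (Eventually.of_forall fun θ => ?_)
  simp only [Pi.add_apply, integral_const_mul, lap]
  ring

variable [SFinite ν]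

/-- Fubini turns a Laplace transform at each frequency into a Marchenko integral of the exponential
transform. The measure is left general so that the same computation covers the real line (reflection
coefficient) and small circles (bound states). -/
lemma integral_mul_lap (h : ExpData ν freq w) (hk : Decay C k) (δ : ℂ) (x t : ℝ) :
    ∫ θ, w θ * Complex.exp (Complex.I * freq θ * t) * (δ + lap k (freq θ) x) ∂ν =
      δ * expT ν freq w t + ∫ s in Ioi (0 : ℝ), k (x, s) * expT ν freq w (t + s) := by
  have h0 := h.integrable_prod hk x t
  have h1 := h0.integral_prod_left
  have h2 : ∀ θ, w θ * Complex.exp (Complex.I * freq θ * t) * (δ + lap k (freq θ) x) =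
      δ * (w θ * Complex.exp (Complex.I * freq θ * t)) + ∫ s in Ioi (0 : ℝ),
        w θ * Complex.exp (Complex.I * freq θ * t) *
        (k (x, s) * Complex.exp (Complex.I * freq θ * s)) := fun θ => by
    rw [integral_const_mul]
    unfold lap
    ring
  simp only [h2]
  rw [integral_add ((h.integrable t).const_mul δ) h1, integral_const_mul,
    integral_integral_swap h0]
  congr 1
  refine integral_congr_ae (Eventually.of_forall fun s => ?_)
  simp only [expT]
  rw [← integral_const_mul]
  congr 1
  ext θ
  rw [show Complex.I * freq θ * ((t + s : ℝ) : ℂ) = Complex.I * freq θ * t + Complex.I * freq θ * s by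
    push_cast; ring, Complex.exp_add]
  ring

end ExpData

end ExpTransform

/-! ### The regularizing factor -/

/-- A factor that is analytic in the upper half-plane, decays there, and tends to `1`. -/
noncomputable def reg (ε : ℝ) (z : ℂ) : ℂ := ((1 - Complex.I * ε * z) ^ 2)⁻¹

lemma one_le_norm_reg_base {ε : ℝ} (hε : 0 ≤ ε) {z : ℂ} (hz : 0 ≤ z.im) :
    1 ≤ ‖1 - Complex.I * ε * z‖ := by
  have h := Complex.abs_re_le_norm (1 - Complex.I * ε * z)
  have h1 : (1 - Complex.I * ε * z).re = 1 + ε * z.im := by simp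
  rw [h1] at h
  have := mul_nonneg hε hz
  linarith [le_abs_self (1 + ε * z.im)]

lemma reg_base_ne_zero {ε : ℝ} (hε : 0 ≤ ε) {z : ℂ} (hz : 0 ≤ z.im) :
    1 - Complex.I * ε * z ≠ 0 := fun h => by
  have := one_le_norm_reg_base hε hz
  rw [h, norm_zero] at this
  linarith

lemma norm_reg_le_one {ε : ℝ} (hε : 0 ≤ ε) {z : ℂ} (hz : 0 ≤ z.im) : ‖reg ε z‖ ≤ 1 := by
  unfold reg
  rw [norm_inv, norm_pow]
  exact inv_le_one_of_one_le₀ (one_le_pow₀ (one_le_norm_reg_base hε hz))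

lemma measurable_reg (ε : ℝ) : Measurable (reg ε) := by
  unfold reg
  fun_prop

lemma tendsto_reg (z : ℂ) : Tendsto (fun ε : ℝ => reg ε z) (𝓝[>] 0) (𝓝 1) := by
  have h : ContinuousAt (fun ε : ℝ => reg ε z) 0 := by
    unfold reg
    refine ContinuousAt.inv₀ (by fun_prop) (by simp)
  have h2 := h.tendsto.mono_left (nhdsWithin_le_nhds (s := Ioi 0))
  simpa [reg] using h2

lemma differentiableAt_reg {ε : ℝ} (hε : 0 ≤ ε) {z : ℂ} (hz : 0 ≤ z.im) :
    DifferentiableAt ℂ (reg ε) z := by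
  unfold reg
  exact DifferentiableAt.inv (by fun_prop) (pow_ne_zero _ (reg_base_ne_zero hε hz))

lemma isBigO_reg {ε : ℝ} (hε : 0 < ε) : reg ε =O[Bornology.cobounded ℂ] fun z => (‖z‖ ^ 2)⁻¹ := by
  refine ((isBigO_pow_inv (-Complex.I / ε) 0).const_mul_left (((-Complex.I * ε) ^ 2)⁻¹)).congr_left
    fun z => ?_
  have hε' : (ε : ℂ) ≠ 0 := by exact_mod_cast hε.ne'
  unfold reg
  rw [← mul_inv, ← mul_pow]
  congr 2
  field_simp
  linear_combination -Complex.I_sq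

/-- The integrand is analytic in the upper half-plane, and the exponential is bounded there. -/
lemma integral_reg_of_nonneg {ε : ℝ} (hε : 0 < ε) {t : ℝ} (ht : 0 ≤ t) :
    ∫ l : ℝ, reg ε l * Complex.exp (Complex.I * l * t) = 0 := by
  have hd : ∀ z : ℂ, 0 ≤ z.im →
      DifferentiableAt ℂ (fun z => reg ε z * Complex.exp (Complex.I * z * t)) z := fun z hz =>
    (differentiableAt_reg hε.le hz).mul (by fun_prop)
  refine integral_eq_zero_of_differentiableOn
    (G := fun z => reg ε z * Complex.exp (Complex.I * z * t))
    (fun z hz => (hd z hz).continuousAt.continuousWithinAt)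
    (fun z hz => (hd z (le_of_lt hz)).differentiableWithinAt) ?_
  refine (Asymptotics.IsBigO.of_bound 1 ?_).trans ((isBigO_reg hε).mono upperInf_le)
  refine eventually_upperInf.2 ⟨0, fun z hz _ => ?_⟩
  rw [norm_mul, one_mul]
  exact mul_le_of_le_one_right (norm_nonneg _) (norm_cexp_I_mul_le_one hz ht)

/-- After the reflection l ↦ -l the exponential is bounded in the upper half-plane and the factor
has a double pole at i/ε. Its residue produces the density of the Gamma law of shape 2 and scale ε,
a one-sided approximate identity. -/
lemma integral_reg_of_neg {ε : ℝ} (hε : 0 < ε) {u : ℝ} (hu : 0 ≤ u) :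
    ∫ l : ℝ, reg ε l * Complex.exp (Complex.I * l * (-u : ℝ)) =
      2 * Real.pi * (u / ε ^ 2 * Real.exp (-(u / ε)) : ℝ) := by
  have hε' : (ε : ℂ) ≠ 0 := by exact_mod_cast hε.ne'
  set c : ℂ := Complex.I / ε with hc
  have hcim : c.im = ε⁻¹ := by simp [hc, Complex.div_ofReal_im]
  set G : ℂ → ℂ := fun z => reg ε (-z) * Complex.exp (Complex.I * z * u) with hG
  have hcne : ∀ z, z ≠ c → 1 - Complex.I * ε * (-z) ≠ 0 := by
    intro z hz h
    apply hz
    rw [hc, eq_div_iff hε']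
    linear_combination -Complex.I * h + (z * ε) * Complex.I_sq
  have hreg : ∀ z, reg ε (-z) = -(1 / ε ^ 2) * (1 / (z - c) ^ (1 + 1)) := by
    intro z
    have : (1 - Complex.I * ε * (-z)) = Complex.I * ε * (z - c) := by
      rw [hc]; field_simp; linear_combination Complex.I_sq
    unfold reg
    rw [this, mul_pow, mul_pow, Complex.I_sq, mul_inv]
    field_simp
  have hd : ∀ z, z ≠ c → DifferentiableAt ℂ G z := by
    intro z hz
    refine DifferentiableAt.mul ?_ (by fun_prop)
    unfold reg
    exact DifferentiableAt.inv (by fun_prop) (pow_ne_zero _ (hcne z hz))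
  have hi : ∫ l : ℝ, reg ε l * Complex.exp (Complex.I * l * (-u : ℝ)) = ∫ l : ℝ, G l := by
    rw [← integral_neg_eq_self]
    congr 1
    ext l
    simp [hG]
  have hpos : 0 < ε⁻¹ / 2 := by positivity
  have hball : ∀ z ∈ Metric.closedBall c (ε⁻¹ / 2), 0 < z.im := by
    intro z hz
    rw [Metric.mem_closedBall, dist_eq_norm] at hz
    have h1 := (Complex.abs_im_le_norm (z - c)).trans hz
    rw [Complex.sub_im, hcim] at h1
    have h2 := neg_abs_le (z.im - ε⁻¹)
    linarith
  have key := integral_eq_sum_circleIntegral {c} (ρ := fun _ => ε⁻¹ / 2) (G := G)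
    (by simpa using hpos) (by simpa using hball) (by simp) ?_ ?_ ?_ ?_
  · rw [hi, key, Finset.sum_singleton]
    have h1 : ∀ z, G z = -(1 / ε ^ 2) * ((1 / (z - c) ^ (1 + 1)) • Complex.exp (Complex.I * z * u)) :=
      fun z => by rw [hG]; simp only; rw [hreg, smul_eq_mul, mul_assoc]
    simp only [h1]
    rw [circleIntegral.integral_const_mul,
      DifferentiableOn.circleIntegral_one_div_sub_center_pow_smul hpos 1
        (Differentiable.differentiableOn (by fun_prop)), iteratedDeriv_one]
    have h2 : HasDerivAt (fun z : ℂ => Complex.exp (Complex.I * z * u))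
        (Complex.exp (Complex.I * c * u) * (Complex.I * u)) c := by
      have : HasDerivAt (fun z : ℂ => Complex.I * z * u) (Complex.I * u) c := by
        simpa using ((hasDerivAt_id c).const_mul Complex.I).mul_const (u : ℂ)
      exact this.cexp
    rw [h2.deriv]
    have h3 : Complex.I * c * u = ((-(u / ε) : ℝ) : ℂ) := by
      rw [hc]; push_cast; field_simp; linear_combination (u : ℂ) * Complex.I_sq
    rw [h3, ← Complex.ofReal_exp]
    push_cast
    simp only [Nat.factorial_one, Nat.cast_one, div_one, smul_eq_mul]
    field_simp
    linear_combination -(u : ℂ) * Complex.I_sq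
  · intro z _ hzS
    exact (hd z (by simpa using hzS)).continuousAt.continuousWithinAt
  · intro z _ hzS
    exact hd z (by simpa using hzS)
  · refine (Asymptotics.IsBigO.of_bound 1 ?_).trans
      (((isBigO_reg hε).comp_tendsto tendsto_neg_upperInf).congr_right fun z => by simp)
    refine eventually_upperInf.2 ⟨0, fun z hz _ => ?_⟩
    rw [hG, norm_mul, one_mul]
    exact mul_le_of_le_one_right (norm_nonneg _) (norm_cexp_I_mul_le_one hz hu)
  · intro z hz
    rw [Finset.mem_singleton.1 hz]
    refine MeromorphicAt.mul ?_ (AnalyticAt.meromorphicAt (by fun_prop))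
    unfold reg
    fun_prop

lemma integrable_reg {ε : ℝ} (hε : 0 < ε) : Integrable fun l : ℝ => reg ε l := by
  refine integrable_of_isBigO_upperInf ?_ ((isBigO_reg hε).mono upperInf_le)
  exact continuous_iff_continuousAt.2 fun x => (differentiableAt_reg hε.le
    (by simp)).continuousAt.comp Complex.continuous_ofReal.continuousAt

/-- Fourier inversion with a summability factor: only s > y contributes, and k(x, ·) is averaged to
the right of y with weight ve^{-v} at scale ε. Continuity of the kernel then recovers its value at y
in the limit. -/
lemma integral_lap_mul_reg {C : ℝ} {k : ℝ × ℝ → ℂ} (hk : Decay C k) {ε : ℝ} (hε : 0 < ε) (x : ℝ)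
    {y : ℝ} (hy : 0 < y) :
    ∫ l : ℝ, reg ε l * Complex.exp (Complex.I * l * y) * lap k (-l) x =
      2 * Real.pi * ∫ v in Ioi (0 : ℝ), k (x, y + ε * v) * (v * Real.exp (-v) : ℝ) := by
  have hkm := hk.cont.measurable
  have hrm := measurable_reg ε
  have h0 : Integrable (fun p : ℝ × ℝ => reg ε p.1 * Complex.exp (Complex.I * p.1 * y) *
      (k (x, p.2) * Complex.exp (Complex.I * -p.1 * p.2)))
      ((volume : Measure ℝ).prod (volume.restrict (Ioi 0))) := by
    refine ((integrable_reg hε).norm.mul_prod (hk.integrableOn x).norm).mono' ?_ ?_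
    · exact Measurable.aestronglyMeasurable (by fun_prop)
    · refine Eventually.of_forall fun p => ?_
      have e1 : ‖Complex.exp (Complex.I * p.1 * y)‖ = 1 := by
        rw [norm_cexp_I_mul]; simp
      have e2 : ‖Complex.exp (Complex.I * -p.1 * p.2)‖ = 1 := by
        rw [norm_cexp_I_mul]; simp
      simp only [norm_mul, e1, e2, mul_one, le_refl]
  have h1 : ∀ l : ℝ, reg ε l * Complex.exp (Complex.I * l * y) * lap k (-l) x =
      ∫ s in Ioi (0 : ℝ), reg ε l * Complex.exp (Complex.I * l * y) *
        (k (x, s) * Complex.exp (Complex.I * -l * s)) := fun l => by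
    rw [integral_const_mul]
    rfl
  simp only [h1]
  rw [integral_integral_swap h0]
  have h2 : ∀ s : ℝ, ∫ l : ℝ, reg ε l * Complex.exp (Complex.I * l * y) *
      (k (x, s) * Complex.exp (Complex.I * -l * s)) = (Ioi y).indicator (fun s => 2 * Real.pi *
        (k (x, y + (s - y)) * ((s - y) / ε ^ 2 * Real.exp (-((s - y) / ε)) : ℝ))) s := by
    intro s
    have e : ∀ l : ℝ, reg ε l * Complex.exp (Complex.I * l * y) *
        (k (x, s) * Complex.exp (Complex.I * -l * s)) =
        k (x, s) * (reg ε l * Complex.exp (Complex.I * l * (y - s : ℝ))) := fun l => by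
      rw [show Complex.I * l * ((y - s : ℝ) : ℂ) = Complex.I * l * y + Complex.I * -l * s by
        push_cast; ring, Complex.exp_add]
      ring
    simp only [e]
    rw [integral_const_mul]
    by_cases hs : y < s
    · rw [indicator_of_mem (mem_Ioi.2 hs)]
      have := integral_reg_of_neg hε (u := s - y) (by linarith)
      rw [neg_sub] at this
      rw [this, add_sub_cancel]
      ring
    · rw [indicator_of_notMem (fun h => hs (mem_Ioi.1 h)), integral_reg_of_nonneg hε (by linarith),
        mul_zero]
  simp only [h2]
  rw [setIntegral_indicator measurableSet_Ioi, Ioi_inter_Ioi, max_eq_right hy.le,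
    integral_Ioi_comp_sub (f := fun u => 2 * Real.pi *
        (k (x, y + u) * (u / ε ^ 2 * Real.exp (-(u / ε)) : ℝ))) y, integral_const_mul]
  congr 1
  have h3 := integral_comp_mul_left_Ioi (fun u : ℝ => k (x, y + u) *
    (u / ε ^ 2 * Real.exp (-(u / ε)) : ℝ)) 0 hε
  rw [mul_zero, eq_inv_smul_iff₀ hε.ne'] at h3
  rw [← h3, Complex.real_smul, ← integral_const_mul]
  congr 1
  ext v
  have hε' : (ε : ℂ) ≠ 0 := by exact_mod_cast hε.ne'
  rw [mul_div_cancel_left₀ _ hε.ne']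
  push_cast
  field_simp

lemma integral_mul_exp_neg : ∫ v in Ioi (0 : ℝ), v * Real.exp (-v) = 1 := by
  have h := Real.Gamma_eq_integral (s := 2) (by norm_num)
  rw [Real.Gamma_two] at h
  rw [h]
  refine setIntegral_congr_fun measurableSet_Ioi fun v _ => ?_
  norm_num
  ring

lemma integrableOn_mul_exp_neg : IntegrableOn (fun v : ℝ => v * Real.exp (-v)) (Ioi 0) := by
  refine (Real.GammaIntegral_convergent (s := 2) (by norm_num)).congr_fun (fun v _ => ?_)
    measurableSet_Ioi
  norm_num
  ring

lemma tendsto_integral_lap_mul_reg {C : ℝ} {k : ℝ × ℝ → ℂ} (hk : Decay C k) (x : ℝ) {y : ℝ}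
    (hy : 0 < y) : Tendsto (fun ε : ℝ =>
      ∫ l : ℝ, reg ε l * Complex.exp (Complex.I * l * y) * lap k (-l) x) (𝓝[>] 0)
      (𝓝 (2 * Real.pi * k (x, y))) := by
  have h1 : Tendsto (fun ε : ℝ => 2 * Real.pi * ∫ v in Ioi (0 : ℝ),
      k (x, y + ε * v) * (v * Real.exp (-v) : ℝ)) (𝓝[>] 0)
      (𝓝 (2 * Real.pi * ∫ v in Ioi (0 : ℝ), k (x, y) * (v * Real.exp (-v) : ℝ))) := by
    refine Tendsto.const_mul _ ?_
    have hkc := hk.cont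
    refine tendsto_integral_filter_of_dominated_convergence (fun v => C * (v * Real.exp (-v)))
      ?_ ?_ (integrableOn_mul_exp_neg.const_mul C) ?_
    · exact Eventually.of_forall fun ε => by fun_prop
    · filter_upwards [self_mem_nhdsWithin] with ε hε
      filter_upwards [ae_restrict_mem measurableSet_Ioi] with v hv
      have hv' : 0 < v := hv
      have hε' : 0 < ε := hε
      have hC := hk.nonneg
      rw [norm_mul, Complex.norm_real, Real.norm_of_nonneg (by positivity)]
      gcongr
      refine (hk.bound x _ (by positivity)).trans ?_
      exact mul_le_of_le_one_right hC (majorant_le_one _)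
    · refine Eventually.of_forall fun v => Tendsto.mul_const _ ?_
      have : Continuous fun ε : ℝ => k (x, y + ε * v) := by fun_prop
      have h2 := (this.tendsto 0).mono_left (nhdsWithin_le_nhds (s := Ioi 0))
      simpa using h2
  rw [integral_const_mul, integral_complex_ofReal, integral_mul_exp_neg] at h1
  simp only [Complex.ofReal_one, mul_one] at h1
  refine h1.congr' ?_
  filter_upwards [self_mem_nhdsWithin] with ε hε
  exact (integral_lap_mul_reg hk hε x hy).symm

lemma ExpData.tendsto_integral_reg {Θ : Type*} [MeasurableSpace Θ] {ν : Measure Θ}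
    {freq w : Θ → ℂ} [SFinite ν] (h : ExpData ν freq w) {C : ℝ} {k : ℝ × ℝ → ℂ} (hk : Decay C k)
    (δ : ℂ) (x t : ℝ) : Tendsto (fun ε : ℝ => ∫ θ, w θ * Complex.exp (Complex.I * freq θ * t) *
      (δ + lap k (freq θ) x) * reg ε (freq θ) ∂ν) (𝓝[>] 0)
      (𝓝 (δ * expT ν freq w t + ∫ s in Ioi (0 : ℝ), k (x, s) * expT ν freq w (t + s))) := by
  rw [← h.integral_mul_lap hk]
  have hi := h.integrable_mul_lap hk δ x t
  refine tendsto_integral_filter_of_dominated_convergence _ ?_ ?_ hi.norm ?_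
  · exact Eventually.of_forall fun ε => hi.aestronglyMeasurable.mul
      ((measurable_reg ε).comp h.meas).aestronglyMeasurable
  · filter_upwards [self_mem_nhdsWithin] with ε hε
    refine Eventually.of_forall fun θ => ?_
    rw [norm_mul]
    exact mul_le_of_le_one_right (norm_nonneg _) (norm_reg_le_one (le_of_lt hε) (h.nonneg θ))
  · refine Eventually.of_forall fun θ => ?_
    simpa using (tendsto_reg (freq θ)).const_mul (w θ * Complex.exp (Complex.I * freq θ * t) *
      (δ + lap k (freq θ) x))

/-! ### The Marchenko equation -/

lemma circleIntegral_eq_integral_Ioc (f : ℂ → ℂ) (c : ℂ) (ρ : ℝ) :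
    ∮ z in C(c, ρ), f z = ∫ θ in Ioc 0 (2 * Real.pi), deriv (circleMap c ρ) θ * f (circleMap c ρ θ) := by
  rw [circleIntegral, intervalIntegral.integral_of_le Real.two_pi_pos.le]
  rfl

lemma expData_circle {B : ℂ → ℂ} {c : ℂ} {ρ : ℝ} (hρ : 0 ≤ ρ)
    (hball : ∀ z ∈ Metric.closedBall c ρ, 0 < z.im) (hB : ContinuousOn B (Metric.sphere c ρ)) :
    ExpData (volume.restrict (Ioc 0 (2 * Real.pi))) (circleMap c ρ)
      (fun θ => deriv (circleMap c ρ) θ * B (circleMap c ρ θ)) where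
  meas := (continuous_circleMap c ρ).measurable
  nonneg θ := (hball _ (circleMap_mem_closedBall c hρ θ)).le
  integrable t := by
    have h : ContinuousOn (fun z => B z * Complex.exp (Complex.I * z * t)) (Metric.sphere c ρ) :=
      hB.mul (by fun_prop)
    have h2 := (h.circleIntegrable hρ).out
    rw [intervalIntegrable_iff_integrableOn_Ioc_of_le Real.two_pi_pos.le] at h2
    refine h2.congr (Eventually.of_forall fun θ => ?_)
    simp only [smul_eq_mul]
    ring

lemma expT_circle (B : ℂ → ℂ) (c : ℂ) (ρ t : ℝ) :
    expT (volume.restrict (Ioc 0 (2 * Real.pi))) (circleMap c ρ)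
      (fun θ => deriv (circleMap c ρ) θ * B (circleMap c ρ θ)) t =
    ∮ z in C(c, ρ), B z * Complex.exp (Complex.I * z * t) := by
  rw [circleIntegral_eq_integral_Ioc]
  unfold expT
  congr 1
  ext θ
  ring

/-- The Marchenko equation for one component of a Jost solution, from a scattering relation on the
real line and the singular behaviour of the other side at finitely many points of the upper
half-plane. -/
theorem marchenko_of_scattering {Ck Cb : ℝ} {k kb : ℝ × ℝ → ℂ} (hk : Decay Ck k)
    (hkb : Decay Cb kb) (δ δb : ℂ) {R : ℝ → ℂ}
    (hR : ExpData volume (fun l : ℝ => (l : ℂ)) R) {x : ℝ} {F : ℂ → ℂ}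
    (hF : ∀ l : ℝ, F l = (δb + lap kb (-l) x) +
      R l * Complex.exp (Complex.I * l * (2 * x : ℝ)) * (δ + lap k l x))
    (S : Finset ℂ) {ρ : ℂ → ℝ} (hρ : ∀ c ∈ S, 0 < ρ c)
    (hball : ∀ c ∈ S, ∀ z ∈ Metric.closedBall c (ρ c), 0 < z.im)
    (hsep : ∀ c ∈ S, ∀ c' ∈ S, c' ∈ Metric.closedBall c (ρ c) → c' = c)
    (hc : ∀ z : ℂ, 0 ≤ z.im → z ∉ S → ContinuousWithinAt F {z | 0 ≤ z.im} z)
    (hd : ∀ z : ℂ, 0 < z.im → z ∉ S → DifferentiableAt ℂ F z)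
    (hFO : F =O[upperInf] fun _ => (1 : ℝ)) (hmer : ∀ c ∈ S, MeromorphicAt F c)
    {B g : ℂ → ℂ → ℂ} (hB : ∀ c ∈ S, ContinuousOn (B c) (Metric.sphere c (ρ c)))
    (hg : ∀ c ∈ S, ∀ z ∈ Metric.closedBall c (ρ c), DifferentiableAt ℂ (g c) z)
    (hFB : ∀ c ∈ S, ∀ z ∈ Metric.sphere c (ρ c), F z =
      B c z * Complex.exp (Complex.I * z * (2 * x : ℝ)) * (δ + lap k z x) + g c z)
    {Ω : ℝ → ℂ} (hΩ : ∀ t, 2 * Real.pi * Ω t = expT volume (fun l : ℝ => (l : ℂ)) R t -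
      ∑ c ∈ S, ∮ z in C(c, ρ c), B c z * Complex.exp (Complex.I * z * t))
    {y : ℝ} (hy : x < y) :
    kb (x, y - x) + δ * Ω (x + y) + ∫ s in Ioi (0 : ℝ), k (x, s) * Ω (x + y + s) = 0 := by
  have hyx : 0 < y - x := sub_pos.2 hy
  have hexp : ∀ z : ℂ, Complex.exp (Complex.I * z * (x + y : ℝ)) =
      Complex.exp (Complex.I * z * (2 * x : ℝ)) * Complex.exp (Complex.I * z * (y - x : ℝ)) := by
    intro z
    rw [← Complex.exp_add]
    push_cast
    ring_nf
  have hE := fun c (h : c ∈ S) => expData_circle (hρ c h).le (hball c h) (hB c h)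
  -- The constant δb does not appear: since y - x > 0, its contribution is a multiple of an integral
  -- that vanishes by analyticity.
  set lhs : ℝ → ℂ := fun ε =>
    (∫ l : ℝ, reg ε l * Complex.exp (Complex.I * l * (y - x : ℝ)) * lap kb (-l) x) +
      ∫ l : ℝ, R l * Complex.exp (Complex.I * l * (x + y : ℝ)) * (δ + lap k l x) * reg ε l with hlhs
  set rhs : ℝ → ℂ := fun ε => ∑ c ∈ S, ∫ θ in Ioc 0 (2 * Real.pi),
    deriv (circleMap c (ρ c)) θ * B c (circleMap c (ρ c) θ) *
      Complex.exp (Complex.I * circleMap c (ρ c) θ * (x + y : ℝ)) *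
      (δ + lap k (circleMap c (ρ c) θ) x) * reg ε (circleMap c (ρ c) θ) with hrhs
  have key : ∀ ε : ℝ, 0 < ε → lhs ε = rhs ε := by
    intro ε hε
    have h1 := integral_eq_sum_circleIntegral S hρ hball hsep
      (G := fun z => F z * Complex.exp (Complex.I * z * (y - x : ℝ)) * reg ε z) ?_ ?_ ?_ ?_
    · have e1 : ∫ l : ℝ, F l * Complex.exp (Complex.I * l * (y - x : ℝ)) * reg ε l = lhs ε := by
        have i1 : Integrable fun l : ℝ =>
            δb * (reg ε l * Complex.exp (Complex.I * l * (y - x : ℝ))) := by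
          refine Integrable.const_mul ?_ _
          refine (integrable_reg hε).mul_bdd (c := 1) (by fun_prop) (Eventually.of_forall fun l => ?_)
          exact norm_cexp_I_mul_le_one (by simp) hyx.le
        have i2 : Integrable fun l : ℝ =>
            reg ε l * Complex.exp (Complex.I * l * (y - x : ℝ)) * lap kb (-l) x := by
          have hcl : Continuous fun l : ℝ => lap kb (-l) x :=
            (hkb.continuousOn_lap_left x).comp_continuous (by fun_prop) fun l => by simp
          have : Integrable fun l : ℝ => reg ε l * (Complex.exp (Complex.I * l * (y - x : ℝ)) *
              lap kb (-l) x) := by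
            refine (integrable_reg hε).mul_bdd (c := 1 * (Cb * tail x)) (by fun_prop)
              (Eventually.of_forall fun l => ?_)
            rw [norm_mul]
            gcongr
            · exact norm_cexp_I_mul_le_one (by simp) hyx.le
            · exact hkb.norm_lap_le (by simp) x
          simpa only [mul_assoc] using this
        have i3 : Integrable fun l : ℝ => R l * Complex.exp (Complex.I * l * (x + y : ℝ)) *
            (δ + lap k l x) * reg ε l := by
          refine (hR.integrable_mul_lap hk δ x (x + y)).mul_bdd (c := 1) ?_
            (Eventually.of_forall fun l => norm_reg_le_one hε.le (by simp))
          exact (integrable_reg hε).aestronglyMeasurable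
        have i0 := integral_reg_of_nonneg hε hyx.le
        rw [hlhs]
        simp only
        rw [← integral_add i2 i3, ← zero_add (∫ _, _ + _), ← mul_zero δb, ← i0,
          ← integral_const_mul]
        refine Eq.trans ?_ (integral_add i1 (i2.add i3))
        congr 1
        ext l
        rw [hF, hexp]
        ring
      rw [← e1, h1, hrhs]
      refine Finset.sum_congr rfl fun c hcS => ?_
      have hcont : ∀ f : ℂ → ℂ, ContinuousOn f (Metric.sphere c (ρ c)) →
          CircleIntegrable f c (ρ c) := fun f hf => hf.circleIntegrable (hρ c hcS).le
      have him : ∀ z ∈ Metric.sphere c (ρ c), 0 < z.im := fun z hz =>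
        hball c hcS z (Metric.sphere_subset_closedBall hz)
      have hregc : ContinuousOn (reg ε) (Metric.sphere c (ρ c)) := fun z hz =>
        (differentiableAt_reg hε.le (him z hz).le).continuousAt.continuousWithinAt
      have hgc : ContinuousOn (g c) (Metric.sphere c (ρ c)) := fun z hz =>
        (hg c hcS z (Metric.sphere_subset_closedBall hz)).continuousAt.continuousWithinAt
      have hlc : ContinuousOn (fun z => lap k z x) (Metric.sphere c (ρ c)) :=
        (hk.continuousOn_lap_left x).mono fun z hz => (him z hz).le
      have hBc := hB c hcS
      -- Only the singular part of F survives on the circle; the term with g is analytic in the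
      -- disk.
      have e2 : ∮ z in C(c, ρ c), F z * Complex.exp (Complex.I * z * (y - x : ℝ)) * reg ε z =
          ∮ z in C(c, ρ c), (B c z * Complex.exp (Complex.I * z * (x + y : ℝ)) *
            (δ + lap k z x) * reg ε z + g c z * Complex.exp (Complex.I * z * (y - x : ℝ)) *
            reg ε z) := by
        refine circleIntegral.integral_congr (hρ c hcS).le fun z hz => ?_
        rw [hFB c hcS z hz, hexp]
        ring
      rw [e2, circleIntegral.integral_add (hcont _ ?_) (hcont _ ?_),
        circleIntegral_eq_zero_of_differentiableAt (hρ c hcS).le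
          (f := fun z => g c z * Complex.exp (Complex.I * z * (y - x : ℝ)) * reg ε z) ?_, add_zero,
        circleIntegral_eq_integral_Ioc]
      · congr 1
        ext θ
        ring
      · intro z hz
        exact ((hg c hcS z hz).mul (by fun_prop)).mul
          (differentiableAt_reg hε.le (hball c hcS z hz).le)
      · exact ((hBc.mul (by fun_prop)).mul (continuousOn_const.add hlc)).mul hregc
      · exact (hgc.mul (by fun_prop)).mul hregc
    · intro z hz hzS
      exact ((hc z hz hzS).mul (Continuous.continuousWithinAt (by fun_prop))).mul
        (differentiableAt_reg hε.le hz).continuousAt.continuousWithinAt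
    · intro z hz hzS
      exact ((hd z hz hzS).mul (by fun_prop)).mul (differentiableAt_reg hε.le hz.le)
    · have h2 : (fun z => Complex.exp (Complex.I * z * (y - x : ℝ))) =O[upperInf]
          fun _ => (1 : ℝ) := by
        refine Asymptotics.IsBigO.of_bound 1 (eventually_upperInf.2 ⟨0, fun z hz _ => ?_⟩)
        simpa using norm_cexp_I_mul_le_one hz hyx.le
      refine ((hFO.mul h2).mul ((isBigO_reg hε).mono upperInf_le)).congr_right fun z => ?_
      simp
    · intro c hcS
      refine ((hmer c hcS).mul (AnalyticAt.meromorphicAt (by fun_prop))).mul ?_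
      unfold reg
      fun_prop
  have l1 : Tendsto lhs (𝓝[>] 0) (𝓝 (2 * Real.pi * kb (x, y - x) +
      (δ * expT volume (fun l : ℝ => (l : ℂ)) R (x + y) +
        ∫ s in Ioi (0 : ℝ), k (x, s) * expT volume (fun l : ℝ => (l : ℂ)) R (x + y + s)))) :=
    (tendsto_integral_lap_mul_reg hkb x hyx).add (hR.tendsto_integral_reg hk δ x (x + y))
  have l2 : Tendsto rhs (𝓝[>] 0) (𝓝 (∑ c ∈ S,
      (δ * (∮ z in C(c, ρ c), B c z * Complex.exp (Complex.I * z * (x + y : ℝ))) +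
        ∫ s in Ioi (0 : ℝ), k (x, s) *
          ∮ z in C(c, ρ c), B c z * Complex.exp (Complex.I * z * (x + y + s : ℝ))))) := by
    refine tendsto_finsetSum _ fun c hcS => ?_
    have := (hE c hcS).tendsto_integral_reg hk δ x (x + y)
    simp only [expT_circle] at this
    exact this
  have l3 := tendsto_nhds_unique (l1.congr' (by
    filter_upwards [self_mem_nhdsWithin] with ε hε using key ε hε)) l2
  have hkE : ∀ {Θ : Type} [MeasurableSpace Θ] {ν : Measure Θ} {freq w : Θ → ℂ},
      ExpData ν freq w → IntegrableOn (fun s => k (x, s) * expT ν freq w (x + y + s)) (Ioi 0) := by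
    intro Θ _ ν freq w h
    have hcE := h.continuous_expT
    refine (hk.integrableOn x).mul_bdd (c := ∫ θ, ‖w θ * Complex.exp (Complex.I * freq θ *
      (x + y : ℝ))‖ ∂ν) (by fun_prop) ?_
    filter_upwards [ae_restrict_mem measurableSet_Ioi] with s hs
    exact h.norm_expT_le (by linarith [mem_Ioi.1 hs])
  have h3 : ∀ s, k (x, s) * Ω (x + y + s) = (2 * Real.pi : ℂ)⁻¹ *
      (k (x, s) * expT volume (fun l : ℝ => (l : ℂ)) R (x + y + s) - ∑ c ∈ S,
        k (x, s) * ∮ z in C(c, ρ c), B c z * Complex.exp (Complex.I * z * (x + y + s : ℝ))) := by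
    intro s
    rw [← Finset.mul_sum, ← mul_sub, ← hΩ]
    have := Real.pi_ne_zero
    field_simp
  have hpi : (2 * Real.pi : ℂ) ≠ 0 := by simp [Real.pi_ne_zero]
  have hci : ∀ c ∈ S, IntegrableOn (fun s => k (x, s) *
      ∮ z in C(c, ρ c), B c z * Complex.exp (Complex.I * z * (x + y + s : ℝ))) (Ioi 0) := by
    intro c hcS
    have := hkE (hE c hcS)
    simpa only [expT_circle] using this
  have h4 : 2 * Real.pi * ∫ s in Ioi (0 : ℝ), k (x, s) * Ω (x + y + s) =
      (∫ s in Ioi (0 : ℝ), k (x, s) * expT volume (fun l : ℝ => (l : ℂ)) R (x + y + s)) - ∑ c ∈ S,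
        ∫ s in Ioi (0 : ℝ), k (x, s) *
          ∮ z in C(c, ρ c), B c z * Complex.exp (Complex.I * z * (x + y + s : ℝ)) := by
    simp only [h3]
    rw [integral_const_mul, mul_inv_cancel_left₀ hpi, integral_sub (hkE hR)
      (integrable_finsetSum _ hci), integral_finsetSum _ hci]
  rw [Finset.sum_add_distrib, ← Finset.mul_sum] at l3
  refine (mul_right_inj' hpi).1 ?_
  linear_combination h4 + δ * hΩ (x + y) + l3

/-! ### Uniqueness for the Marchenko system -/

section Uniqueness

variable {ω ω₁ ω₂ A B u v : ℝ → ℂ} {x₀ x W L : ℝ}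

lemma integrableOn_kernel_mul (hω : Continuous ω) (hW : ∀ t, 2 * x₀ ≤ t → ‖ω t‖ ≤ W)
    (hA : IntegrableOn A (Ioi x₀)) {y : ℝ} (hy : x₀ ≤ y) :
    IntegrableOn (fun z => ω (y + z) * A z) (Ioi x₀) := by
  refine Integrable.bdd_mul (c := W) hA (by fun_prop) ?_
  filter_upwards [ae_restrict_mem measurableSet_Ioi] with z hz
  exact hW _ (by linarith [mem_Ioi.1 hz])

lemma norm_integral_kernel_le {a : ℝ} (hW : ∀ t, 2 * x₀ ≤ t → ‖ω t‖ ≤ W)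
    (hA : IntegrableOn A (Ioc x₀ a)) {y : ℝ} (hy : x₀ ≤ y) :
    ‖∫ z in Ioc x₀ a, ω (y + z) * A z‖ ≤ W * ∫ z in Ioc x₀ a, ‖A z‖ := by
  rw [← integral_const_mul]
  refine norm_integral_le_of_norm_le (hA.norm.const_mul W) ?_
  filter_upwards [ae_restrict_mem measurableSet_Ioc] with z hz
  rw [norm_mul]
  gcongr
  exact hW _ (by linarith [hz.1])

/-- The kernel depends only on the sum of its arguments, so the operator is its own transpose. -/
lemma integral_kernel_swap (hω : Continuous ω) (hW : ∀ t, 2 * x ≤ t → ‖ω t‖ ≤ W)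
    (hA : IntegrableOn A (Ioi x)) (hu : IntegrableOn u (Ioi x)) :
    ∫ y in Ioi x, (∫ z in Ioi x, A z * ω (z + y)) * u y =
      ∫ y in Ioi x, A y * ∫ z in Ioi x, ω (y + z) * u z := by
  have h : Integrable (fun p : ℝ × ℝ => A p.2 * ω (p.2 + p.1) * u p.1)
      ((volume.restrict (Ioi x)).prod (volume.restrict (Ioi x))) := by
    refine (((hu.norm.mul_prod hA.norm)).const_mul W).mono' ?_ ?_
    · exact (hA.aestronglyMeasurable.comp_snd.mul
        (Continuous.aestronglyMeasurable (by fun_prop))).mul hu.aestronglyMeasurable.comp_fst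
    · have h1 : ∀ᵐ p : ℝ × ℝ ∂((volume.restrict (Ioi x)).prod (volume.restrict (Ioi x))),
          p ∈ Ioi x ×ˢ Ioi x := by
        rw [Measure.prod_restrict]
        exact ae_restrict_mem (measurableSet_Ioi.prod measurableSet_Ioi)
      filter_upwards [h1] with p hp
      rw [norm_mul, norm_mul]
      have := hW (p.2 + p.1) (by linarith [mem_Ioi.1 hp.1, mem_Ioi.1 hp.2])
      calc ‖A p.2‖ * ‖ω (p.2 + p.1)‖ * ‖u p.1‖ ≤ ‖A p.2‖ * W * ‖u p.1‖ := by gcongr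
        _ = W * (‖u p.1‖ * ‖A p.2‖) := by ring
  calc ∫ y in Ioi x, (∫ z in Ioi x, A z * ω (z + y)) * u y
      = ∫ y in Ioi x, ∫ z in Ioi x, A z * ω (z + y) * u y := by
        simp only [integral_mul_const]
    _ = ∫ z in Ioi x, ∫ y in Ioi x, A z * ω (z + y) * u y := integral_integral_swap h
    _ = _ := by simp only [mul_assoc, integral_const_mul]

/-- A Volterra inequality for a homogeneous solution, from a row of a Marchenko solution. -/
lemma norm_le_of_marchenko_row (hω₁ : Continuous ω₁) (hω₂ : Continuous ω₂)
    (hW₁ : ∀ t, 2 * x₀ ≤ t → ‖ω₁ t‖ ≤ W) (hW₂ : ∀ t, 2 * x₀ ≤ t → ‖ω₂ t‖ ≤ W)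
    (hu : IntegrableOn u (Ioi x₀)) (hv : IntegrableOn v (Ioi x₀))
    (hue : ∀ y, x₀ < y → u y + ∫ z in Ioi x₀, ω₁ (y + z) * v z = 0)
    (hve : ∀ y, x₀ < y → v y + ∫ z in Ioi x₀, ω₂ (y + z) * u z = 0) (hx : x₀ < x)
    (hA : IntegrableOn A (Ioi x)) (hB : IntegrableOn B (Ioi x))
    (hAe : ∀ y, x < y → A y + ∫ z in Ioi x, B z * ω₂ (z + y) = 0)
    (hBe : ∀ y, x < y → B y + ω₁ (x + y) + ∫ z in Ioi x, A z * ω₁ (z + y) = 0)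
    (hAL : ∫ y in Ioi x, ‖A y‖ ≤ L) (hBL : ∫ y in Ioi x, ‖B y‖ ≤ L) :
    ‖u x‖ ≤ W * (1 + L) * ∫ z in Ioc x₀ x, (‖u z‖ + ‖v z‖) := by
  have hsub : Ioi x ⊆ Ioi x₀ := Ioi_subset_Ioi hx.le
  have hux := hu.mono_set hsub
  have hvx := hv.mono_set hsub
  have huc := hu.mono_set (Ioc_subset_Ioi_self : Ioc x₀ x ⊆ _)
  have hvc := hv.mono_set (Ioc_subset_Ioi_self : Ioc x₀ x ⊆ _)
  have hW₁' : ∀ t, 2 * x ≤ t → ‖ω₁ t‖ ≤ W := fun t ht => hW₁ t (by linarith)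
  have hW₂' : ∀ t, 2 * x ≤ t → ‖ω₂ t‖ ≤ W := fun t ht => hW₂ t (by linarith)
  have hsplit : ∀ {ω f : ℝ → ℂ}, Continuous ω → (∀ t, 2 * x₀ ≤ t → ‖ω t‖ ≤ W) →
      IntegrableOn f (Ioi x₀) → ∀ y, x ≤ y → ∫ z in Ioi x₀, ω (y + z) * f z =
        (∫ z in Ioc x₀ x, ω (y + z) * f z) + ∫ z in Ioi x, ω (y + z) * f z := by
    intro ω f hω hW hf y hy
    have := integrableOn_kernel_mul hω hW hf (hx.le.trans hy)
    rw [← setIntegral_union (Ioc_disjoint_Ioi le_rfl) measurableSet_Ioi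
      (this.mono_set Ioc_subset_Ioi_self) (this.mono_set hsub), Ioc_union_Ioi_eq_Ioi hx.le]
  have iA := integrableOn_kernel_mul hω₁ hW₁' hvx le_rfl
  have bdd : ∀ {ω f : ℝ → ℂ}, Continuous ω → (∀ t, 2 * x ≤ t → ‖ω t‖ ≤ W) →
      IntegrableOn f (Ioi x) → ∀ y, x < y → ‖∫ z in Ioi x, ω (y + z) * f z‖ ≤
        ∫ z in Ioi x, W * ‖f z‖ := by
    intro ω f hω hW hf y hy
    refine norm_integral_le_of_norm_le (hf.norm.const_mul W) ?_
    filter_upwards [ae_restrict_mem measurableSet_Ioi] with z hz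
    rw [norm_mul]
    gcongr
    exact hW _ (by linarith [mem_Ioi.1 hz])
  -- The row equations are paired with u and v over (x, ∞), and the operators are moved over to u
  -- and v.
  have e1 : ∫ y in Ioi x, A y * u y = -∫ y in Ioi x, B y * ∫ z in Ioi x, ω₂ (y + z) * u z := by
    rw [← integral_kernel_swap hω₂ hW₂' hB hux, ← integral_neg]
    refine setIntegral_congr_fun measurableSet_Ioi fun y hy => ?_
    linear_combination u y * hAe y hy
  have imul : ∀ {f g h ω : ℝ → ℂ}, (∀ t, 2 * x₀ ≤ t → ‖ω t‖ ≤ W) →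
      IntegrableOn f (Ioi x) → IntegrableOn g (Ioi x) → IntegrableOn h (Ioi x₀) →
      (∀ y, x₀ < y → g y + ∫ z in Ioi x₀, ω (y + z) * h z = 0) →
      IntegrableOn (fun y => f y * g y) (Ioi x) := by
    intro f g h ω hW hf hg hh hge
    refine Integrable.mul_bdd hf hg.aestronglyMeasurable (c := ∫ z in Ioi x₀, W * ‖h z‖) ?_
    filter_upwards [ae_restrict_mem measurableSet_Ioi] with y hy
    rw [eq_neg_of_add_eq_zero_left (hge y (hx.trans hy)), norm_neg]
    refine norm_integral_le_of_norm_le (hh.norm.const_mul W) ?_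
    filter_upwards [ae_restrict_mem measurableSet_Ioi] with z hz
    rw [norm_mul]
    gcongr
    exact hW _ (by linarith [mem_Ioi.1 hz, mem_Ioi.1 hy])
  have iBv := imul hW₂ hB hvx hu hve
  have e2 : (∫ y in Ioi x, B y * v y) + ∫ y in Ioi x, ω₁ (x + y) * v y =
      -∫ y in Ioi x, A y * ∫ z in Ioi x, ω₁ (y + z) * v z := by
    rw [← integral_kernel_swap hω₁ hW₁' hA hvx, ← integral_neg, ← integral_add iBv iA]
    refine setIntegral_congr_fun measurableSet_Ioi fun y hy => ?_
    linear_combination v y * hBe y hy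
  have e3 : ∀ {f g h ω : ℝ → ℂ}, Continuous ω → (∀ t, 2 * x₀ ≤ t → ‖ω t‖ ≤ W) →
      IntegrableOn f (Ioi x) → IntegrableOn g (Ioi x) → IntegrableOn h (Ioi x₀) →
      (∀ y, x₀ < y → g y + ∫ z in Ioi x₀, ω (y + z) * h z = 0) →
      ∫ y in Ioi x, ‖f y‖ ≤ L →
      ‖(∫ y in Ioi x, f y * g y) + ∫ y in Ioi x, f y * ∫ z in Ioi x, ω (y + z) * h z‖ ≤
        L * (W * ∫ z in Ioc x₀ x, ‖h z‖) := by
    intro f g h ω hω hW hf hg hh hge hfL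
    have hfg := imul hW hf hg hh hge
    have hhc := hh.mono_set (Ioc_subset_Ioi_self : Ioc x₀ x ⊆ _)
    have hhx := hh.mono_set hsub
    have h1 : (∫ y in Ioi x, f y * g y) + ∫ y in Ioi x, f y * ∫ z in Ioi x, ω (y + z) * h z =
        -∫ y in Ioi x, f y * ∫ z in Ioc x₀ x, ω (y + z) * h z := by
      rw [← integral_neg, ← integral_add hfg]
      · refine setIntegral_congr_fun measurableSet_Ioi fun y hy => ?_
        have hy' : x < y := hy
        have := hge y (hx.trans hy')
        rw [hsplit hω hW hh y hy'.le] at this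
        linear_combination f y * this
      · refine Integrable.mul_bdd hf ?_ (c := ∫ z in Ioi x, W * ‖h z‖) ?_
        · exact AEStronglyMeasurable.integral_prod_right' (μ := volume.restrict (Ioi x))
            (f := fun p : ℝ × ℝ => ω (p.1 + p.2) * h p.2)
            ((Continuous.aestronglyMeasurable (by fun_prop)).mul hhx.aestronglyMeasurable.comp_snd)
        · filter_upwards [ae_restrict_mem measurableSet_Ioi] with y hy
          exact bdd hω (fun t ht => hW t (by linarith)) hhx y hy
    rw [h1, norm_neg]
    refine (norm_integral_le_of_norm_le (hf.norm.mul_const (W * ∫ z in Ioc x₀ x, ‖h z‖)) ?_).trans ?_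
    · filter_upwards [ae_restrict_mem measurableSet_Ioi] with y hy
      rw [norm_mul]
      gcongr
      exact norm_integral_kernel_le hW hhc (hx.le.trans (le_of_lt hy))
    · rw [integral_mul_const]
      have : 0 ≤ W := (norm_nonneg _).trans (hW _ le_rfl)
      gcongr
  have e4 := e3 hω₁ hW₁ hA hux hv hue hAL
  have e5 := e3 hω₂ hW₂ hB hvx hu hve hBL
  -- The inhomogeneous term ω₁(x + y) of the row, paired with v, is exactly the tail of the
  -- homogeneous equation at the point x. Eliminating it expresses u(x) through quantities supported
  -- on (x₀, x].
  have e6 : u x = -(∫ z in Ioc x₀ x, ω₁ (x + z) * v z) +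
      (((∫ y in Ioi x, A y * u y) + ∫ y in Ioi x, A y * ∫ z in Ioi x, ω₁ (y + z) * v z) +
      ((∫ y in Ioi x, B y * v y) + ∫ y in Ioi x, B y * ∫ z in Ioi x, ω₂ (y + z) * u z)) := by
    have := hue x hx
    rw [hsplit hω₁ hW₁ hv x le_rfl] at this
    linear_combination this - e1 - e2
  rw [e6, integral_add huc.norm hvc.norm]
  refine (norm_add_le _ _).trans ?_
  have e7 := norm_integral_kernel_le hW₁ hvc hx.le
  have h0 : 0 ≤ ∫ z in Ioc x₀ x, ‖u z‖ := integral_nonneg fun _ => norm_nonneg _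
  have hW0 : 0 ≤ W := (norm_nonneg _).trans (hW₁ _ le_rfl)
  rw [norm_neg]
  have e8 := norm_add_le
    ((∫ y in Ioi x, A y * u y) + ∫ y in Ioi x, A y * ∫ z in Ioi x, ω₁ (y + z) * v z)
    ((∫ y in Ioi x, B y * v y) + ∫ y in Ioi x, B y * ∫ z in Ioi x, ω₂ (y + z) * u z)
  nlinarith [mul_nonneg hW0 h0]

/-- N is merely integrable, so Grönwall's inequality is applied after two integrations: the
primitive J of N is continuous, J ≤ G for the primitive G of MJ, and G is differentiable with |G'| ≤
M|G| and G(x₀) = 0. -/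
lemma eq_zero_of_le_integral {N : ℝ → ℝ} {M : ℝ} (hN : IntegrableOn N (Ioi x₀)) (hM : 0 ≤ M)
    (h0 : ∀ x, 0 ≤ N x) (h : ∀ x, x₀ < x → N x ≤ M * ∫ z in Ioc x₀ x, N z) {x : ℝ} (hx : x₀ < x) :
    N x = 0 := by
  have hN' : ∀ a b, x₀ ≤ a → IntegrableOn N (Ioc a b) := fun a b ha =>
    hN.mono_set (Ioc_subset_Ioi_self.trans (Ioi_subset_Ioi ha))
  set J : ℝ → ℝ := fun y => ∫ z in x₀..y, (Ioi x₀).indicator N z with hJ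
  have hJc : Continuous J :=
    intervalIntegral.continuous_primitive (fun a b => (hN.integrable_indicator
      measurableSet_Ioi).intervalIntegrable) x₀
  have hJe : ∀ y, x₀ ≤ y → J y = ∫ z in Ioc x₀ y, N z := by
    intro y hy
    rw [hJ]
    simp only
    rw [intervalIntegral.integral_of_le hy]
    exact setIntegral_congr_fun measurableSet_Ioc fun z hz => indicator_of_mem hz.1 _
  have hJ0 : ∀ y, x₀ ≤ y → 0 ≤ J y := fun y hy => by
    rw [hJe y hy]
    exact integral_nonneg h0
  set G : ℝ → ℝ := fun y => ∫ z in x₀..y, M * J z with hG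
  have hGd : ∀ y, HasDerivAt G (M * J y) y := fun y =>
    (continuous_const.mul hJc).integral_hasStrictDerivAt x₀ y |>.hasDerivAt
  have hJG : ∀ y, x₀ ≤ y → J y ≤ G y := by
    intro y hy
    rw [hJe y hy, hG]
    simp only
    rw [intervalIntegral.integral_of_le hy]
    refine setIntegral_mono_on (hN' x₀ y le_rfl) ((continuous_const.mul hJc).integrableOn_Ioc)
      measurableSet_Ioc fun z hz => ?_
    rw [hJe z hz.1.le]
    exact h z hz.1
  have hGz := norm_le_gronwallBound_of_norm_deriv_right_le (f := G) (f' := fun y => M * J y)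
    (δ := 0) (K := M) (ε := 0) (a := x₀) (b := x)
    (fun y _ => (hGd y).continuousAt.continuousWithinAt) (fun y _ => (hGd y).hasDerivWithinAt)
    (by simp [hG]) (fun y hy => ?_) x ⟨hx.le, le_rfl⟩
  · rw [gronwallBound_ε0_δ0] at hGz
    have h1 := hJG x hx.le
    have h2 := hJ0 x hx.le
    have h3 : G x = 0 := norm_le_zero_iff.1 hGz
    have h4 := h x hx
    rw [← hJe x hx.le, le_antisymm (h3 ▸ h1) h2, mul_zero] at h4
    exact le_antisymm h4 (h0 x)
  · have h1 := hJG y hy.1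
    have h2 := hJ0 y hy.1
    rw [Real.norm_of_nonneg (mul_nonneg hM h2), Real.norm_of_nonneg (h2.trans h1), add_zero]
    gcongr

/-- A homogeneous solution of the Marchenko system vanishes when the matrix Marchenko system has
solutions with uniformly bounded rows on the half-line. -/
theorem eq_zero_of_homogeneous_marchenko {A B C D : ℝ → ℝ → ℂ}
    (hω₁ : Continuous ω₁) (hω₂ : Continuous ω₂)
    (hW₁ : ∀ t, 2 * x₀ ≤ t → ‖ω₁ t‖ ≤ W) (hW₂ : ∀ t, 2 * x₀ ≤ t → ‖ω₂ t‖ ≤ W)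
    (hu : IntegrableOn u (Ioi x₀)) (hv : IntegrableOn v (Ioi x₀))
    (hue : ∀ y, x₀ < y → u y + ∫ z in Ioi x₀, ω₁ (y + z) * v z = 0)
    (hve : ∀ y, x₀ < y → v y + ∫ z in Ioi x₀, ω₂ (y + z) * u z = 0)
    (hA : ∀ x, x₀ < x → IntegrableOn (A x) (Ioi x)) (hB : ∀ x, x₀ < x → IntegrableOn (B x) (Ioi x))
    (hC : ∀ x, x₀ < x → IntegrableOn (C x) (Ioi x)) (hD : ∀ x, x₀ < x → IntegrableOn (D x) (Ioi x))
    (hAe : ∀ x y, x₀ < x → x < y → A x y + ∫ z in Ioi x, B x z * ω₂ (z + y) = 0)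
    (hBe : ∀ x y, x₀ < x → x < y → B x y + ω₁ (x + y) + ∫ z in Ioi x, A x z * ω₁ (z + y) = 0)
    (hCe : ∀ x y, x₀ < x → x < y → C x y + ω₂ (x + y) + ∫ z in Ioi x, D x z * ω₂ (z + y) = 0)
    (hDe : ∀ x y, x₀ < x → x < y → D x y + ∫ z in Ioi x, C x z * ω₁ (z + y) = 0)
    (hAL : ∀ x, x₀ < x → ∫ y in Ioi x, ‖A x y‖ ≤ L) (hBL : ∀ x, x₀ < x → ∫ y in Ioi x, ‖B x y‖ ≤ L)
    (hCL : ∀ x, x₀ < x → ∫ y in Ioi x, ‖C x y‖ ≤ L) (hDL : ∀ x, x₀ < x → ∫ y in Ioi x, ‖D x y‖ ≤ L)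
    {x : ℝ} (hx : x₀ < x) : u x = 0 ∧ v x = 0 := by
  have hW0 : 0 ≤ W := (norm_nonneg _).trans (hW₁ _ le_rfl)
  have hL0 : 0 ≤ L := (integral_nonneg fun _ => norm_nonneg _).trans (hAL x hx)
  have h := eq_zero_of_le_integral (N := fun y => ‖u y‖ + ‖v y‖) (M := 2 * (W * (1 + L)))
    (hu.norm.add hv.norm) (by positivity) (fun y => by positivity) (fun y hy => ?_) hx
  · have h1 := norm_nonneg (u x)
    have h2 := norm_nonneg (v x)
    exact ⟨norm_eq_zero.1 (by linarith), norm_eq_zero.1 (by linarith)⟩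
  · have h1 := norm_le_of_marchenko_row hω₁ hω₂ hW₁ hW₂ hu hv hue hve hy (hA y hy) (hB y hy)
      (fun z => hAe y z hy) (fun z => hBe y z hy) (hAL y hy) (hBL y hy)
    -- For v the two kernels exchange their roles, and the other row of the matrix solution is used.
    have h2 := norm_le_of_marchenko_row hω₂ hω₁ hW₂ hW₁ hv hu hve hue hy (hD y hy) (hC y hy)
      (fun z => hDe y z hy) (fun z => hCe y z hy) (hDL y hy) (hCL y hy)
    simp only [add_comm ‖v _‖] at h2
    linarith

end Uniqueness

/-! ### Trace-free linear systems -/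

/-- `(u, v)` solves the system with the trace-free matrix `!![A, B; C, -A]`. -/
structure LinSol (A B C u v : ℝ → ℂ) : Prop where
  deriv₁ : ∀ x, HasDerivAt u (A x * u x + B x * v x) x
  deriv₂ : ∀ x, HasDerivAt v (C x * u x - A x * v x) x

namespace LinSol

variable {A B C u v u' v' : ℝ → ℂ}

lemma sub_smul (h : LinSol A B C u v) (h' : LinSol A B C u' v') (κ : ℂ) :
    LinSol A B C (fun x => u x - κ * u' x) (fun x => v x - κ * v' x) where
  deriv₁ x := ((h.deriv₁ x).sub ((h'.deriv₁ x).const_mul κ)).congr_deriv (by ring)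
  deriv₂ x := ((h.deriv₂ x).sub ((h'.deriv₂ x).const_mul κ)).congr_deriv (by ring)

lemma wronskian_eq (h : LinSol A B C u v) (h' : LinSol A B C u' v') (x y : ℝ) :
    u x * v' x - u' x * v x = u y * v' y - u' y * v y := by
  have hd : ∀ x, HasDerivAt (fun x => u x * v' x - u' x * v x) 0 x := fun x =>
    (((h.deriv₁ x).mul (h'.deriv₂ x)).sub ((h'.deriv₁ x).mul (h.deriv₂ x))).congr_deriv (by ring)
  exact is_const_of_deriv_eq_zero (fun x => (hd x).differentiableAt) (fun x => (hd x).deriv) x y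

/-- Exchanging the components reverses the sign of the spectral parameter and swaps the potentials.
It carries results on the unbarred solutions over to the barred ones. -/
lemma swap (h : LinSol A B C u v) : LinSol (-A) C B v u where
  deriv₁ x := (h.deriv₂ x).congr_deriv (by simp; ring)
  deriv₂ x := (h.deriv₁ x).congr_deriv (by simp; ring)

/-- This exchanges the two ends of the line without changing the spectral parameter, so left Jost
solutions are right Jost solutions for oddly reflected potentials. -/
lemma reflect (h : LinSol A B C u v) : LinSol (fun x => A (-x)) (fun x => -C (-x))
    (fun x => -B (-x)) (fun x => v (-x)) (fun x => u (-x)) where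
  deriv₁ x := ((h.deriv₂ (-x)).scomp x (hasDerivAt_neg x)).congr_deriv (by simp; ring)
  deriv₂ x := ((h.deriv₁ (-x)).scomp x (hasDerivAt_neg x)).congr_deriv (by simp; ring)

lemma eq_zero {M : ℝ} (hA : ∀ x, ‖A x‖ ≤ M) (hB : ∀ x, ‖B x‖ ≤ M) (hC : ∀ x, ‖C x‖ ≤ M)
    (h : LinSol A B C u v) {x₀ : ℝ} (hu : u x₀ = 0) (hv : v x₀ = 0) (x : ℝ) : u x = 0 ∧ v x = 0 := by
  have hM : 0 ≤ M := (norm_nonneg _).trans (hA 0)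
  have h1 := ODE_solution_unique_univ (K := (2 * M).toNNReal) (s := fun _ => univ)
    (v := fun x (p : ℂ × ℂ) => (A x * p.1 + B x * p.2, C x * p.1 - A x * p.2))
    (f := fun x => (u x, v x)) (g := fun _ => (0, 0)) (t₀ := x₀) (fun t => ?_)
    (fun t => ⟨(h.deriv₁ t).prodMk (h.deriv₂ t), mem_univ _⟩)
    (fun t => ⟨(hasDerivAt_const t ((0, 0) : ℂ × ℂ)).congr_deriv (by simp; rfl), mem_univ _⟩) (by simp [hu, hv])
  · have := congrFun h1 x
    exact ⟨congrArg Prod.fst this, congrArg Prod.snd this⟩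
  · refine LipschitzOnWith.of_dist_le_mul fun p _ p' _ => ?_
    rw [Real.coe_toNNReal _ (by positivity)]
    have e1 : ‖p.1 - p'.1‖ ≤ dist p p' := by
      rw [dist_eq_norm]; exact norm_fst_le (p - p')
    have e2 : ‖p.2 - p'.2‖ ≤ dist p p' := by
      rw [dist_eq_norm]; exact norm_snd_le (p - p')
    have key : ∀ {a b : ℂ}, ‖a‖ ≤ M → ‖b‖ ≤ M →
        ‖a * (p.1 - p'.1) + b * (p.2 - p'.2)‖ ≤ 2 * M * dist p p' := by
      intro a b ha hb
      refine (norm_add_le _ _).trans ?_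
      rw [norm_mul, norm_mul]
      calc ‖a‖ * ‖p.1 - p'.1‖ + ‖b‖ * ‖p.2 - p'.2‖ ≤ M * dist p p' + M * dist p p' := by gcongr
        _ = _ := by ring
    rw [dist_eq_norm, Prod.norm_def]
    refine max_le ?_ ?_
    · refine le_trans (le_of_eq ?_) (key (hA t) (hB t))
      congr 1
      simp only [Prod.fst_sub]
      ring
    · refine le_trans (le_of_eq ?_) (key (hC t) (by simpa using hA t : ‖-A t‖ ≤ M))
      congr 1
      simp only [Prod.snd_sub]
      ring

/-- The solution with asymptotics `(o(1), e^{izx} (1 + o(1)))` at `+∞` is unique. -/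
lemma unique {M : ℝ} (hA : ∀ x, ‖A x‖ ≤ M) (hB : ∀ x, ‖B x‖ ≤ M) (hC : ∀ x, ‖C x‖ ≤ M)
    {z : ℂ} (hz : 0 ≤ z.im) (h : LinSol A B C u v) (h' : LinSol A B C u' v')
    (hu : Tendsto u atTop (𝓝 0))
    (hv : Tendsto (fun x : ℝ => Complex.exp (-(Complex.I * z * x)) * v x) atTop (𝓝 1))
    (hu' : Tendsto u' atTop (𝓝 0))
    (hv' : Tendsto (fun x : ℝ => Complex.exp (-(Complex.I * z * x)) * v' x) atTop (𝓝 1)) :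
    u = u' ∧ v = v' := by
  have hexp : ∀ (w : ℝ → ℂ) (x : ℝ), w x = Complex.exp (Complex.I * z * x) *
      (Complex.exp (-(Complex.I * z * x)) * w x) := fun w x => by
    rw [← mul_assoc, ← Complex.exp_add, add_neg_cancel, Complex.exp_zero, one_mul]
  have hbd : ∀ {f w : ℝ → ℂ}, Tendsto f atTop (𝓝 0) →
      Tendsto (fun x : ℝ => Complex.exp (-(Complex.I * z * x)) * w x) atTop (𝓝 1) →
      Tendsto (fun x => f x * w x) atTop (𝓝 0) := by
    intro f w hf hw
    have h1 : Tendsto (fun x => f x * (Complex.exp (-(Complex.I * z * x)) * w x)) atTop (𝓝 0) := by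
      simpa using hf.mul hw
    refine squeeze_zero_norm' ?_ (tendsto_zero_iff_norm_tendsto_zero.1 h1)
    filter_upwards [eventually_ge_atTop 0] with x hx
    rw [norm_mul, norm_mul (f x)]
    gcongr
    nth_rewrite 1 [hexp w x]
    rw [norm_mul]
    exact mul_le_of_le_one_left (norm_nonneg _) (norm_cexp_I_mul_le_one hz hx)
  -- The Wronskian is constant and tends to 0 at +∞: in each product the growth of one factor is no
  -- worse than its normalization allows, while the other tends to 0.
  have hW : ∀ x, u x * v' x - u' x * v x = 0 := by
    intro x
    have h1 : Tendsto (fun y => u y * v' y - u' y * v y) atTop (𝓝 0) := by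
      simpa using (hbd hu hv').sub (hbd hu' hv)
    refine tendsto_nhds_unique ?_ h1
    exact tendsto_const_nhds.congr fun y => h.wronskian_eq h' x y
  -- Far to the right the second components do not vanish; with zero Wronskian the solutions are
  -- proportional, and the common limit 1 fixes the ratio.
  obtain ⟨x₀, hx₀, hx₀'⟩ := ((hv.eventually_ne one_ne_zero).and (hv'.eventually_ne one_ne_zero)).exists
  have hvx' : v' x₀ ≠ 0 := right_ne_zero_of_mul hx₀'
  have hprop := fun x => (h.sub_smul h' (v x₀ / v' x₀)).eq_zero hA hB hC (x₀ := x₀)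
    (by field_simp; linear_combination hW x₀) (by field_simp; ring) x
  have hκ : v x₀ / v' x₀ = 1 := by
    have h1 := hv'.const_mul (v x₀ / v' x₀)
    rw [mul_one] at h1
    refine tendsto_nhds_unique h1 (hv.congr fun x => ?_)
    linear_combination Complex.exp (-(Complex.I * z * x)) * (hprop x).2
  rw [hκ] at hprop
  constructor <;> ext x
  · linear_combination (hprop x).1
  · linear_combination (hprop x).2

end LinSol

/-! ### Scattering data -/

lemma Sol.linSol {q r u v : ℝ → ℂ} {z : ℂ} (h : Sol q r z u v) :
    LinSol (fun _ => -Complex.I * z) q r u v where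
  deriv₁ := h.deriv₁
  deriv₂ x := (h.deriv₂ x).congr_deriv (by ring)

section Scattering

variable (q r : 𝓢(ℝ, ℂ)) {z : ℂ}

/-- The first component of the Jost solution `∼ (e^{-izx}, 0)` at `-∞`. -/
noncomputable def leftOne (z : ℂ) (x : ℝ) : ℂ := jostTwo (reflS r) (reflS q) z (-x)

/-- The second component of the Jost solution `∼ (e^{-izx}, 0)` at `-∞`. -/
noncomputable def leftTwo (z : ℂ) (x : ℝ) : ℂ := jostOne (reflS r) (reflS q) z (-x)

lemma linSol_jost (hz : 0 ≤ z.im) :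
    LinSol (fun _ => -Complex.I * z) q r (jostOne q r z) (jostTwo q r z) :=
  (sol_jost q r hz).linSol

lemma linSol_left (hz : 0 ≤ z.im) :
    LinSol (fun _ => -Complex.I * z) q r (leftOne q r z) (leftTwo q r z) := by
  have := (linSol_jost (reflS r) (reflS q) hz).reflect
  simpa using! this

lemma tendsto_exp_mul_jostTwo (hz : 0 ≤ z.im) : Tendsto (fun x : ℝ =>
    Complex.exp (-(Complex.I * z * x)) * jostTwo q r z x) atTop (𝓝 1) := by
  refine (tendsto_mTwo q r hz).congr fun x => ?_
  rw [jostTwo, ← mul_assoc, ← Complex.exp_add, neg_add_cancel, Complex.exp_zero, one_mul]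

lemma tendsto_jostOne (hz : 0 ≤ z.im) : Tendsto (jostOne q r z) atTop (𝓝 0) := by
  refine squeeze_zero_norm' ?_ (tendsto_zero_iff_norm_tendsto_zero.1 (tendsto_mOne q r hz))
  filter_upwards [eventually_ge_atTop 0] with x hx
  rw [jostOne, norm_mul]
  exact mul_le_of_le_one_left (norm_nonneg _) (norm_cexp_I_mul_le_one hz hx)

/-- The reciprocal of the transmission coefficient. -/
noncomputable def aCoef (z : ℂ) : ℂ :=
  leftOne q r z 0 * jostTwo q r z 0 - jostOne q r z 0 * leftTwo q r z 0

/-- The Wronskian of the Jost solutions whose quotient by `aCoef` is minus the reflection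
coefficient. -/
noncomputable def bCoef (z : ℂ) : ℂ :=
  leftOne q r z 0 * jostOne r q (-z) 0 - jostTwo r q (-z) 0 * leftTwo q r z 0

/-- The right reflection coefficient on the real line. -/
noncomputable def reflCoef (l : ℝ) : ℂ := -bCoef q r l / aCoef q r l

lemma aCoef_eq : aCoef q r z = mTwo (reflS r) (reflS q) z 0 * mTwo q r z 0 -
    mOne q r z 0 * mOne (reflS r) (reflS q) z 0 := by
  simp [aCoef, leftOne, leftTwo, jostOne, jostTwo]

lemma bCoef_eq : bCoef q r z = mTwo (reflS r) (reflS q) z 0 * mOne r q (-z) 0 -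
    mTwo r q (-z) 0 * mOne (reflS r) (reflS q) z 0 := by
  simp [bCoef, leftOne, leftTwo, jostOne, jostTwo]

lemma continuousOn_aCoef : ContinuousOn (aCoef q r) {z | 0 ≤ z.im} := by
  have : aCoef q r = _ := funext fun z => aCoef_eq q r (z := z)
  rw [this]
  exact ((continuousOn_mTwo _ _ 0).mul (continuousOn_mTwo _ _ 0)).sub
    ((continuousOn_mOne _ _ 0).mul (continuousOn_mOne _ _ 0))

lemma differentiableOn_aCoef : DifferentiableOn ℂ (aCoef q r) {z | 0 < z.im} := by
  have : aCoef q r = _ := funext fun z => aCoef_eq q r (z := z)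
  rw [this]
  exact ((differentiableOn_mTwo _ _ 0).mul (differentiableOn_mTwo _ _ 0)).sub
    ((differentiableOn_mOne _ _ 0).mul (differentiableOn_mOne _ _ 0))

lemma analyticAt_aCoef (hz : 0 < z.im) : AnalyticAt ℂ (aCoef q r) z :=
  (differentiableOn_aCoef q r).analyticAt ((isOpen_lt continuous_const Complex.continuous_im).mem_nhds hz)

lemma tendsto_of_norm_mul_le {f : ℂ → ℂ} {C : ℝ} (h : ∀ z : ℂ, 0 ≤ z.im → ‖z‖ * ‖f z‖ ≤ C) :
    Tendsto f upperInf (𝓝 0) := by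
  have h1 : Tendsto (fun z : ℂ => C * ‖z‖⁻¹) upperInf (𝓝 0) := by
    have : Tendsto (fun z : ℂ => ‖z‖⁻¹) upperInf (𝓝 0) :=
      tendsto_inv_atTop_zero.comp (tendsto_norm_cobounded_atTop.mono_left upperInf_le)
    simpa using this.const_mul C
  refine squeeze_zero_norm' (eventually_upperInf.2 ⟨1, fun z hz hz1 => ?_⟩) h1
  have h2 : 0 < ‖z‖ := by linarith
  rw [← div_eq_mul_inv, le_div_iff₀ h2, mul_comm]
  exact h z hz

lemma tendsto_mOne_upperInf (x : ℝ) : Tendsto (fun z => mOne q r z x) upperInf (𝓝 0) := by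
  obtain ⟨C, _, hC⟩ := exists_norm_mOne_le q r x
  exact tendsto_of_norm_mul_le fun z hz => hC z hz x le_rfl

lemma tendsto_mTwo_upperInf (x : ℝ) : Tendsto (fun z => mTwo q r z x) upperInf (𝓝 1) := by
  obtain ⟨C, hC⟩ := exists_norm_mTwo_sub_one_le q r x
  simpa using! (tendsto_of_norm_mul_le hC).add_const 1

lemma tendsto_aCoef : Tendsto (aCoef q r) upperInf (𝓝 1) := by
  have : aCoef q r = _ := funext fun z => aCoef_eq q r (z := z)
  rw [this]
  simpa using! ((tendsto_mTwo_upperInf _ _ 0).mul (tendsto_mTwo_upperInf _ _ 0)).sub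
    ((tendsto_mOne_upperInf _ _ 0).mul (tendsto_mOne_upperInf _ _ 0))

lemma tendsto_ofReal_upperInf : Tendsto (fun l : ℝ => (l : ℂ)) (cocompact ℝ) upperInf := by
  rw [upperInf, tendsto_inf, tendsto_principal]
  exact ⟨tendsto_norm_atTop_iff_cobounded.1 ((tendsto_norm_cocompact_atTop (E := ℝ)).congr
    fun l => (Complex.norm_real l).symm), by simp⟩

lemma continuous_bCoef : Continuous fun l : ℝ => bCoef q r l := by
  simp only [bCoef_eq]
  have h1 : ∀ (f g : 𝓢(ℝ, ℂ)), Continuous fun l : ℝ => mOne f g l 0 := fun f g =>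
    (continuousOn_mOne f g 0).comp_continuous (by fun_prop) (by simp)
  have h2 : ∀ (f g : 𝓢(ℝ, ℂ)), Continuous fun l : ℝ => mTwo f g l 0 := fun f g =>
    (continuousOn_mTwo f g 0).comp_continuous (by fun_prop) (by simp)
  have h3 : ∀ (f g : 𝓢(ℝ, ℂ)), Continuous fun l : ℝ => mOne f g (-l) 0 := fun f g =>
    (continuousOn_mOne f g 0).comp_continuous (by fun_prop) (by simp)
  have h4 : ∀ (f g : 𝓢(ℝ, ℂ)), Continuous fun l : ℝ => mTwo f g (-l) 0 := fun f g =>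
    (continuousOn_mTwo f g 0).comp_continuous (by fun_prop) (by simp)
  exact ((h2 _ _).mul (h3 _ _)).sub ((h4 _ _).mul (h1 _ _))

/-- Each `mOne` factor has a leading term of order 1/l proportional to r(0). Since the odd
reflection of r has the value -r(0) at 0, the two leading terms cancel in b, and the second-order
bounds apply. -/
lemma exists_norm_bCoef_le : ∃ C, ∀ l : ℝ, l ^ 2 * ‖bCoef q r l‖ ≤ C := by
  obtain ⟨C₁, h₁⟩ := exists_norm_mOne_sub_le r q 0
  obtain ⟨C₂, h₂⟩ := exists_norm_mOne_sub_le (reflS r) (reflS q) 0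
  obtain ⟨M₁, hM₁, m₁⟩ := exists_norm_m_le r q 0
  obtain ⟨M₂, hM₂, m₂⟩ := exists_norm_m_le (reflS r) (reflS q) 0
  refine ⟨M₂ * C₁ + M₁ * C₂, fun l => ?_⟩
  have e₁ := h₁ (-l) (by simp)
  have e₂ := h₂ l (by simp)
  have f₁ := (m₁ (-l) (by simp) 0 le_rfl).2
  have f₂ := (m₂ l (by simp) 0 le_rfl).2
  rw [norm_neg] at e₁
  have key : -2 * Complex.I * l * bCoef q r l =
      mTwo (reflS r) (reflS q) l 0 *
        (2 * Complex.I * -l * mOne r q (-l) 0 - r 0 * mTwo r q (-l) 0) +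
      mTwo r q (-l) 0 * (2 * Complex.I * l * mOne (reflS r) (reflS q) l 0 -
        reflS r 0 * mTwo (reflS r) (reflS q) l 0) := by
    rw [bCoef_eq, reflS_apply, neg_zero]
    ring
  have h5 : ‖(l : ℂ)‖ * ‖-2 * Complex.I * l * bCoef q r l‖ ≤ M₂ * C₁ + M₁ * C₂ := by
    rw [key]
    calc _ ≤ ‖(l : ℂ)‖ * (‖mTwo (reflS r) (reflS q) l 0‖ *
        ‖2 * Complex.I * -l * mOne r q (-l) 0 - r 0 * mTwo r q (-l) 0‖ +
        ‖mTwo r q (-l) 0‖ * ‖2 * Complex.I * l * mOne (reflS r) (reflS q) l 0 -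
        reflS r 0 * mTwo (reflS r) (reflS q) l 0‖) := by
          gcongr
          refine (norm_add_le _ _).trans ?_
          rw [norm_mul, norm_mul]
      _ = ‖mTwo (reflS r) (reflS q) l 0‖ * (‖(l : ℂ)‖ *
        ‖2 * Complex.I * -l * mOne r q (-l) 0 - r 0 * mTwo r q (-l) 0‖) +
        ‖mTwo r q (-l) 0‖ * (‖(l : ℂ)‖ * ‖2 * Complex.I * l * mOne (reflS r) (reflS q) l 0 -
        reflS r 0 * mTwo (reflS r) (reflS q) l 0‖) := by ring
      _ ≤ _ := by gcongr
  rw [norm_mul, norm_mul, norm_mul, Complex.norm_I, norm_neg, Complex.norm_ofNat,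
    Complex.norm_real, Real.norm_eq_abs] at h5
  rw [← sq_abs]
  have := mul_nonneg (sq_nonneg |l|) (norm_nonneg (bCoef q r l))
  nlinarith

variable {q r}

lemma integrable_reflCoef (ha : ∀ l : ℝ, aCoef q r l ≠ 0) :
    Integrable (reflCoef q r) := by
  have hac : Continuous fun l : ℝ => aCoef q r l :=
    (continuousOn_aCoef q r).comp_continuous (by fun_prop) (by simp)
  have hc : Continuous (reflCoef q r) := (continuous_bCoef q r).neg.div hac ha
  obtain ⟨C, hC⟩ := exists_norm_bCoef_le q r
  refine hc.locallyIntegrable.integrable_of_isBigO_cocompact (g := fun l : ℝ => (1 + l ^ 2)⁻¹) ?_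
    (integrable_inv_one_add_sq.integrableAtFilter _)
  have h1 : ∀ᶠ l : ℝ in cocompact ℝ, 2⁻¹ ≤ ‖aCoef q r l‖ := by
    have h2 := ((tendsto_aCoef q r).comp tendsto_ofReal_upperInf).norm
    rw [norm_one] at h2
    exact h2.eventually_const_le (by norm_num)
  have h3 : ∀ᶠ l : ℝ in cocompact ℝ, 1 ≤ |l| := by
    have := tendsto_norm_cocompact_atTop (E := ℝ)
    exact this.eventually_ge_atTop 1
  refine Asymptotics.IsBigO.of_bound (4 * C) ?_
  filter_upwards [h1, h3] with l h4 h5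
  have h6 : 1 ≤ l ^ 2 := by
    rw [← sq_abs]
    exact one_le_pow₀ h5
  have h7 := hC l
  rw [Real.norm_of_nonneg (by positivity), ← div_eq_mul_inv, le_div_iff₀ (by positivity),
    reflCoef, norm_div, norm_neg, div_mul_eq_mul_div, div_le_iff₀ (by linarith)]
  have h8 := norm_nonneg (bCoef q r l)
  have h9 : 0 ≤ C := le_trans (by positivity) h7
  nlinarith

lemma expData_reflCoef (ha : ∀ l : ℝ, aCoef q r l ≠ 0) :
    ExpData volume (fun l : ℝ => (l : ℂ)) (reflCoef q r) where
  meas := Complex.measurable_ofReal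
  nonneg l := by simp
  integrable t := by
    refine (integrable_reflCoef ha).mul_bdd (c := 1) (by fun_prop) (Eventually.of_forall fun l => ?_)
    rw [norm_cexp_I_mul]
    simp

variable (q r)

lemma wronskian_right (l x : ℝ) : jostTwo r q (-l) x * jostTwo q r l x -
    jostOne q r l x * jostOne r q (-l) x = 1 := by
  have hl : 0 ≤ (l : ℂ).im := by simp
  have hl' : 0 ≤ (-l : ℂ).im := by simp
  have h1 := linSol_jost q r hl
  have h2 := (linSol_jost r q hl').swap
  have h3 : (-fun _ : ℝ => -Complex.I * (-l : ℂ)) = fun _ => -Complex.I * l := by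
    ext; simp
  rw [h3] at h2
  have h4 : Tendsto (fun x : ℝ => jostTwo r q (-l) x * jostTwo q r l x -
      jostOne q r l x * jostOne r q (-l) x) atTop (𝓝 1) := by
    have := ((tendsto_mTwo r q hl').mul (tendsto_mTwo q r hl)).sub
      ((tendsto_mOne q r hl).mul (tendsto_mOne r q hl'))
    simp only [mul_one, mul_zero, sub_zero] at this
    refine this.congr fun x => ?_
    have h5 : Complex.exp (Complex.I * -l * x) * Complex.exp (Complex.I * l * x) = 1 := by
      rw [← Complex.exp_add]
      simp
    simp only [jostOne, jostTwo]
    linear_combination -(mTwo r q (-l) x * mTwo q r l x - mOne q r l x * mOne r q (-l) x) * h5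
  exact tendsto_nhds_unique (tendsto_const_nhds.congr fun y => h2.wronskian_eq h1 x y) h4

lemma wronskian_left (hz : 0 ≤ z.im) (x : ℝ) :
    leftOne q r z x * jostTwo q r z x - jostOne q r z x * leftTwo q r z x = aCoef q r z :=
  (linSol_left q r hz).wronskian_eq (linSol_jost q r hz) x 0

lemma wronskian_left_bar (l x : ℝ) : leftOne q r l x * jostOne r q (-l) x -
    jostTwo r q (-l) x * leftTwo q r l x = bCoef q r l := by
  have hl : 0 ≤ (l : ℂ).im := by simp
  have hl' : 0 ≤ (-l : ℂ).im := by simp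
  have h2 := (linSol_jost r q hl').swap
  have h3 : (-fun _ : ℝ => -Complex.I * (-l : ℂ)) = fun _ => -Complex.I * l := by
    ext; simp
  rw [h3] at h2
  exact (linSol_left q r hl).wronskian_eq h2 x 0

/-- For real l the two right Jost solutions form a basis with Wronskian 1; the Wronskians of the
left solution with them are its coefficients. -/
lemma leftOne_div (l : ℝ) (ha : aCoef q r l ≠ 0) (x : ℝ) : leftOne q r l x / aCoef q r l =
    jostTwo r q (-l) x + reflCoef q r l * jostOne q r l x := by
  have h1 := wronskian_right q r l x
  have h2 := wronskian_left q r (z := l) (by simp) x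
  have h3 := wronskian_left_bar q r l x
  rw [reflCoef]
  field_simp
  rw [← h2, ← h3]
  linear_combination -leftOne q r l x * h1

lemma leftTwo_div (l : ℝ) (ha : aCoef q r l ≠ 0) (x : ℝ) : leftTwo q r l x / aCoef q r l =
    jostOne r q (-l) x + reflCoef q r l * jostTwo q r l x := by
  have h1 := wronskian_right q r l x
  have h2 := wronskian_left q r (z := l) (by simp) x
  have h3 := wronskian_left_bar q r l x
  rw [reflCoef]
  field_simp
  rw [← h2, ← h3]
  linear_combination -leftTwo q r l x * h1

end Scattering

/-! ### The Marchenko equations of an AKNS system -/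

/-- The zeros of `aCoef` and the behaviour of the Jost solutions at them: `Γ c` is the dependency
function at `c`, and `ρ c` the radius of a disk that isolates `c`. -/
structure Scat (q r : 𝓢(ℝ, ℂ)) (S : Finset ℂ) (ρ : ℂ → ℝ) (Γ : ℂ → ℂ → ℂ) : Prop where
  a_ne : ∀ l : ℝ, aCoef q r l ≠ 0
  zero_mem : ∀ z : ℂ, 0 < z.im → aCoef q r z = 0 → z ∈ S
  pos : ∀ c ∈ S, 0 < ρ c
  ball : ∀ c ∈ S, ∀ z ∈ Metric.closedBall c (ρ c), 0 < z.im
  sep : ∀ c ∈ S, ∀ c' ∈ S, c' ∈ Metric.closedBall c (ρ c) → c' = c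
  diff : ∀ c ∈ S, Differentiable ℂ (Γ c)
  ext₁ : ∀ c ∈ S, ∀ x : ℝ, ∃ h : ℂ → ℂ, AnalyticAt ℂ h c ∧ ∀ᶠ z in 𝓝[≠] c,
    (leftOne q r z x - Γ c z * jostOne q r z x) / aCoef q r z = h z
  ext₂ : ∀ c ∈ S, ∀ x : ℝ, ∃ h : ℂ → ℂ, AnalyticAt ℂ h c ∧ ∀ᶠ z in 𝓝[≠] c,
    (leftTwo q r z x - Γ c z * jostTwo q r z x) / aCoef q r z = h z

lemma exists_extension {f : ℂ → ℂ} {c : ℂ} {ρ : ℝ} {h : ℂ → ℂ} (hh : AnalyticAt ℂ h c)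
    (hfh : ∀ᶠ z in 𝓝[≠] c, f z = h z)
    (hf : ∀ z ∈ Metric.closedBall c ρ, z ≠ c → DifferentiableAt ℂ f z) :
    ∃ g : ℂ → ℂ, (∀ z ∈ Metric.closedBall c ρ, DifferentiableAt ℂ g z) ∧ ∀ z, z ≠ c → g z = f z := by
  refine ⟨Function.update f c (h c), fun z hz => ?_, fun z hz => Function.update_of_ne hz _ _⟩
  by_cases hzc : z = c
  · subst hzc
    refine hh.differentiableAt.congr_of_eventuallyEq ?_
    have := eventually_nhdsWithin_iff.1 hfh
    filter_upwards [this] with w hw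
    by_cases hwz : w = z
    · subst hwz; simp
    · rw [Function.update_of_ne hwz, hw hwz]
  · refine (hf z hz hzc).congr_of_eventuallyEq ?_
    filter_upwards [isOpen_ne.mem_nhds hzc] with w hw
    exact Function.update_of_ne hw _ _

namespace Scat

variable {q r : 𝓢(ℝ, ℂ)} {S : Finset ℂ} {ρ : ℂ → ℝ} {Γ : ℂ → ℂ → ℂ} {z : ℂ}

lemma ne_zero (h : Scat q r S ρ Γ) (hz : 0 ≤ z.im) (hzS : z ∉ S) : aCoef q r z ≠ 0 := by
  rcases hz.lt_or_eq with hz | hz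
  · exact fun h0 => hzS (h.zero_mem z hz h0)
  · have : z = (z.re : ℂ) := by
      apply Complex.ext <;> simp [← hz]
    rw [this]
    exact h.a_ne _

lemma ne_zero_of_mem_ball (h : Scat q r S ρ Γ) {c : ℂ} (hc : c ∈ S)
    (hz : z ∈ Metric.closedBall c (ρ c)) (hzc : z ≠ c) : aCoef q r z ≠ 0 :=
  h.ne_zero (h.ball c hc z hz).le fun hzS => hzc (h.sep c hc z hzS hz)

lemma ne_of_mem_sphere (h : Scat q r S ρ Γ) {c : ℂ} (hc : c ∈ S)
    (hz : z ∈ Metric.sphere c (ρ c)) : z ≠ c :=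
  Metric.ne_of_mem_sphere hz (h.pos c hc).ne'

lemma differentiableAt_aCoef (hz : 0 < z.im) : DifferentiableAt ℂ (aCoef q r) z :=
  (analyticAt_aCoef q r hz).differentiableAt

lemma isOpen_im : IsOpen {z : ℂ | 0 < z.im} := isOpen_lt continuous_const Complex.continuous_im

variable {Ω : ℝ → ℂ}

/-- The hypothesis relating a Marchenko kernel to the scattering data. -/
def IsKernelFun (q r : 𝓢(ℝ, ℂ)) (S : Finset ℂ) (ρ : ℂ → ℝ) (Γ : ℂ → ℂ → ℂ) (Ω : ℝ → ℂ) : Prop :=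
  ∀ t, 2 * Real.pi * Ω t = expT volume (fun l : ℝ => (l : ℂ)) (reflCoef q r) t -
    ∑ c ∈ S, ∮ z in C(c, ρ c), Γ c z / aCoef q r z * Complex.exp (Complex.I * z * t)

/-- Written as e^{-izx}M, a left component gives the function M/a, bounded near infinity, with
singular part governed by Γ/a. The constants δ and δb let one proof serve both components. -/
lemma marchenko_aux (h : Scat q r S ρ Γ) (hΩ : IsKernelFun q r S ρ Γ Ω) {x y : ℝ} (hxy : x < y)
    {Ck Cb : ℝ} {k kb : ℝ × ℝ → ℂ} (hk : Decay Ck k) (hkb : Decay Cb kb) (δ δb : ℂ) {M : ℂ → ℂ}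
    (hMc : ContinuousOn M {z | 0 ≤ z.im}) (hMd : DifferentiableOn ℂ M {z | 0 < z.im})
    {m : ℂ} (hMm : Tendsto M upperInf (𝓝 m))
    (hM : ∀ l : ℝ, Complex.exp (Complex.I * l * (-x : ℝ)) * M l / aCoef q r l =
      Complex.exp (Complex.I * -l * x) * (δb + lap kb (-l) x) +
      reflCoef q r l * (Complex.exp (Complex.I * l * x) * (δ + lap k l x)))
    (hext : ∀ c ∈ S, ∃ g : ℂ → ℂ, AnalyticAt ℂ g c ∧ ∀ᶠ z in 𝓝[≠] c,
      (Complex.exp (Complex.I * z * (-x : ℝ)) * M z -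
        Γ c z * (Complex.exp (Complex.I * z * x) * (δ + lap k z x))) / aCoef q r z = g z) :
    kb (x, y - x) + δ * Ω (x + y) + ∫ s in Ioi (0 : ℝ), k (x, s) * Ω (x + y + s) = 0 := by
  have hexp : ∀ z : ℂ, Complex.exp (Complex.I * z * x) * Complex.exp (Complex.I * z * (-x : ℝ)) = 1 := by
    intro z
    rw [← Complex.exp_add, Complex.ofReal_neg, mul_neg, add_neg_cancel, Complex.exp_zero]
  have hexp2 : ∀ z : ℂ, Complex.exp (Complex.I * z * x) * Complex.exp (Complex.I * z * x) =
      Complex.exp (Complex.I * z * (2 * x : ℝ)) := by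
    intro z
    rw [← Complex.exp_add]
    push_cast
    ring_nf
  have hMd' : ∀ z : ℂ, 0 < z.im → DifferentiableAt ℂ M z := fun z hz =>
    hMd.differentiableAt (isOpen_im.mem_nhds hz)
  have hgs : ∀ c ∈ S, ∃ g : ℂ → ℂ, (∀ z ∈ Metric.closedBall c (ρ c), DifferentiableAt ℂ g z) ∧
      ∀ z, z ≠ c → g z = (Complex.exp (Complex.I * z * (-x : ℝ)) * M z -
        Γ c z * (Complex.exp (Complex.I * z * x) * (δ + lap k z x))) / aCoef q r z := by
    intro c hc
    obtain ⟨g, hg, hge⟩ := hext c hc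
    refine exists_extension hg hge fun z hz hzc => ?_
    have hz0 := h.ball c hc z hz
    have hlap : DifferentiableAt ℂ (fun z => lap k z x) z :=
      (hk.differentiableOn_lap x).differentiableAt (isOpen_im.mem_nhds hz0)
    have hΓ := h.diff c hc z
    refine DifferentiableAt.div ?_ (differentiableAt_aCoef hz0) (h.ne_zero_of_mem_ball hc hz hzc)
    exact (DifferentiableAt.mul (by fun_prop) (hMd' z hz0)).sub (hΓ.mul
      (DifferentiableAt.mul (by fun_prop) (hlap.const_add δ)))
  choose! g hgd hge using hgs
  refine marchenko_of_scattering (F := fun z => M z / aCoef q r z) (R := reflCoef q r)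
    (B := fun c z => Γ c z / aCoef q r z)
    (g := fun c z => g c z * Complex.exp (Complex.I * z * x)) hk hkb δ δb
    (expData_reflCoef h.a_ne) ?_ S h.pos h.ball h.sep ?_ ?_ ?_ ?_ ?_ ?_ ?_ hΩ hxy
  · intro l
    have h1 := hM l
    have h2 := hexp l
    have h3 : Complex.exp (Complex.I * l * x) * Complex.exp (Complex.I * -l * x) = 1 := by
      rw [← Complex.exp_add]
      simp
    rw [← hexp2]
    calc M l / aCoef q r l = Complex.exp (Complex.I * l * x) *
          (Complex.exp (Complex.I * l * (-x : ℝ)) * M l / aCoef q r l) := by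
          linear_combination -(M l / aCoef q r l) * h2
      _ = _ := by
          rw [h1]
          linear_combination (δb + lap kb (-l) x) * h3
  · intro z hz hzS
    exact (hMc z hz).div (continuousOn_aCoef q r z hz) (h.ne_zero hz hzS)
  · intro z hz hzS
    exact (hMd' z hz).div (differentiableAt_aCoef hz) (h.ne_zero hz.le hzS)
  · exact (hMm.div (tendsto_aCoef q r) one_ne_zero).isBigO_one ℝ
  · intro c hc
    have hc0 : 0 < c.im := h.ball c hc c (Metric.mem_closedBall_self (h.pos c hc).le)
    exact (hMd.analyticAt (isOpen_im.mem_nhds hc0)).meromorphicAt.div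
      (analyticAt_aCoef q r hc0).meromorphicAt
  · intro c hc z hz
    have hzb := Metric.sphere_subset_closedBall hz
    exact ((h.diff c hc z).continuousAt.div
      (differentiableAt_aCoef (h.ball c hc z hzb)).continuousAt
      (h.ne_zero_of_mem_ball hc hzb (h.ne_of_mem_sphere hc hz))).continuousWithinAt
  · intro c hc z hz
    exact (hgd c hc z hz).mul (by fun_prop)
  · intro c hc z hz
    rw [hge c hc z (h.ne_of_mem_sphere hc hz), ← hexp2]
    linear_combination -(M z / aCoef q r z) * hexp z

/-- In the first component the constant 1 belongs to the barred solution, so δ = 0 and no free term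
Ω(x + y) arises. -/
theorem marchenko_one (h : Scat q r S ρ Γ) (hΩ : IsKernelFun q r S ρ Γ Ω) {x y : ℝ} (hxy : x < y) :
    kerTwo r q (x, y - x) + ∫ s in Ioi (0 : ℝ), kerOne q r (x, s) * Ω (x + y + s) = 0 := by
  obtain ⟨C, hk⟩ := isKernel_ker q r
  obtain ⟨C', hk'⟩ := isKernel_ker r q
  have := h.marchenko_aux hΩ hxy hk.decay₁ hk'.decay₂ 0 1
    (M := fun z => mTwo (reflS r) (reflS q) z (-x)) (continuousOn_mTwo _ _ _)
    (differentiableOn_mTwo _ _ _) (tendsto_mTwo_upperInf _ _ _) (fun l => ?_) (fun c hc => ?_)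
  · simpa using this
  · have := leftOne_div q r l (h.a_ne l) x
    simp only [leftOne, jostTwo, jostOne] at this
    rw [zero_add]
    exact this
  · obtain ⟨g, hg, hge⟩ := h.ext₁ c hc x
    refine ⟨g, hg, hge.mono fun z hz => ?_⟩
    rw [zero_add]
    exact hz

/-- In the second component the constant 1 belongs to the unbarred solution: δ = 1 gives the free
term. -/
theorem marchenko_two (h : Scat q r S ρ Γ) (hΩ : IsKernelFun q r S ρ Γ Ω) {x y : ℝ} (hxy : x < y) :
    kerOne r q (x, y - x) + Ω (x + y) +
      ∫ s in Ioi (0 : ℝ), kerTwo q r (x, s) * Ω (x + y + s) = 0 := by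
  obtain ⟨C, hk⟩ := isKernel_ker q r
  obtain ⟨C', hk'⟩ := isKernel_ker r q
  have := h.marchenko_aux hΩ hxy hk.decay₂ hk'.decay₁ 1 0
    (M := fun z => mOne (reflS r) (reflS q) z (-x)) (continuousOn_mOne _ _ _)
    (differentiableOn_mOne _ _ _) (tendsto_mOne_upperInf _ _ _) (fun l => ?_) (fun c hc => ?_)
  · simpa using this
  · have := leftTwo_div q r l (h.a_ne l) x
    simp only [leftTwo, jostTwo, jostOne] at this
    rw [zero_add]
    exact this
  · obtain ⟨g, hg, hge⟩ := h.ext₂ c hc x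
    exact ⟨g, hg, hge⟩

end Scat

/-! ### Bounds for Marchenko kernels and identification of Marchenko solutions -/

namespace Scat

variable {q r : 𝓢(ℝ, ℂ)} {S S' : Finset ℂ} {ρ ρ' : ℂ → ℝ} {Γ Γ' : ℂ → ℂ → ℂ} {z : ℂ}
  {Ω Ωb : ℝ → ℂ}

lemma expData_dep (h : Scat q r S ρ Γ) {c : ℂ} (hc : c ∈ S) :
    ExpData (volume.restrict (Ioc 0 (2 * Real.pi))) (circleMap c (ρ c))
      (fun θ => deriv (circleMap c (ρ c)) θ *
        (Γ c (circleMap c (ρ c) θ) / aCoef q r (circleMap c (ρ c) θ))) :=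
  expData_circle (B := fun z => Γ c z / aCoef q r z) (h.pos c hc).le (h.ball c hc) fun z hz => by
    have hzb := Metric.sphere_subset_closedBall hz
    exact ((h.diff c hc z).continuousAt.div
      (differentiableAt_aCoef (h.ball c hc z hzb)).continuousAt
      (h.ne_zero_of_mem_ball hc hzb (h.ne_of_mem_sphere hc hz))).continuousWithinAt

/-- With the residues also written as exponential transforms, continuity, half-line bounds and
derivatives all come from `ExpData`. -/
lemma kernelFun_eq (hΩ : IsKernelFun q r S ρ Γ Ω) : Ω = fun t => (2 * Real.pi : ℂ)⁻¹ *
    (expT volume (fun l : ℝ => (l : ℂ)) (reflCoef q r) t - ∑ c ∈ S,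
      expT (volume.restrict (Ioc 0 (2 * Real.pi))) (circleMap c (ρ c))
      (fun θ => deriv (circleMap c (ρ c)) θ *
        (Γ c (circleMap c (ρ c) θ) / aCoef q r (circleMap c (ρ c) θ))) t) := by
  ext t
  have h1 : ∀ c, expT (volume.restrict (Ioc 0 (2 * Real.pi))) (circleMap c (ρ c))
      (fun θ => deriv (circleMap c (ρ c)) θ *
        (Γ c (circleMap c (ρ c) θ) / aCoef q r (circleMap c (ρ c) θ))) t =
      ∮ z in C(c, ρ c), Γ c z / aCoef q r z * Complex.exp (Complex.I * z * t) := fun c =>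
    expT_circle (fun z => Γ c z / aCoef q r z) c (ρ c) t
  simp only [h1]
  rw [← hΩ t, inv_mul_cancel_left₀]
  simp [Real.pi_ne_zero]

lemma continuous_kernelFun (h : Scat q r S ρ Γ) (hΩ : IsKernelFun q r S ρ Γ Ω) : Continuous Ω := by
  rw [kernelFun_eq hΩ]
  refine continuous_const.mul ((expData_reflCoef h.a_ne).continuous_expT.sub ?_)
  exact continuous_finsetSum _ fun c hc => (h.expData_dep hc).continuous_expT

lemma exists_norm_kernelFun_le (h : Scat q r S ρ Γ) (hΩ : IsKernelFun q r S ρ Γ Ω) (t₀ : ℝ) :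
    ∃ W, ∀ t, t₀ ≤ t → ‖Ω t‖ ≤ W := by
  refine ⟨‖(2 * Real.pi : ℂ)⁻¹‖ * ((∫ l : ℝ, ‖reflCoef q r l *
      Complex.exp (Complex.I * (l : ℂ) * t₀)‖) + ∑ c ∈ S, ∫ θ in Ioc 0 (2 * Real.pi),
      ‖deriv (circleMap c (ρ c)) θ * (Γ c (circleMap c (ρ c) θ) / aCoef q r (circleMap c (ρ c) θ)) *
        Complex.exp (Complex.I * circleMap c (ρ c) θ * t₀)‖), fun t ht => ?_⟩
  rw [kernelFun_eq hΩ, norm_mul]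
  gcongr
  refine (norm_sub_le _ _).trans (add_le_add ((expData_reflCoef h.a_ne).norm_expT_le ht) ?_)
  exact (norm_sum_le _ _).trans (Finset.sum_le_sum fun c hc => (h.expData_dep hc).norm_expT_le ht)

end Scat

lemma Decay.integrableOn_shift {C : ℝ} {k : ℝ × ℝ → ℂ} (h : Decay C k) (x : ℝ) :
    IntegrableOn (fun y => k (x, y - x)) (Ioi x) := by
  have := (measurePreserving_sub_right volume x).integrableOn_comp_preimage
    (MeasurableEquiv.subRight x).measurableEmbedding (f := fun s => k (x, s)) (s := Ioi 0)
  have h2 := this.2 (h.integrableOn x)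
  simpa [Function.comp_def] using h2

lemma Decay.integral_norm_shift_le {C : ℝ} {k : ℝ × ℝ → ℂ} (h : Decay C k) {x₀ x : ℝ}
    (hx : x₀ ≤ x) : ∫ y in Ioi x, ‖k (x, y - x)‖ ≤ C * tail x₀ := by
  have h1 : ∫ y in Ioi x, ‖k (x, y - x)‖ = ∫ s in Ioi (0 : ℝ), ‖k (x, s)‖ := by
    have := (measurePreserving_sub_right volume x).setIntegral_preimage_emb
      (MeasurableEquiv.subRight x).measurableEmbedding (fun s => ‖k (x, s)‖) (Ioi 0)
    rw [← this]
    congr 1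
    simp
  rw [h1]
  refine le_trans ?_ (mul_le_mul_of_nonneg_left (antitone_tail hx) h.nonneg)
  rw [tail, ← integral_const_mul]
  refine setIntegral_mono_on (h.integrableOn x).norm ((integrableOn_majorant x).const_mul C)
    measurableSet_Ioi fun s hs => h.bound x s (le_of_lt hs)

lemma integral_shift (k : ℝ × ℝ → ℂ) (Ω : ℝ → ℂ) (x y : ℝ) :
    ∫ s in Ioi (0 : ℝ), k (x, s) * Ω (x + y + s) = ∫ z in Ioi x, k (x, z - x) * Ω (z + y) := by
  rw [← integral_Ioi_comp_add (f := fun z => k (x, z - x) * Ω (z + y)) x]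
  congr 1
  ext s
  rw [add_sub_cancel_left, add_right_comm]

/-- A solution of a row of the Marchenko system of an AKNS system is the transformation kernel. -/
theorem Scat.eq_ker_of_marchenko {q r : 𝓢(ℝ, ℂ)} {S S' : Finset ℂ} {ρ ρ' : ℂ → ℝ}
    {Γ Γ' : ℂ → ℂ → ℂ} {Ω Ωb : ℝ → ℂ} (h : Scat q r S ρ Γ) (hΩ : IsKernelFun q r S ρ Γ Ω)
    (h' : Scat r q S' ρ' Γ') (hΩb : IsKernelFun r q S' ρ' Γ' Ωb) {x : ℝ} {a b : ℝ → ℂ}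
    (ha : IntegrableOn a (Ioi x)) (hb : IntegrableOn b (Ioi x))
    (hae : ∀ y, x < y → a y + ∫ z in Ioi x, b z * Ω (z + y) = 0)
    (hbe : ∀ y, x < y → b y + Ωb (x + y) + ∫ z in Ioi x, a z * Ωb (z + y) = 0)
    {y : ℝ} (hy : x < y) : a y = kerTwo r q (x, y - x) ∧ b y = kerOne q r (x, y - x) := by
  obtain ⟨C, hk⟩ := isKernel_ker q r
  obtain ⟨C', hk'⟩ := isKernel_ker r q
  obtain ⟨W, hW⟩ := h.exists_norm_kernelFun_le hΩ (2 * x)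
  obtain ⟨W', hW'⟩ := h'.exists_norm_kernelFun_le hΩb (2 * x)
  have hΩc := h.continuous_kernelFun hΩ
  have hΩbc := h'.continuous_kernelFun hΩb
  have m1 := fun {x y : ℝ} (hxy : x < y) => h.marchenko_one hΩ hxy
  have m2 := fun {x y : ℝ} (hxy : x < y) => h.marchenko_two hΩ hxy
  have m3 := fun {x y : ℝ} (hxy : x < y) => h'.marchenko_one hΩb hxy
  have m4 := fun {x y : ℝ} (hxy : x < y) => h'.marchenko_two hΩb hxy
  simp only [integral_shift] at m1 m2 m3 m4
  have iA := hk'.decay₂.integrableOn_shift x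
  have iB := hk.decay₁.integrableOn_shift x
  have hsub : ∀ {f g ω : ℝ → ℂ} {W : ℝ}, IntegrableOn f (Ioi x) → IntegrableOn g (Ioi x) →
      Continuous ω → (∀ t, 2 * x ≤ t → ‖ω t‖ ≤ W) → ∀ y, x < y →
      ∫ z in Ioi x, ω (y + z) * (f z - g z) =
        (∫ z in Ioi x, f z * ω (z + y)) - ∫ z in Ioi x, g z * ω (z + y) := by
    intro f g ω W hf hg hω hW y hy
    have i1 := integrableOn_kernel_mul hω hW hf hy.le
    have i2 := integrableOn_kernel_mul hω hW hg hy.le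
    simp only [mul_sub]
    rw [integral_sub i1 i2]
    simp only [mul_comm (ω _), add_comm y]
  -- The homogeneous solution is the given row minus the kernels. The matrix solutions required on
  -- the smaller half-lines are the kernels of the pair and of the swapped pair; their L¹ bounds are
  -- uniform because `tail` decreases.
  have key := eq_zero_of_homogeneous_marchenko (x₀ := x) (W := max W W')
    (L := max C C' * tail x) (ω₁ := Ωb) (ω₂ := Ω)
    (u := fun y => b y - kerOne q r (x, y - x)) (v := fun y => a y - kerTwo r q (x, y - x))
    (A := fun x y => kerTwo r q (x, y - x)) (B := fun x y => kerOne q r (x, y - x))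
    (C := fun x y => kerOne r q (x, y - x)) (D := fun x y => kerTwo q r (x, y - x))
    hΩbc hΩc (fun t ht => (hW' t ht).trans (le_max_right _ _))
    (fun t ht => (hW t ht).trans (le_max_left _ _)) (hb.sub iB) (ha.sub iA) ?_ ?_
    (fun x _ => hk'.decay₂.integrableOn_shift x) (fun x _ => hk.decay₁.integrableOn_shift x)
    (fun x _ => hk'.decay₁.integrableOn_shift x) (fun x _ => hk.decay₂.integrableOn_shift x)
    (fun x y _ hxy => m1 hxy) (fun x y _ hxy => m4 hxy) (fun x y _ hxy => m2 hxy)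
    (fun x y _ hxy => m3 hxy) ?_ ?_ ?_ ?_ hy
  · exact ⟨sub_eq_zero.1 key.2, sub_eq_zero.1 key.1⟩
  · intro y hy
    rw [hsub ha iA hΩbc hW' y hy]
    linear_combination hbe y hy - m4 hy
  · intro y hy
    rw [hsub hb iB hΩc hW y hy]
    linear_combination hae y hy - m1 hy
  all_goals
    intro x' hx'
    have ht := tail_nonneg x
    first
      | exact (hk'.decay₂.integral_norm_shift_le hx'.le).trans (by gcongr; exact le_max_right _ _)
      | exact (hk'.decay₁.integral_norm_shift_le hx'.le).trans (by gcongr; exact le_max_right _ _)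
      | exact (hk.decay₁.integral_norm_shift_le hx'.le).trans (by gcongr; exact le_max_left _ _)
      | exact (hk.decay₂.integral_norm_shift_le hx'.le).trans (by gcongr; exact le_max_left _ _)

/-! ### The gauge transformation between two AKNS systems -/

section Gauge

variable (c : ℂ) (q r : 𝓢(ℝ, ℂ)) {z ζ : ℂ}

/-- The potential `c q' + c² q² r`. -/
noncomputable def gaugePot : 𝓢(ℝ, ℂ) := c • derivS q + c ^ 2 • mulS (mulS q q) r

lemma gaugePot_apply (x : ℝ) :
    gaugePot c q r x = c * derivS q x + c ^ 2 * (q x * q x * r x) := rfl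

lemma reflS_gaugePot : reflS (gaugePot c q r) = gaugePot (-c) (reflS q) (reflS r) := by
  ext x
  simp only [reflS_apply, gaugePot_apply, derivS_reflS]
  ring

lemma tendsto_schwartz (f : 𝓢(ℝ, ℂ)) : Tendsto f atTop (𝓝 0) := by
  have h : Tendsto (fun x : ℝ => f x) (cocompact ℝ) (𝓝 0) :=
    ZeroAtInftyContinuousMapClass.zero_at_infty f
  exact h.mono_left atTop_le_cocompact

/-- The substitution differentiates r and q once each: the term with r' is cancelled by the
potential on the old side, and the term with q' is supplied by the potential on the new side. This
dictates the form of `gaugePot`. -/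
lemma sol_gauge (hz : 0 ≤ z.im) :
    LinSol (fun _ => -Complex.I * z) (gaugePot c q r) r
      (fun x => -2 * Complex.I * c * z * jostOne q (gaugePot (-c) r q) z x +
        c * q x * (jostTwo q (gaugePot (-c) r q) z x + c * r x * jostOne q (gaugePot (-c) r q) z x))
      (fun x => jostTwo q (gaugePot (-c) r q) z x + c * r x * jostOne q (gaugePot (-c) r q) z x) := by
  have h := linSol_jost q (gaugePot (-c) r q) hz
  have hv : ∀ x, HasDerivAt (fun x => jostTwo q (gaugePot (-c) r q) z x +
      c * r x * jostOne q (gaugePot (-c) r q) z x) _ x := fun x =>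
    (h.deriv₂ x).add (((hasDerivAt_schwartz r x).const_mul c).mul (h.deriv₁ x))
  constructor
  · intro x
    refine (((h.deriv₁ x).const_mul (-2 * Complex.I * c * z)).add
      (((hasDerivAt_schwartz q x).const_mul c).mul (hv x))).congr_deriv ?_
    simp only [gaugePot_apply]
    ring
  · intro x
    refine (hv x).congr_deriv ?_
    simp only [gaugePot_apply]
    ring

/-- The correction terms of the substitution vanish at +∞ together with q and r, so the substituted
solution keeps the Jost normalization, and uniqueness applies. -/
lemma jost_gauge (hz : 0 ≤ z.im) (x : ℝ) :
    jostOne (gaugePot c q r) r z x = -2 * Complex.I * c * z * jostOne q (gaugePot (-c) r q) z x +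
        c * q x * jostTwo (gaugePot c q r) r z x ∧
    jostTwo (gaugePot c q r) r z x = jostTwo q (gaugePot (-c) r q) z x +
        c * r x * jostOne q (gaugePot (-c) r q) z x := by
  set ρ := gaugePot (-c) r q with hρ
  set σ := gaugePot c q r with hσ
  obtain ⟨G, hG1, hG2⟩ := exists_pot₂ σ r
  have hv : Tendsto (fun x : ℝ => Complex.exp (-(Complex.I * z * x)) *
      (jostTwo q ρ z x + c * r x * jostOne q ρ z x)) atTop (𝓝 1) := by
    have h1 := (tendsto_mTwo q ρ hz).add
      (((tendsto_schwartz r).const_mul c).mul (tendsto_mOne q ρ hz))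
    simp only [mul_zero, add_zero] at h1
    refine h1.congr fun x => ?_
    have h2 : Complex.exp (-(Complex.I * z * x)) * Complex.exp (Complex.I * z * x) = 1 := by
      rw [← Complex.exp_add, neg_add_cancel, Complex.exp_zero]
    simp only [jostOne, jostTwo]
    linear_combination -(mTwo q ρ z x + c * r x * mOne q ρ z x) * h2
  have hqv : Tendsto (fun x : ℝ => q x * (jostTwo q ρ z x + c * r x * jostOne q ρ z x))
      atTop (𝓝 0) := by
    have h1 := (tendsto_schwartz q).mul hv
    rw [zero_mul] at h1
    refine squeeze_zero_norm' ?_ (tendsto_zero_iff_norm_tendsto_zero.1 h1)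
    filter_upwards [eventually_ge_atTop 0] with x hx
    rw [norm_mul, norm_mul, norm_mul]
    gcongr
    refine le_mul_of_one_le_left (norm_nonneg _) ?_
    rw [Complex.exp_neg, norm_inv]
    exact one_le_inv_iff₀.2 ⟨norm_pos_iff.2 (Complex.exp_ne_zero _), norm_cexp_I_mul_le_one hz hx⟩
  have hu : Tendsto (fun x : ℝ => -2 * Complex.I * c * z * jostOne q ρ z x +
        c * q x * (jostTwo q ρ z x + c * r x * jostOne q ρ z x)) atTop (𝓝 0) := by
    have := ((tendsto_jostOne q ρ hz).const_mul (-2 * Complex.I * c * z)).add (hqv.const_mul c)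
    simp only [mul_zero, add_zero] at this
    refine this.congr fun x => ?_
    ring
  have hM := (norm_nonneg (-Complex.I * z))
  have := (linSol_jost σ r hz).unique (M := ‖-Complex.I * z‖ + G)
    (fun _ => by linarith [hG1.nonneg]) (fun x => by linarith [hG1.norm_le x])
    (fun x => by linarith [hG2.norm_le x]) hz (sol_gauge c q r hz)
    (tendsto_jostOne σ r hz) (tendsto_exp_mul_jostTwo σ r hz) hu hv
  have h1 := congrFun this.1 x
  have h2 := congrFun this.2 x
  exact ⟨by rw [h2]; exact h1, h2⟩

lemma left_gauge (hz : 0 ≤ z.im) (x : ℝ) :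
    leftTwo q (gaugePot (-c) r q) z x = -2 * Complex.I * c * z * leftTwo (gaugePot c q r) r z x -
        c * r x * leftOne q (gaugePot (-c) r q) z x ∧
    leftOne q (gaugePot (-c) r q) z x = leftOne (gaugePot c q r) r z x -
        c * q x * leftTwo (gaugePot c q r) r z x := by
  have h := jost_gauge c (reflS r) (reflS q) hz (-x)
  simp only [reflS_apply, neg_neg] at h
  simp only [leftOne, leftTwo, reflS_gaugePot, neg_neg]
  exact ⟨by linear_combination h.1, by linear_combination h.2⟩

lemma aCoef_gauge (hz : 0 ≤ z.im) :
    aCoef q (gaugePot (-c) r q) z = aCoef (gaugePot c q r) r z := by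
  obtain ⟨h1, h2⟩ := jost_gauge c q r hz 0
  obtain ⟨h3, h4⟩ := left_gauge c q r hz 0
  simp only [aCoef]
  rw [h3, h1, show leftOne (gaugePot c q r) r z 0 = leftOne q (gaugePot (-c) r q) z 0 +
    c * q 0 * leftTwo (gaugePot c q r) r z 0 by linear_combination -h4]
  linear_combination -leftOne q (gaugePot (-c) r q) z 0 * h2

/-- Unlike a, the coefficient b acquires a factor l; in the Marchenko kernel this factor becomes a
derivative. -/
lemma bCoef_gauge (l : ℝ) :
    bCoef q (gaugePot (-c) r q) l = -2 * Complex.I * c * l * bCoef (gaugePot c q r) r l := by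
  obtain ⟨h1, h2⟩ := jost_gauge (-c) r q (z := -l) (by simp) 0
  obtain ⟨h3, h4⟩ := left_gauge c q r (z := l) (by simp) 0
  rw [neg_neg] at h1 h2
  simp only [bCoef]
  rw [h1, h2, h3, show leftOne (gaugePot c q r) r l 0 = leftOne q (gaugePot (-c) r q) l 0 +
    c * q 0 * leftTwo (gaugePot c q r) r l 0 by linear_combination -h4]
  ring

lemma reflCoef_gauge (l : ℝ) : reflCoef q (gaugePot (-c) r q) l =
    -2 * Complex.I * c * l * reflCoef (gaugePot c q r) r l := by
  rw [reflCoef, reflCoef, aCoef_gauge c q r (by simp), bCoef_gauge]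
  ring

/-! ### The gauged system -/

/-- The first component of the solution `∼ (0, e^{izx})` at `+∞` of the gauged system. -/
noncomputable def gaugeRight (ζ z : ℂ) (x : ℝ) : ℂ × ℂ :=
  (ζ * jostOne q (gaugePot (-c) r q) z x, jostTwo (gaugePot c q r) r z x)

/-- The solution `∼ (e^{-izx}, 0)` at `-∞` of the gauged system. -/
noncomputable def gaugeLeft (ζ z : ℂ) (x : ℝ) : ℂ × ℂ :=
  (leftOne q (gaugePot (-c) r q) z x, ζ * leftTwo (gaugePot c q r) r z x)

/-- Each AKNS equation contains one component of the other system's solution; eliminating it by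
`jost_gauge` creates the diagonal terms with cqr. The choice c = i/2 gives z = ζ², and c = -i/2
gives z = -ζ². -/
lemma linSol_gaugeRight (hz : 0 ≤ z.im) (hζ : ζ ^ 2 = -2 * Complex.I * c * z) :
    LinSol (fun x => -Complex.I * z - c * (q x * r x)) (fun x => ζ * q x) (fun x => ζ * r x)
      (fun x => (gaugeRight c q r ζ z x).1) (fun x => (gaugeRight c q r ζ z x).2) where
  deriv₁ x := by
    refine (((linSol_jost q (gaugePot (-c) r q) hz).deriv₁ x).const_mul ζ).congr_deriv ?_
    obtain ⟨h1, h2⟩ := jost_gauge c q r hz x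
    simp only [gaugeRight]
    rw [h2]
    ring
  deriv₂ x := by
    refine ((linSol_jost (gaugePot c q r) r hz).deriv₂ x).congr_deriv ?_
    obtain ⟨h1, h2⟩ := jost_gauge c q r hz x
    simp only [gaugeRight]
    rw [h1]
    linear_combination -(r x * jostOne q (gaugePot (-c) r q) z x) * hζ

lemma linSol_gaugeLeft (hz : 0 ≤ z.im) (hζ : ζ ^ 2 = -2 * Complex.I * c * z) :
    LinSol (fun x => -Complex.I * z - c * (q x * r x)) (fun x => ζ * q x) (fun x => ζ * r x)
      (fun x => (gaugeLeft c q r ζ z x).1) (fun x => (gaugeLeft c q r ζ z x).2) where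
  deriv₁ x := by
    refine ((linSol_left q (gaugePot (-c) r q) hz).deriv₁ x).congr_deriv ?_
    obtain ⟨h1, h2⟩ := left_gauge c q r hz x
    simp only [gaugeLeft]
    rw [h1]
    linear_combination -(q x * leftTwo (gaugePot c q r) r z x) * hζ
  deriv₂ x := by
    refine (((linSol_left (gaugePot c q r) r hz).deriv₂ x).const_mul ζ).congr_deriv ?_
    obtain ⟨h1, h2⟩ := left_gauge c q r hz x
    simp only [gaugeLeft]
    rw [h2]
    ring

lemma tendsto_gaugeRight (hz : 0 ≤ z.im) :
    Tendsto (fun x => (gaugeRight c q r ζ z x).1) atTop (𝓝 0) ∧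
    Tendsto (fun x : ℝ => Complex.exp (-(Complex.I * z * x)) * (gaugeRight c q r ζ z x).2)
      atTop (𝓝 1) := by
  refine ⟨?_, tendsto_exp_mul_jostTwo _ _ hz⟩
  simpa using! (tendsto_jostOne q (gaugePot (-c) r q) hz).const_mul ζ

lemma tendsto_gaugeLeft (hz : 0 ≤ z.im) :
    Tendsto (fun x => (gaugeLeft c q r ζ z (-x)).2) atTop (𝓝 0) ∧
    Tendsto (fun x : ℝ => Complex.exp (-(Complex.I * z * x)) * (gaugeLeft c q r ζ z (-x)).1)
      atTop (𝓝 1) := by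
  have h1 := (tendsto_jostOne (reflS r) (reflS (gaugePot c q r)) hz).const_mul ζ
  have h2 := tendsto_exp_mul_jostTwo (reflS (gaugePot (-c) r q)) (reflS q) hz
  rw [mul_zero] at h1
  refine ⟨h1.congr fun x => ?_, h2.congr fun x => ?_⟩ <;> simp [gaugeLeft, leftOne, leftTwo]

lemma exists_coeff_bound (z ζ : ℂ) : ∃ M, (∀ x, ‖-Complex.I * z - c * (q x * r x)‖ ≤ M) ∧
    (∀ x, ‖ζ * q x‖ ≤ M) ∧ ∀ x, ‖ζ * r x‖ ≤ M := by
  obtain ⟨G, hG1, hG2⟩ := exists_pot₂ q r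
  have hG := hG1.nonneg
  refine ⟨‖-Complex.I * z‖ + ‖c‖ * (G * G) + ‖ζ‖ * G, fun x => ?_, fun x => ?_, fun x => ?_⟩
  · refine (norm_sub_le _ _).trans ?_
    rw [norm_mul c, norm_mul (q x)]
    have : ‖c‖ * (‖q x‖ * ‖r x‖) ≤ ‖c‖ * (G * G) := by
      gcongr
      exacts [hG1.norm_le x, hG2.norm_le x]
    have : 0 ≤ ‖ζ‖ * G := by positivity
    linarith
  · rw [norm_mul]
    have : ‖ζ‖ * ‖q x‖ ≤ ‖ζ‖ * G := by
      gcongr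
      exact hG1.norm_le x
    have : 0 ≤ ‖c‖ * (G * G) := by positivity
    linarith [norm_nonneg (-Complex.I * z)]
  · rw [norm_mul]
    have : ‖ζ‖ * ‖r x‖ ≤ ‖ζ‖ * G := by
      gcongr
      exact hG2.norm_le x
    have : 0 ≤ ‖c‖ * (G * G) := by positivity
    linarith [norm_nonneg (-Complex.I * z)]

lemma eq_gaugeRight (hz : 0 ≤ z.im) (hζ : ζ ^ 2 = -2 * Complex.I * c * z) {u v : ℝ → ℂ}
    (h : LinSol (fun x => -Complex.I * z - c * (q x * r x)) (fun x => ζ * q x) (fun x => ζ * r x) u v)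
    (hu : Tendsto u atTop (𝓝 0))
    (hv : Tendsto (fun x : ℝ => Complex.exp (-(Complex.I * z * x)) * v x) atTop (𝓝 1)) (x : ℝ) :
    u x = ζ * jostOne q (gaugePot (-c) r q) z x ∧ v x = jostTwo (gaugePot c q r) r z x := by
  obtain ⟨M, h1, h2, h3⟩ := exists_coeff_bound c q r z ζ
  obtain ⟨h4, h5⟩ := tendsto_gaugeRight c q r (ζ := ζ) hz
  have := h.unique h1 h2 h3 hz (linSol_gaugeRight c q r hz hζ) hu hv h4 h5
  exact ⟨congrFun this.1 x, congrFun this.2 x⟩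

lemma eq_gaugeLeft (hz : 0 ≤ z.im) (hζ : ζ ^ 2 = -2 * Complex.I * c * z) {u v : ℝ → ℂ}
    (h : LinSol (fun x => -Complex.I * z - c * (q x * r x)) (fun x => ζ * q x) (fun x => ζ * r x) u v)
    (hu : Tendsto (fun x : ℝ => Complex.exp (Complex.I * z * x) * u x) atBot (𝓝 1))
    (hv : Tendsto v atBot (𝓝 0)) (x : ℝ) :
    u x = leftOne q (gaugePot (-c) r q) z x ∧ v x = ζ * leftTwo (gaugePot c q r) r z x := by
  obtain ⟨M, h1, h2, h3⟩ := exists_coeff_bound c q r z ζ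
  obtain ⟨h4, h5⟩ := tendsto_gaugeLeft c q r (ζ := ζ) hz
  have hu' : Tendsto (fun x : ℝ => Complex.exp (-(Complex.I * z * x)) * u (-x)) atTop (𝓝 1) := by
    refine (hu.comp tendsto_neg_atTop_atBot).congr fun x => ?_
    simp [Function.comp]
  have := h.reflect.unique (fun x => h1 (-x)) (fun x => by simpa using h3 (-x))
    (fun x => by simpa using h2 (-x)) hz (linSol_gaugeLeft c q r hz hζ).reflect
    (hv.comp tendsto_neg_atTop_atBot) hu' h4 h5
  have e1 := congrFun this.2 (-x)
  have e2 := congrFun this.1 (-x)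
  simp only [neg_neg] at e1 e2
  exact ⟨e1, e2⟩

end Gauge

/-! ### The Jost solutions of the full linear system -/

section GI

variable (q r : 𝓢(ℝ, ℂ)) {ζ : ℂ}

/-- The potential paired with `q`. -/
noncomputable def potLow : 𝓢(ℝ, ℂ) := gaugePot (-(Complex.I / 2)) r q

/-- The potential paired with `r`. -/
noncomputable def potUp : 𝓢(ℝ, ℂ) := gaugePot (Complex.I / 2) q r

lemma isSolution_iff (f : ℝ → Fin 2 → ℂ) : GI.IsSolution q r ζ f ↔
    LinSol (fun x => -Complex.I * ζ ^ 2 - Complex.I / 2 * (q x * r x)) (fun x => ζ * q x)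
      (fun x => ζ * r x) (fun x => f x 0) (fun x => f x 1) := by
  unfold GI.IsSolution GI.coeffMatrix
  constructor
  · intro h
    constructor <;> intro x
    · refine ((hasDerivAt_pi.1 (h x)) 0).congr_deriv ?_
      simp [Matrix.mulVec, dotProduct, Fin.sum_univ_two, -mul_eq_mul_right_iff]
      ring
    · refine ((hasDerivAt_pi.1 (h x)) 1).congr_deriv ?_
      simp [Matrix.mulVec, dotProduct, Fin.sum_univ_two, -mul_eq_mul_right_iff]
      ring
  · intro h x
    refine hasDerivAt_pi.2 fun i => ?_
    fin_cases i
    · refine (h.deriv₁ x).congr_deriv ?_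
      simp [Matrix.mulVec, dotProduct, Fin.sum_univ_two, -mul_eq_mul_right_iff]
      ring
    · refine (h.deriv₂ x).congr_deriv ?_
      simp [Matrix.mulVec, dotProduct, Fin.sum_univ_two, -mul_eq_mul_right_iff]
      ring

/-- After the exchange of components the system has the gauged form again, with q and r exchanged,
-ζ² for ζ² and -i/2 for i/2. The barred solutions are treated through this form. -/
lemma isSolution_iff_swap (f : ℝ → Fin 2 → ℂ) : GI.IsSolution q r ζ f ↔
    LinSol (fun x => -Complex.I * -ζ ^ 2 - -(Complex.I / 2) * (r x * q x)) (fun x => ζ * r x)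
      (fun x => ζ * q x) (fun x => f x 1) (fun x => f x 0) := by
  rw [isSolution_iff]
  constructor
  · intro h
    convert h.swap using 1
    ext x
    simp
    ring
  · intro h
    convert h.swap using 1
    ext x
    simp
    ring

/-- The gauged AKNS solution shows that `Classical.epsilon` has something to choose, and uniqueness
identifies the choice. -/
lemma psi_spec (hζ : 0 ≤ (ζ ^ 2).im) : GI.IsJostPsi q r ζ (GI.psi q r ζ) ∧
    ∀ x, GI.psi q r ζ x 0 = ζ * jostOne q (potLow q r) (ζ ^ 2) x ∧
      GI.psi q r ζ x 1 = jostTwo (potUp q r) r (ζ ^ 2) x := by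
  have hc : ζ ^ 2 = -2 * Complex.I * (Complex.I / 2) * ζ ^ 2 := by
    linear_combination ζ ^ 2 * Complex.I_sq
  have hex : ∃ f, GI.IsJostPsi q r ζ f := by
    refine ⟨fun x => ![_, _], (isSolution_iff q r _).2 (linSol_gaugeRight _ q r hζ hc), ?_⟩
    obtain ⟨h1, h2⟩ := tendsto_gaugeRight (Complex.I / 2) q r (ζ := ζ) hζ
    exact ⟨h1, h2.congr fun x => by simp⟩
  have h := Classical.epsilon_spec hex
  refine ⟨h, fun x => ?_⟩
  obtain ⟨h1, h2, h3⟩ := h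
  exact eq_gaugeRight _ q r hζ hc ((isSolution_iff q r _).1 h1) h2 (h3.congr fun x => by simp) x

lemma phi_spec (hζ : 0 ≤ (ζ ^ 2).im) :
    ∀ x, GI.phi q r ζ x 0 = leftOne q (potLow q r) (ζ ^ 2) x ∧
      GI.phi q r ζ x 1 = ζ * leftTwo (potUp q r) r (ζ ^ 2) x := by
  have hc : ζ ^ 2 = -2 * Complex.I * (Complex.I / 2) * ζ ^ 2 := by
    linear_combination ζ ^ 2 * Complex.I_sq
  have hex : ∃ f, GI.IsJostPhi q r ζ f := by
    refine ⟨fun x => ![_, _], (isSolution_iff q r _).2 (linSol_gaugeLeft _ q r hζ hc), ?_⟩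
    obtain ⟨h1, h2⟩ := tendsto_gaugeLeft (Complex.I / 2) q r (ζ := ζ) hζ
    exact ⟨(h2.comp tendsto_neg_atBot_atTop).congr fun x => by simp [Function.comp],
      (h1.comp tendsto_neg_atBot_atTop).congr fun x => by simp [Function.comp]⟩
  obtain ⟨h1, h2, h3⟩ := Classical.epsilon_spec hex
  exact fun x => eq_gaugeLeft _ q r hζ hc ((isSolution_iff q r _).1 h1) h2 h3 x

lemma psiBar_spec (hζ : (ζ ^ 2).im ≤ 0) : GI.IsJostPsiBar q r ζ (GI.psiBar q r ζ) ∧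
    ∀ x, GI.psiBar q r ζ x 1 = ζ * jostOne r (potUp q r) (-ζ ^ 2) x ∧
      GI.psiBar q r ζ x 0 = jostTwo (potLow q r) q (-ζ ^ 2) x := by
  have hc : ζ ^ 2 = -2 * Complex.I * (-(Complex.I / 2)) * -ζ ^ 2 := by
    linear_combination ζ ^ 2 * Complex.I_sq
  have hz : 0 ≤ (-ζ ^ 2).im := by simpa using hζ
  have hex : ∃ f, GI.IsJostPsiBar q r ζ f := by
    refine ⟨fun x => ![_, _], (isSolution_iff_swap q r _).2 (linSol_gaugeRight _ r q hz hc), ?_⟩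
    obtain ⟨h1, h2⟩ := tendsto_gaugeRight (-(Complex.I / 2)) r q (ζ := ζ) hz
    exact ⟨h2.congr fun x => by simp, h1⟩
  have h := Classical.epsilon_spec hex
  refine ⟨h, fun x => ?_⟩
  obtain ⟨h1, h2, h3⟩ := h
  have := eq_gaugeRight _ r q hz hc ((isSolution_iff_swap q r _).1 h1) h3
    (h2.congr fun x => by simp) x
  rwa [neg_neg] at this

lemma phiBar_spec (hζ : (ζ ^ 2).im ≤ 0) :
    ∀ x, GI.phiBar q r ζ x 1 = leftOne r (potUp q r) (-ζ ^ 2) x ∧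
      GI.phiBar q r ζ x 0 = ζ * leftTwo (potLow q r) q (-ζ ^ 2) x := by
  have hc : ζ ^ 2 = -2 * Complex.I * (-(Complex.I / 2)) * -ζ ^ 2 := by
    linear_combination ζ ^ 2 * Complex.I_sq
  have hz : 0 ≤ (-ζ ^ 2).im := by simpa using hζ
  have hex : ∃ f, GI.IsJostPhiBar q r ζ f := by
    refine ⟨fun x => ![_, _], (isSolution_iff_swap q r _).2 (linSol_gaugeLeft _ r q hz hc), ?_⟩
    obtain ⟨h1, h2⟩ := tendsto_gaugeLeft (-(Complex.I / 2)) r q (ζ := ζ) hz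
    exact ⟨(h1.comp tendsto_neg_atBot_atTop).congr fun x => by simp [Function.comp],
      (h2.comp tendsto_neg_atBot_atTop).congr fun x => by simp [Function.comp]⟩
  obtain ⟨h1, h2, h3⟩ := Classical.epsilon_spec hex
  intro x
  have := eq_gaugeLeft _ r q hz hc ((isSolution_iff_swap q r _).1 h1)
    (h3.congr fun x => by simp) h2 x
  rwa [neg_neg] at this

lemma zeta_sq (l : ℂ) : GI.zeta l ^ 2 = l := by
  rw [GI.zeta, one_div]
  exact Complex.cpow_ofNat_inv_pow l 2

lemma zeta_ne_zero {l : ℂ} (hl : l ≠ 0) : GI.zeta l ≠ 0 := fun h => hl (by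
  rw [← zeta_sq l, h, zero_pow two_ne_zero])

lemma jost_low (hz : 0 ≤ ζ.im) (x : ℝ) :
    jostOne (potUp q r) r ζ x = ζ * jostOne q (potLow q r) ζ x +
        Complex.I / 2 * q x * jostTwo (potUp q r) r ζ x ∧
    jostTwo (potUp q r) r ζ x = jostTwo q (potLow q r) ζ x +
        Complex.I / 2 * r x * jostOne q (potLow q r) ζ x := by
  obtain ⟨h1, h2⟩ := jost_gauge (Complex.I / 2) q r hz x
  refine ⟨h1.trans ?_, h2⟩
  rw [potLow, potUp]
  linear_combination -(ζ * jostOne q (gaugePot (-(Complex.I / 2)) r q) ζ x) * Complex.I_sq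

lemma left_low (hz : 0 ≤ ζ.im) (x : ℝ) :
    leftTwo q (potLow q r) ζ x = ζ * leftTwo (potUp q r) r ζ x -
        Complex.I / 2 * r x * leftOne q (potLow q r) ζ x ∧
    leftOne q (potLow q r) ζ x = leftOne (potUp q r) r ζ x -
        Complex.I / 2 * q x * leftTwo (potUp q r) r ζ x := by
  obtain ⟨h1, h2⟩ := left_gauge (Complex.I / 2) q r hz x
  refine ⟨h1.trans ?_, h2⟩
  rw [potLow, potUp]
  linear_combination -(ζ * leftTwo (gaugePot (Complex.I / 2) q r) r ζ x) * Complex.I_sq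

lemma jost_up (hz : 0 ≤ ζ.im) (x : ℝ) :
    jostOne (potLow q r) q ζ x = -ζ * jostOne r (potUp q r) ζ x -
        Complex.I / 2 * r x * jostTwo (potLow q r) q ζ x ∧
    jostTwo (potLow q r) q ζ x = jostTwo r (potUp q r) ζ x -
        Complex.I / 2 * q x * jostOne r (potUp q r) ζ x := by
  obtain ⟨h1, h2⟩ := jost_gauge (-(Complex.I / 2)) r q hz x
  rw [neg_neg] at h1 h2
  rw [potLow, potUp]
  constructor
  · linear_combination h1 + ζ * jostOne r (gaugePot (Complex.I / 2) q r) ζ x * Complex.I_sq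
  · linear_combination h2

lemma left_up (hz : 0 ≤ ζ.im) (x : ℝ) :
    leftTwo r (potUp q r) ζ x = -ζ * leftTwo (potLow q r) q ζ x +
        Complex.I / 2 * q x * leftOne r (potUp q r) ζ x ∧
    leftOne r (potUp q r) ζ x = leftOne (potLow q r) q ζ x +
        Complex.I / 2 * r x * leftTwo (potLow q r) q ζ x := by
  obtain ⟨h1, h2⟩ := left_gauge (-(Complex.I / 2)) r q hz x
  rw [neg_neg] at h1 h2
  rw [potLow, potUp]
  constructor
  · linear_combination h1 + ζ * leftTwo (gaugePot (-(Complex.I / 2)) r q) q ζ x * Complex.I_sq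
  · linear_combination h2

/-- The components of φ and ψ come from two different AKNS systems; the gauge relations at x = 0
turn the mixed expression into the Wronskian of a single one. -/
lemma wronskian_phi_psi {l : ℂ} (hl : 0 ≤ l.im) :
    GI.wronskian (GI.phi q r (GI.zeta l)) (GI.psi q r (GI.zeta l)) = aCoef (potUp q r) r l := by
  have hz : 0 ≤ (GI.zeta l ^ 2).im := by rwa [zeta_sq]
  obtain ⟨h1, h2⟩ := (psi_spec q r hz).2 0
  obtain ⟨h3, h4⟩ := phi_spec q r hz 0
  obtain ⟨h5, h6⟩ := jost_low q r hl 0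
  obtain ⟨h7, h8⟩ := left_low q r hl 0
  rw [GI.wronskian, h1, h2, h3, h4, zeta_sq, aCoef, h5, h8]
  linear_combination -(jostOne q (potLow q r) l 0 * leftTwo (potUp q r) r l 0) * zeta_sq l

lemma wronskian_psiBar_phiBar {l : ℂ} (hl : l.im ≤ 0) :
    GI.wronskian (GI.psiBar q r (GI.zeta l)) (GI.phiBar q r (GI.zeta l)) =
      aCoef (potLow q r) q (-l) := by
  have hz : (GI.zeta l ^ 2).im ≤ 0 := by rwa [zeta_sq]
  have hl' : 0 ≤ (-l).im := by simpa using hl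
  obtain ⟨h1, h2⟩ := (psiBar_spec q r hz).2 0
  obtain ⟨h3, h4⟩ := phiBar_spec q r hz 0
  obtain ⟨h5, h6⟩ := jost_up q r hl' 0
  obtain ⟨h7, h8⟩ := left_up q r hl' 0
  rw [GI.wronskian, h1, h2, h3, h4, zeta_sq, aCoef, h5, h8]
  linear_combination -(jostOne r (potUp q r) (-l) 0 * leftTwo (potLow q r) q (-l) 0) * zeta_sq l

/-- One factor ζ comes out of the Wronskian of φ and ψ̄, which explains the division by ζ. At l = 0
that division has the default value 0, so this null set is excluded. -/
lemma R_div_zeta {l : ℝ} (hl : l ≠ 0) :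
    GI.R q r (GI.zeta l) / GI.zeta l = reflCoef (potUp q r) r l := by
  have hz : 0 ≤ (GI.zeta l ^ 2).im := by simp [zeta_sq]
  have hz' : (GI.zeta l ^ 2).im ≤ 0 := by simp [zeta_sq]
  have h0 : GI.zeta l ≠ 0 := zeta_ne_zero (by exact_mod_cast hl)
  obtain ⟨h1, h2⟩ := (psiBar_spec q r hz').2 0
  obtain ⟨h3, h4⟩ := phi_spec q r hz 0
  obtain ⟨h5, h6⟩ := jost_up q r (ζ := -l) (by simp) 0
  obtain ⟨h7, h8⟩ := left_low q r (ζ := l) (by simp) 0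
  have hw := wronskian_phi_psi q r (l := l) (by simp)
  have e1 : GI.wronskian (GI.psi q r (GI.zeta l)) (GI.phi q r (GI.zeta l)) =
      -aCoef (potUp q r) r l := by
    rw [← hw, GI.wronskian, GI.wronskian]
    ring
  have e2 : GI.wronskian (GI.phi q r (GI.zeta l)) (GI.psiBar q r (GI.zeta l)) =
      GI.zeta l * bCoef (potUp q r) r l := by
    rw [GI.wronskian, h1, h2, h3, h4, zeta_sq, bCoef, h8, h6]
    ring
  rw [GI.R, e1, e2, reflCoef]
  field_simp

lemma RBar_div_zeta {l : ℝ} (hl : l ≠ 0) :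
    GI.RBar q r (GI.zeta l) / GI.zeta l = reflCoef (potLow q r) q (-l) := by
  have hz : 0 ≤ (GI.zeta l ^ 2).im := by simp [zeta_sq]
  have hz' : (GI.zeta l ^ 2).im ≤ 0 := by simp [zeta_sq]
  have h0 : GI.zeta l ≠ 0 := zeta_ne_zero (by exact_mod_cast hl)
  obtain ⟨h1, h2⟩ := (psi_spec q r hz).2 0
  obtain ⟨h3, h4⟩ := phiBar_spec q r hz' 0
  obtain ⟨h5, h6⟩ := jost_low q r (ζ := l) (by simp) 0
  obtain ⟨h7, h8⟩ := left_up q r (ζ := -l) (by simp) 0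
  have hw := wronskian_psiBar_phiBar q r (l := l) (by simp)
  have e2 : GI.wronskian (GI.phiBar q r (GI.zeta l)) (GI.psi q r (GI.zeta l)) =
      -(GI.zeta l * bCoef (potLow q r) q (-l)) := by
    rw [GI.wronskian, h1, h2, h3, h4, zeta_sq, bCoef, neg_neg, h8, h6]
    ring
  rw [GI.RBar, hw, e2, reflCoef]
  push_cast
  field_simp

end GI

/-! ### The matrix exponential of a Jordan block -/

section Jordan

open Matrix

/-- The nilpotent shift matrix. -/
def shiftMatrix (m : ℕ) : Matrix (Fin m) (Fin m) ℂ :=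
  Matrix.of fun a b => if (a : ℕ) + 1 = b then 1 else 0

lemma shiftMatrix_apply (m : ℕ) (a b : Fin m) :
    shiftMatrix m a b = if (a : ℕ) + 1 = b then 1 else 0 := rfl

lemma shiftMatrix_pow (m k : ℕ) (a b : Fin m) :
    (shiftMatrix m ^ k) a b = if (a : ℕ) + k = b then 1 else 0 := by
  induction k generalizing b with
  | zero => simp [Matrix.one_apply, Fin.ext_iff]
  | succ k ih =>
    rw [pow_succ, Matrix.mul_apply]
    simp only [ih, shiftMatrix_apply]
    have := b.2
    by_cases h : (a : ℕ) + (k + 1) = b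
    · rw [if_pos h, Finset.sum_eq_single ⟨a + k, by omega⟩]
      · simp; omega
      · intro c _ hc
        rw [if_neg, zero_mul]
        intro h'
        exact hc (Fin.ext h'.symm)
      · simp
    · rw [if_neg h]
      refine Finset.sum_eq_zero fun c _ => ?_
      by_cases h1 : (a : ℕ) + k = c
      · rw [if_neg (by omega : ¬(c : ℕ) + 1 = b), mul_zero]
      · rw [if_neg h1, zero_mul]

lemma exp_smul_shiftMatrix (m : ℕ) (w : ℂ) : NormedSpace.exp (w • shiftMatrix m) =
    ∑ k ∈ Finset.range m, (w ^ k / (k.factorial : ℂ)) • shiftMatrix m ^ k := by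
  rw [NormedSpace.exp_eq_tsum_rat]
  beta_reduce
  rw [tsum_eq_sum (s := Finset.range m)]
  · refine Finset.sum_congr rfl fun k _ => ?_
    ext a b
    simp only [smul_pow, Matrix.smul_apply, smul_eq_mul, Rat.smul_def]
    push_cast
    ring
  · intro k hk
    have : shiftMatrix m ^ k = 0 := by
      ext a b
      rw [shiftMatrix_pow, if_neg, Matrix.zero_apply]
      have := a.2
      have := b.2
      simp only [Finset.mem_range] at hk
      omega
    rw [smul_pow, this, smul_zero, smul_zero]

lemma exp_smul_jordanBlock (l w : ℂ) (m : ℕ) :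
    NormedSpace.exp (w • GI.BoundStateData.jordanBlock l m) =
      Complex.exp (w * l) • NormedSpace.exp (w • shiftMatrix m) := by
  have h1 : w • GI.BoundStateData.jordanBlock l m =
      Matrix.diagonal (fun _ => w * l) + w • shiftMatrix m := by
    ext a b
    simp only [GI.BoundStateData.jordanBlock, shiftMatrix, Matrix.smul_apply, Matrix.add_apply,
      Matrix.of_apply, Matrix.diagonal_apply, smul_eq_mul]
    by_cases h : a = b
    · subst h
      simp
    · simp [h]
  rw [h1, Matrix.exp_add_of_commute, Matrix.exp_diagonal]
  · ext a b
    rw [Matrix.diagonal_mul, Matrix.smul_apply, Pi.coe_exp, Complex.exp_eq_exp_ℂ, smul_eq_mul]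
  · rw [← Matrix.smul_one_eq_diagonal]
    exact (Commute.one_left _).smul_left _

/-- The vector selects the last column of the exponential. `Fin.rev` counts rows from the bottom,
which is also the order of the entries of `vecC`. -/
lemma exp_jordanBlock_mulVec (l w : ℂ) (m : ℕ) (a : Fin m) :
    (NormedSpace.exp (w • GI.BoundStateData.jordanBlock l m)).mulVec
      (fun b : Fin m => if (b : ℕ) + 1 = m then (1 : ℂ) else 0) a =
    Complex.exp (w * l) * (w ^ (a.rev : ℕ) / ((a.rev : ℕ).factorial : ℂ)) := by
  have ha := a.2
  have hrev : (a.rev : ℕ) = m - (a + 1) := Fin.val_rev a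
  have hm : 0 < m := by omega
  rw [exp_smul_jordanBlock, exp_smul_shiftMatrix, Matrix.smul_mulVec, Pi.smul_apply, smul_eq_mul]
  congr 1
  rw [Matrix.mulVec, dotProduct, Finset.sum_eq_single ⟨m - 1, by omega⟩]
  · rw [if_pos (by simp; omega), mul_one, Matrix.sum_apply, Finset.sum_eq_single (a.rev : ℕ)]
    · rw [Matrix.smul_apply, shiftMatrix_pow, if_pos (by simp; omega), smul_eq_mul, mul_one]
    · intro k _ hk
      rw [Matrix.smul_apply, shiftMatrix_pow, if_neg (by simp; omega), smul_zero]
    · intro h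
      exact absurd (Finset.mem_range.2 a.rev.2) h
  · intro b _ hb
    rw [if_neg, mul_zero]
    intro h
    exact hb (Fin.ext (by simp; omega))
  · simp

/-- The statement involves no norm; the local norms are introduced only to apply the product formula
for the exponential. -/
lemma exp_pi_matrix {ι : Type*} [Finite ι] {n : ι → Type*} [∀ i, Fintype (n i)]
    [∀ i, DecidableEq (n i)] (v : ∀ i, Matrix (n i) (n i) ℂ) (i : ι) :
    NormedSpace.exp v i = NormedSpace.exp (v i) := by
  let : ∀ i, NormedRing (Matrix (n i) (n i) ℂ) := fun i => Matrix.linftyOpNormedRing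
  let : ∀ i, NormedAlgebra ℂ (Matrix (n i) (n i) ℂ) := fun i => Matrix.linftyOpNormedAlgebra
  let : ∀ i, NormedAlgebra ℚ (Matrix (n i) (n i) ℂ) := fun i => Matrix.linftyOpNormedAlgebra
  have : ∀ i, @CompleteSpace (Matrix (n i) (n i) ℂ) PseudoMetricSpace.toUniformSpace := fun i =>
    FiniteDimensional.complete ℂ (Matrix (n i) (n i) ℂ)
  exact Pi.coe_exp (𝔸 := fun i => Matrix (n i) (n i) ℂ) v i

lemma expSandwich_eq (D : GI.BoundStateData) (w : ℂ) : D.expSandwich w =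
    ∑ j, ∑ k : Fin (D.mult j), D.c j k *
      (Complex.exp (w * D.lam j) * (w ^ (k : ℕ) / ((k : ℕ).factorial : ℂ))) := by
  have h1 : ∀ (j : Fin D.N) (a : Fin (D.mult j)),
      ((NormedSpace.exp (w • D.matA)).mulVec D.vecB) ⟨j, a⟩ =
      Complex.exp (w * D.lam j) * (w ^ (a.rev : ℕ) / ((a.rev : ℕ).factorial : ℂ)) := by
    intro j a
    rw [← exp_jordanBlock_mulVec, GI.BoundStateData.matA, ← Matrix.blockDiagonal'_smul,
      Matrix.exp_blockDiagonal', Matrix.mulVec, dotProduct, Fintype.sum_sigma,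
      Finset.sum_eq_single j]
    · simp only [Matrix.blockDiagonal'_apply_eq, exp_pi_matrix]
      rfl
    · intro j' _ hj'
      refine Finset.sum_eq_zero fun b _ => ?_
      rw [Matrix.blockDiagonal'_apply_ne _ _ _ hj'.symm, zero_mul]
    · simp
  rw [GI.BoundStateData.expSandwich, dotProduct, Fintype.sum_sigma]
  refine Finset.sum_congr rfl fun j _ => ?_
  rw [← Equiv.sum_comp Fin.revPerm]
  refine Finset.sum_congr rfl fun a _ => ?_
  rw [h1, GI.BoundStateData.vecC, Fin.revPerm_apply, Fin.rev_rev]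

end Jordan

/-! ### Dependency functions -/

/-- The polynomial in `l` whose derivatives at `lam` of order less than `m` are the `γ n`. -/
noncomputable def depFun (γ : ℕ → ℂ) (m : ℕ) (lam l : ℂ) : ℂ :=
  ∑ n ∈ Finset.range m, γ n / (n.factorial : ℂ) * (l - lam) ^ n

lemma differentiable_depFun (γ : ℕ → ℂ) (m : ℕ) (lam : ℂ) : Differentiable ℂ (depFun γ m lam) := by
  unfold depFun
  fun_prop

lemma analyticAt_depFun (γ : ℕ → ℂ) (m : ℕ) (lam l : ℂ) : AnalyticAt ℂ (depFun γ m lam) l :=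
  (differentiable_depFun γ m lam).analyticAt l

lemma iteratedDeriv_depFun (γ : ℕ → ℂ) {m k : ℕ} (hk : k < m) (lam : ℂ) :
    iteratedDeriv k (depFun γ m lam) lam = γ k := by
  unfold depFun
  rw [iteratedDeriv_fun_sum fun n _ => ContDiff.contDiffAt (by fun_prop)]
  have h : ∀ n, iteratedDeriv k (fun l : ℂ => γ n / (n.factorial : ℂ) * (l - lam) ^ n) lam =
      if k = n then γ n else 0 := by
    intro n
    rw [iteratedDeriv_const_mul_field, iteratedDeriv_comp_sub_const (f := fun z : ℂ => z ^ n)]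
    simp only [sub_self]
    rw [iteratedDeriv_fun_pow_zero]
    by_cases hkn : k = n
    · rw [if_pos hkn, if_pos hkn]
      exact div_mul_cancel₀ _ (by exact_mod_cast n.factorial_ne_zero)
    · rw [if_neg hkn, if_neg hkn, Nat.cast_zero, mul_zero]
  simp only [h]
  rw [Finset.sum_ite_eq, if_pos (Finset.mem_range.2 hk)]

/-- A function with a pole of order at most `m`, given by its Laurent coefficients. -/
def IsLaurent (τ : ℂ → ℂ) (lam : ℂ) (m : ℕ) (t : ℕ → ℂ) : Prop :=
  ∃ g : ℂ → ℂ, AnalyticAt ℂ g lam ∧ ∀ᶠ l in 𝓝[≠] lam,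
    τ l = (∑ k ∈ Finset.Icc 1 m, t k / (l - lam) ^ k) + g l

/-- By the Leibniz rule the dependency relations say that Φ and ΓΨ have the same derivatives of
order below m at the pole. Their difference thus vanishes to order m there, which cancels the pole
of τ. -/
lemma IsLaurent.exists_extension {τ : ℂ → ℂ} {lam : ℂ} {m : ℕ} {t γ : ℕ → ℂ}
    (hτ : IsLaurent τ lam m t) {Φ Ψ : ℂ → ℂ} (hΦ : AnalyticAt ℂ Φ lam) (hΨ : AnalyticAt ℂ Ψ lam)
    (h : ∀ k < m, iteratedDeriv k Φ lam = ∑ n ∈ Finset.range (k + 1),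
      (k.choose n : ℂ) * γ (k - n) * iteratedDeriv n Ψ lam) :
    ∃ f : ℂ → ℂ, AnalyticAt ℂ f lam ∧
      ∀ᶠ l in 𝓝[≠] lam, τ l * (Φ l - depFun γ m lam l * Ψ l) = f l := by
  have hΓ := analyticAt_depFun γ m lam lam
  have hd : AnalyticAt ℂ (fun l => Φ l - Ψ l * depFun γ m lam l) lam := hΦ.sub (hΨ.mul hΓ)
  have ho : (m : ℕ∞) ≤ analyticOrderAt (fun l => Φ l - Ψ l * depFun γ m lam l) lam := by
    rw [natCast_le_analyticOrderAt_iff_iteratedDeriv_eq_zero hd]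
    intro k hk
    rw [iteratedDeriv_fun_sub hΦ.contDiffAt (hΨ.fun_mul hΓ).contDiffAt,
      iteratedDeriv_fun_mul hΨ.contDiffAt hΓ.contDiffAt, h k hk, sub_eq_zero]
    refine Finset.sum_congr rfl fun n hn => ?_
    rw [iteratedDeriv_depFun γ (by omega) lam]
    ring
  obtain ⟨u, hu, hue⟩ := (natCast_le_analyticOrderAt hd).1 ho
  obtain ⟨g, hg, hge⟩ := hτ
  refine ⟨fun l => ((∑ k ∈ Finset.Icc 1 m, t k * (l - lam) ^ (m - k)) + g l * (l - lam) ^ m) * u l,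
    ?_, ?_⟩
  · refine AnalyticAt.mul (AnalyticAt.add ?_ (hg.mul (by fun_prop))) hu
    exact Finset.analyticAt_fun_sum _ fun k _ => by fun_prop
  · filter_upwards [hge, eventually_nhdsWithin_of_eventually_nhds hue, self_mem_nhdsWithin]
      with l h1 h2 h3
    have h4 : l - lam ≠ 0 := sub_ne_zero.2 h3
    rw [mul_comm (depFun γ m lam l), h2, h1, smul_eq_mul, ← mul_assoc, add_mul, Finset.sum_mul]
    congr 2
    refine Finset.sum_congr rfl fun k hk => ?_
    rw [← Nat.sub_add_cancel (Finset.mem_Icc.1 hk).2, Nat.add_sub_cancel, pow_add]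
    field_simp

lemma circleIntegral_pole {lam w : ℂ} {m k : ℕ} (γ : ℕ → ℂ) {ρ : ℝ} (hρ : 0 < ρ) (hk : k < m) :
    ∮ l in C(lam, ρ), 1 / (l - lam) ^ (k + 1) * (depFun γ m lam l * Complex.exp (w * l)) =
      2 * Real.pi * Complex.I * ∑ n ∈ Finset.range (k + 1),
        γ n / (n.factorial : ℂ) * (Complex.exp (w * lam) * (w ^ (k - n) / ((k - n).factorial : ℂ))) := by
  have hΓ := differentiable_depFun γ m lam
  have hd : Differentiable ℂ fun l => depFun γ m lam l * Complex.exp (w * l) := by fun_prop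
  have h := DifferentiableOn.circleIntegral_one_div_sub_center_pow_smul hρ k
    (hd.differentiableOn (s := Metric.closedBall lam ρ))
  simp only [smul_eq_mul] at h
  rw [h, iteratedDeriv_fun_mul (hΓ.contDiff.contDiffAt) (by fun_prop), Finset.mul_sum,
    Finset.mul_sum]
  refine Finset.sum_congr rfl fun n hn => ?_
  have hn' : n ≤ k := Nat.lt_succ_iff.1 (Finset.mem_range.1 hn)
  rw [iteratedDeriv_depFun γ (by omega), iteratedDeriv_cexp_const_mul, Nat.cast_choose ℂ hn']
  have h1 : (k.factorial : ℂ) ≠ 0 := by exact_mod_cast k.factorial_ne_zero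
  field_simp

/-- Cauchy's formula for derivatives and the Leibniz rule give a double sum over a triangle; summing
by the power p of w collects precisely the combinations of t and γ that define the normalization
constants. -/
lemma IsLaurent.circleIntegral_eq {τ : ℂ → ℂ} {lam : ℂ} {m : ℕ} {t : ℕ → ℂ}
    (hτ : IsLaurent τ lam m t) (γ : ℕ → ℂ) (w : ℂ) {ρ : ℝ} (hρ : 0 < ρ)
    (hd : ∀ l ∈ Metric.closedBall lam ρ, l ≠ lam → DifferentiableAt ℂ τ l) :
    ∮ l in C(lam, ρ), τ l * depFun γ m lam l * Complex.exp (w * l) =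
      2 * Real.pi * Complex.I * ∑ p : Fin m,
        (∑ n ∈ Finset.range (m - p), t (p + n + 1) * γ n / (n.factorial : ℂ)) *
          (Complex.exp (w * lam) * (w ^ (p : ℕ) / ((p : ℕ).factorial : ℂ))) := by
  obtain ⟨g, hg, hge⟩ := hτ
  have hΓ := differentiable_depFun γ m lam
  have hE : Differentiable ℂ fun l => depFun γ m lam l * Complex.exp (w * l) := by fun_prop
  obtain ⟨G, hGd, hGe⟩ := AKNS.exists_extension (ρ := ρ)
    (f := fun l => τ l - ∑ k ∈ Finset.Icc 1 m, t k / (l - lam) ^ k) hg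
    (hge.mono fun l hl => by rw [hl]; ring) (fun l hl hne => (hd l hl hne).sub
      (DifferentiableAt.fun_sum fun k _ => DifferentiableAt.div (by fun_prop) (by fun_prop)
        (pow_ne_zero _ (sub_ne_zero.2 hne))))
  have hne : ∀ l ∈ Metric.sphere lam ρ, l ≠ lam := fun l hl => Metric.ne_of_mem_sphere hl hρ.ne'
  have hi : ∀ k ∈ Finset.range m, CircleIntegrable (fun l => t (k + 1) * (1 / (l - lam) ^ (k + 1) *
      (depFun γ m lam l * Complex.exp (w * l)))) lam ρ := by
    intro k _
    refine ContinuousOn.circleIntegrable hρ.le (continuousOn_const.mul ?_)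
    refine ContinuousOn.mul (continuousOn_const.div (by fun_prop) fun l hl => ?_)
      hE.continuous.continuousOn
    exact pow_ne_zero _ (sub_ne_zero.2 (hne l hl))
  have hGi : ∀ l ∈ Metric.closedBall lam ρ,
      DifferentiableAt ℂ (fun l => G l * (depFun γ m lam l * Complex.exp (w * l))) l :=
    fun l hl => (hGd l hl).mul (hE l)
  have e1 : ∮ l in C(lam, ρ), τ l * depFun γ m lam l * Complex.exp (w * l) =
      ∮ l in C(lam, ρ), ((∑ k ∈ Finset.range m, t (k + 1) * (1 / (l - lam) ^ (k + 1) *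
        (depFun γ m lam l * Complex.exp (w * l)))) +
        G l * (depFun γ m lam l * Complex.exp (w * l))) := by
    refine circleIntegral.integral_congr hρ.le fun l hl => ?_
    have h1 := hGe l (hne l hl)
    have h2 : ∑ k ∈ Finset.Icc 1 m, t k / (l - lam) ^ k =
        ∑ k ∈ Finset.range m, t (k + 1) / (l - lam) ^ (k + 1) := by
      rw [Finset.range_eq_Ico, Finset.sum_Ico_add' (fun k => t k / (l - lam) ^ k) 0 m 1]
      rfl
    rw [h2] at h1
    have h3 : ∑ k ∈ Finset.range m, t (k + 1) * (1 / (l - lam) ^ (k + 1) *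
        (depFun γ m lam l * Complex.exp (w * l))) =
        (∑ k ∈ Finset.range m, t (k + 1) / (l - lam) ^ (k + 1)) *
        (depFun γ m lam l * Complex.exp (w * l)) := by
      rw [Finset.sum_mul]
      exact Finset.sum_congr rfl fun k _ => by ring
    rw [h3, h1]
    ring
  have hsi : CircleIntegrable (fun l => ∑ k ∈ Finset.range m, t (k + 1) * (1 / (l - lam) ^ (k + 1) *
      (depFun γ m lam l * Complex.exp (w * l)))) lam ρ := by
    simpa only [Finset.sum_fn] using CircleIntegrable.sum _ hi
  rw [e1, circleIntegral.integral_add hsi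
    (circleIntegrable_of_differentiableAt hρ.le
      fun l hl => hGi l (Metric.sphere_subset_closedBall hl)),
    circleIntegral_eq_zero_of_differentiableAt hρ.le hGi, add_zero,
    circleIntegral.integral_fun_sum hi]
  simp only [circleIntegral.integral_const_mul]
  set X : ℕ → ℂ := fun p => Complex.exp (w * lam) * (w ^ p / (p.factorial : ℂ)) with hX
  have e2 : ∀ k ∈ Finset.range m, t (k + 1) * ∮ l in C(lam, ρ), 1 / (l - lam) ^ (k + 1) *
      (depFun γ m lam l * Complex.exp (w * l)) = 2 * Real.pi * Complex.I *
        ∑ n ∈ Finset.range (k + 1), t (n + (k - n) + 1) * γ (k - n) / ((k - n).factorial : ℂ) * X n := by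
    intro k hk
    rw [circleIntegral_pole γ hρ (Finset.mem_range.1 hk), ← Finset.sum_flip, Finset.mul_sum,
      Finset.mul_sum, Finset.mul_sum]
    refine Finset.sum_congr rfl fun n hn => ?_
    have hn' : n ≤ k := Nat.lt_succ_iff.1 (Finset.mem_range.1 hn)
    rw [Nat.sub_sub_self hn', Nat.add_sub_cancel' hn']
    ring
  rw [Finset.sum_congr rfl e2, ← Finset.mul_sum,
    Finset.sum_range_diag_flip m fun n i => t (n + i + 1) * γ i / (i.factorial : ℂ) * X n,
    Finset.sum_range]
  simp only [Finset.sum_mul, hX]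

/-! ### Bound states -/

lemma exists_isolating_radii {S : Finset ℂ} (hS : ∀ c ∈ S, 0 < c.im) : ∃ ρ : ℂ → ℝ,
    (∀ c ∈ S, 0 < ρ c) ∧ (∀ c ∈ S, ∀ z ∈ Metric.closedBall c (ρ c), 0 < z.im) ∧
    ∀ c ∈ S, ∀ c' ∈ S, c' ∈ Metric.closedBall c (ρ c) → c' = c := by
  have h : ∀ c ∈ S, ∃ ρ : ℝ, 0 < ρ ∧
      Metric.closedBall c ρ ⊆ {z | 0 < z.im} ∩ ((S.erase c : Finset ℂ) : Set ℂ)ᶜ := by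
    intro c hc
    refine Metric.nhds_basis_closedBall.mem_iff.1 (IsOpen.mem_nhds ?_ ⟨hS c hc, by simp⟩)
    exact Scat.isOpen_im.inter (Finset.finite_toSet _).isClosed.isOpen_compl
  choose! ρ h1 h2 using h
  refine ⟨ρ, h1, fun c hc z hz => (h2 c hc hz).1, fun c hc c' hc' hz => ?_⟩
  by_contra hne
  exact (h2 c hc hz).2 (by simp [hne, hc'])

/-- Negation is a rotation of the circle parameter by π, undone by periodicity; the sign comes from
dz. -/
lemma circleIntegral_comp_neg (f : ℂ → ℂ) (c : ℂ) (ρ : ℝ) :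
    ∮ z in C(-c, ρ), f (-z) = -∮ z in C(c, ρ), f z := by
  have h1 : ∀ θ, -circleMap (-c) ρ θ = circleMap c ρ (θ + Real.pi) := by
    intro θ
    simp only [circleMap]
    push_cast
    rw [add_mul, Complex.exp_add, Complex.exp_pi_mul_I]
    ring
  have h2 : ∀ θ, deriv (circleMap (-c) ρ) θ = -deriv (circleMap c ρ) (θ + Real.pi) := by
    intro θ
    simp only [deriv_circleMap, circleMap]
    push_cast
    rw [add_mul (θ : ℂ), Complex.exp_add, Complex.exp_pi_mul_I]
    ring
  simp only [circleIntegral, h1, h2, neg_smul, intervalIntegral.integral_neg]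
  rw [intervalIntegral.integral_comp_add_right
    (fun θ => deriv (circleMap c ρ) θ • f (circleMap c ρ θ)), zero_add, add_comm (2 * Real.pi)]
  congr 1
  have hp : Function.Periodic (fun θ => deriv (circleMap c ρ) θ • f (circleMap c ρ θ))
      (2 * Real.pi) := by
    intro θ
    simp only [deriv_circleMap, periodic_circleMap c ρ θ, periodic_circleMap 0 ρ θ]
  simpa using hp.intervalIntegral_add_eq Real.pi 0

/-- The dependency functions that belong to the bound-state data. -/
lemma exists_depFun {D : GI.BoundStateData} {H : Set ℂ} {τ : ℂ → ℂ} {Φ Ψ : ℂ → ℝ → Fin 2 → ℂ}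
    {s : ℂ} (h : D.Represents H τ Φ Ψ s) : ∃ Γ : ℂ → ℂ → ℂ,
    (∀ j, Differentiable ℂ (Γ (D.lam j))) ∧
    (∀ j x i, AnalyticAt ℂ (fun l => Φ l x i) (D.lam j) → AnalyticAt ℂ (fun l => Ψ l x i) (D.lam j) →
      ∃ f : ℂ → ℂ, AnalyticAt ℂ f (D.lam j) ∧ ∀ᶠ l in 𝓝[≠] (D.lam j),
        τ l * (Φ l x i - Γ (D.lam j) l * Ψ l x i) = f l) ∧
    ∀ (ρ : ℂ → ℝ) (w : ℂ), (∀ j, 0 < ρ (D.lam j)) →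
      (∀ j, ∀ l ∈ Metric.closedBall (D.lam j) (ρ (D.lam j)), l ≠ D.lam j → DifferentiableAt ℂ τ l) →
      2 * Real.pi * D.expSandwich w = -Complex.I * s * ∑ j,
        ∮ l in C(D.lam j, ρ (D.lam j)), τ l * Γ (D.lam j) l * Complex.exp (w * l) := by
  obtain ⟨hinj, -, hrep⟩ := h
  choose _ t γ hL hΦ hc using hrep
  -- The dependency functions are indexed by points of the plane rather than by j; injectivity of
  -- `D.lam` makes this consistent, and the value off its range is irrelevant.
  refine ⟨Function.extend D.lam (fun j => depFun (γ j) (D.mult j) (D.lam j)) 0, ?_, ?_, ?_⟩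
  · intro j
    rw [hinj.extend_apply]
    exact differentiable_depFun _ _ _
  · intro j x i h1 h2
    rw [hinj.extend_apply]
    exact IsLaurent.exists_extension (hL j) h1 h2 (hΦ j x i)
  · intro ρ w hρ hd
    simp only [hinj.extend_apply]
    rw [expSandwich_eq, Finset.mul_sum, Finset.mul_sum]
    refine Finset.sum_congr rfl fun j _ => ?_
    rw [IsLaurent.circleIntegral_eq (hL j) (γ j) w (hρ j) (hd j), Finset.mul_sum, Finset.mul_sum,
      Finset.mul_sum]
    refine Finset.sum_congr rfl fun p _ => ?_
    rw [hc]
    linear_combination (2 * Real.pi * s * (∑ n ∈ Finset.range (D.mult j - p),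
      t j (p + n + 1) * γ j n / (n.factorial : ℂ)) * (Complex.exp (w * D.lam j) *
        (w ^ (p : ℕ) / ((p : ℕ).factorial : ℂ)))) * Complex.I_sq

lemma meromorphicOrderAt_inv_neg {a : ℂ → ℂ} {z : ℂ} (ha : AnalyticAt ℂ a z) (h0 : a z = 0)
    (hne : ¬∀ᶠ w in 𝓝 z, a w = 0) : meromorphicOrderAt (fun w => 1 / a w) z < 0 := by
  have h1 : (fun w => 1 / a w) = a⁻¹ := by
    ext w
    simp
  rw [h1, meromorphicOrderAt_inv, ha.meromorphicOrderAt_eq]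
  have h2 : analyticOrderAt a z ≠ 0 := ha.analyticOrderAt_ne_zero.2 h0
  have h3 : analyticOrderAt a z ≠ ⊤ := fun h => hne (analyticOrderAt_eq_top.1 h)
  obtain ⟨n, hn⟩ := ENat.ne_top_iff_exists.1 h3
  rw [← hn] at h2 ⊢
  have h4 : 0 < n := Nat.pos_of_ne_zero (by exact_mod_cast h2)
  simp only [ENat.map_natCast]
  have : (-(n : ℤ) : ℤ) < 0 := by omega
  exact_mod_cast this

/-- By the identity theorem a would vanish on the whole half-plane, against its limit 1 along the
imaginary axis. This rules out the degenerate case in which 1/a is locally 0, of order ⊤, instead of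
having a pole. -/
lemma not_eventually_aCoef_eq_zero (q r : 𝓢(ℝ, ℂ)) {z : ℂ} (hz : 0 < z.im) :
    ¬∀ᶠ w in 𝓝 z, aCoef q r w = 0 := by
  intro h
  have h1 : EqOn (aCoef q r) 0 {z | 0 < z.im} := by
    refine AnalyticOnNhd.eqOn_zero_of_preconnected_of_eventuallyEq_zero
      (fun w hw => analyticAt_aCoef q r hw) ?_ hz h
    exact (convex_halfSpace_im_gt 0).isPreconnected
  have h2 : Tendsto (fun n : ℕ => ((n : ℂ) + 1) * Complex.I) atTop upperInf := by
    rw [upperInf, tendsto_inf, tendsto_principal]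
    constructor
    · rw [← tendsto_norm_atTop_iff_cobounded]
      have : ∀ n : ℕ, ‖((n : ℂ) + 1) * Complex.I‖ = n + 1 := by
        intro n
        rw [norm_mul, Complex.norm_I, mul_one]
        exact_mod_cast Complex.norm_natCast (n + 1)
      simp only [this]
      exact tendsto_atTop_add_const_right _ _ tendsto_natCast_atTop_atTop
    · refine Eventually.of_forall fun n => ?_
      simp
      positivity
  have h3 := (tendsto_aCoef q r).comp h2
  have h4 : aCoef q r ∘ (fun n : ℕ => ((n : ℂ) + 1) * Complex.I) = fun _ => 0 := by
    ext n
    refine h1 ?_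
    simp
    positivity
  rw [h4] at h3
  exact zero_ne_one (tendsto_nhds_unique tendsto_const_nhds h3)

lemma analyticAt_left (q r : 𝓢(ℝ, ℂ)) (x : ℝ) {z : ℂ} (hz : 0 < z.im) :
    AnalyticAt ℂ (fun z => leftOne q r z x) z ∧ AnalyticAt ℂ (fun z => leftTwo q r z x) z := by
  have h1 := (differentiableOn_mOne (reflS r) (reflS q) (-x)).analyticAt (Scat.isOpen_im.mem_nhds hz)
  have h2 := (differentiableOn_mTwo (reflS r) (reflS q) (-x)).analyticAt (Scat.isOpen_im.mem_nhds hz)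
  exact ⟨AnalyticAt.fun_mul (by fun_prop) h2, AnalyticAt.fun_mul (by fun_prop) h1⟩

lemma analyticAt_jost (q r : 𝓢(ℝ, ℂ)) (x : ℝ) {z : ℂ} (hz : 0 < z.im) :
    AnalyticAt ℂ (fun z => jostOne q r z x) z ∧ AnalyticAt ℂ (fun z => jostTwo q r z x) z := by
  have h1 := (differentiableOn_mOne q r x).analyticAt (Scat.isOpen_im.mem_nhds hz)
  have h2 := (differentiableOn_mTwo q r x).analyticAt (Scat.isOpen_im.mem_nhds hz)
  exact ⟨AnalyticAt.fun_mul (by fun_prop) h1, AnalyticAt.fun_mul (by fun_prop) h2⟩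

/-- The scattering structure of both gauge-related systems, from one component of each. -/
lemma scat_pair (c : ℂ) (q r : 𝓢(ℝ, ℂ)) {S : Finset ℂ} {ρ : ℂ → ℝ} {Γ : ℂ → ℂ → ℂ}
    (ha : ∀ l : ℝ, aCoef (gaugePot c q r) r l ≠ 0)
    (hz : ∀ z : ℂ, 0 < z.im → aCoef (gaugePot c q r) r z = 0 → z ∈ S)
    (pos : ∀ c ∈ S, 0 < ρ c) (ball : ∀ c ∈ S, ∀ z ∈ Metric.closedBall c (ρ c), 0 < z.im)
    (sep : ∀ c ∈ S, ∀ c' ∈ S, c' ∈ Metric.closedBall c (ρ c) → c' = c)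
    (diff : ∀ c ∈ S, Differentiable ℂ (Γ c))
    (h₁ : ∀ b ∈ S, ∀ x : ℝ, ∃ h : ℂ → ℂ, AnalyticAt ℂ h b ∧ ∀ᶠ z in 𝓝[≠] b,
      (leftOne q (gaugePot (-c) r q) z x - -2 * Complex.I * c * z * Γ b z *
        jostOne q (gaugePot (-c) r q) z x) / aCoef (gaugePot c q r) r z = h z)
    (h₂ : ∀ b ∈ S, ∀ x : ℝ, ∃ h : ℂ → ℂ, AnalyticAt ℂ h b ∧ ∀ᶠ z in 𝓝[≠] b,
      (leftTwo (gaugePot c q r) r z x - Γ b z *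
        jostTwo (gaugePot c q r) r z x) / aCoef (gaugePot c q r) r z = h z) :
    Scat (gaugePot c q r) r S ρ Γ ∧
      Scat q (gaugePot (-c) r q) S ρ (fun b z => -2 * Complex.I * c * z * Γ b z) := by
  have him : ∀ b ∈ S, ∀ᶠ z in 𝓝[≠] b, 0 < z.im := fun b hb =>
    eventually_nhdsWithin_of_eventually_nhds (Scat.isOpen_im.mem_nhds
      (ball b hb b (Metric.mem_closedBall_self (pos b hb).le)))
  constructor
  · refine ⟨ha, hz, pos, ball, sep, diff, fun b hb x => ?_, h₂⟩
    obtain ⟨f, hf, hfe⟩ := h₁ b hb x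
    obtain ⟨g, hg, hge⟩ := h₂ b hb x
    -- The missing first component is, by the gauge relations, a combination of the two given
    -- quotients with coefficients analytic in z.
    refine ⟨fun z => f z + c * q x * g z, hf.fun_add (analyticAt_const.fun_mul hg), ?_⟩
    filter_upwards [hfe, hge, him b hb] with z h3 h4 h5
    obtain ⟨h6, -⟩ := jost_gauge c q r h5.le x
    obtain ⟨-, h7⟩ := left_gauge c q r h5.le x
    rw [← h3, ← h4, h6, h7]
    ring
  · refine ⟨fun l => ?_, fun z hz' => ?_, pos, ball, sep, fun b hb => ?_, fun b hb x => ?_,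
      fun b hb x => ?_⟩
    · rw [aCoef_gauge c q r (by simp)]
      exact ha l
    · rw [aCoef_gauge c q r hz'.le]
      exact hz z hz'
    · have := diff b hb
      fun_prop
    · obtain ⟨f, hf, hfe⟩ := h₁ b hb x
      refine ⟨f, hf, ?_⟩
      filter_upwards [hfe, him b hb] with z h3 h5
      rw [aCoef_gauge c q r h5.le]
      exact h3
    · obtain ⟨f, hf, hfe⟩ := h₁ b hb x
      obtain ⟨g, hg, hge⟩ := h₂ b hb x
      refine ⟨fun z => -2 * Complex.I * c * z * g z - c * r x * f z,
        (AnalyticAt.fun_mul (by fun_prop) hg).fun_sub (analyticAt_const.fun_mul hf), ?_⟩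
      filter_upwards [hfe, hge, him b hb] with z h3 h4 h5
      obtain ⟨-, h6⟩ := jost_gauge c q r h5.le x
      obtain ⟨h7, -⟩ := left_gauge c q r h5.le x
      rw [← h3, ← h4, h6, h7, aCoef_gauge c q r h5.le]
      ring

namespace Scat

variable {q r q' r' : 𝓢(ℝ, ℂ)} {S : Finset ℂ} {ρ : ℂ → ℝ} {Γ : ℂ → ℂ → ℂ} {Ω : ℝ → ℂ}

/-- The derivative of a Marchenko kernel is the kernel of the gauge-related system. -/
lemma isKernelFun_deriv {κ : ℂ} (h : Scat q r S ρ Γ) (hΩ : IsKernelFun q r S ρ Γ Ω)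
    (h' : Scat q' r' S ρ (fun b z => κ * z * Γ b z)) (hκ : κ ≠ 0)
    (hR : ∀ l : ℝ, reflCoef q' r' l = κ * l * reflCoef q r l)
    (ha : ∀ z : ℂ, 0 ≤ z.im → aCoef q' r' z = aCoef q r z) :
    IsKernelFun q' r' S ρ (fun b z => κ * z * Γ b z) (fun t => -Complex.I * κ * deriv Ω t) := by
  have hdiv : ∀ {Θ : Type} [MeasurableSpace Θ] {ν : Measure Θ} {freq w : Θ → ℂ},
      ExpData ν freq w → ExpData ν freq (fun θ => κ * (freq θ * w θ)) →
      ∀ t, HasDerivAt (expT ν freq w)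
        (Complex.I * κ⁻¹ * expT ν freq (fun θ => κ * (freq θ * w θ)) t) t := by
    intro Θ _ ν freq w h1 h2 t
    have h3 : ExpData ν freq (fun θ => freq θ * w θ) := ⟨h2.meas, h2.nonneg, fun t => by
      refine ((h2.integrable t).const_mul κ⁻¹).congr (Eventually.of_forall fun θ => ?_)
      simp only
      field_simp⟩
    refine (h1.hasDerivAt_expT h3 t).congr_deriv ?_
    rw [mul_assoc]
    congr 1
    unfold expT
    rw [← integral_const_mul]
    congr 1
    ext θ
    field_simp
  have e1 : reflCoef q' r' = fun l : ℝ => κ * ((l : ℂ) * reflCoef q r l) := by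
    ext l
    rw [hR]
    ring
  -- Differentiating under the integral needs l times the reflection coefficient to be integrable.
  -- Up to the factor κ this is the reflection coefficient of the related system, integrable by its
  -- own decay.
  have i1 := expData_reflCoef h'.a_ne
  rw [e1] at i1
  have e2 : ∀ b ∈ S, (fun θ => deriv (circleMap b (ρ b)) θ *
      (κ * circleMap b (ρ b) θ * Γ b (circleMap b (ρ b) θ) /
        aCoef q' r' (circleMap b (ρ b) θ))) = fun θ => κ * (circleMap b (ρ b) θ *
      (deriv (circleMap b (ρ b)) θ *
      (Γ b (circleMap b (ρ b) θ) / aCoef q r (circleMap b (ρ b) θ)))) := by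
    intro b hb
    ext θ
    rw [ha _ (h.ball b hb _ (circleMap_mem_closedBall b (h.pos b hb).le θ)).le]
    ring
  have i2 : ∀ b ∈ S, _ := fun b hb => h'.expData_dep hb
  intro t
  have hd : HasDerivAt Ω ((2 * Real.pi : ℂ)⁻¹ * (Complex.I * κ⁻¹ * expT volume (fun l : ℝ => (l : ℂ))
      (reflCoef q' r') t - ∑ b ∈ S, Complex.I * κ⁻¹ *
        expT (volume.restrict (Ioc 0 (2 * Real.pi))) (circleMap b (ρ b))
      (fun θ => deriv (circleMap b (ρ b)) θ * (κ * circleMap b (ρ b) θ *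
        Γ b (circleMap b (ρ b) θ) / aCoef q' r' (circleMap b (ρ b) θ))) t)) t := by
    rw [kernelFun_eq hΩ, e1]
    refine HasDerivAt.const_mul _ ((hdiv (expData_reflCoef h.a_ne) i1 t).sub ?_)
    refine HasDerivAt.fun_sum fun b hb => ?_
    have := i2 b hb
    rw [e2 b hb] at this ⊢
    exact hdiv (h.expData_dep hb) this t
  have hc : ∀ b, expT (volume.restrict (Ioc 0 (2 * Real.pi))) (circleMap b (ρ b))
      (fun θ => deriv (circleMap b (ρ b)) θ * (κ * circleMap b (ρ b) θ *
        Γ b (circleMap b (ρ b) θ) / aCoef q' r' (circleMap b (ρ b) θ))) t =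
      ∮ z in C(b, ρ b), κ * z * Γ b z / aCoef q' r' z * Complex.exp (Complex.I * z * t) := fun b =>
    expT_circle (fun z => κ * z * Γ b z / aCoef q' r' z) b (ρ b) t
  simp only [hc] at hd
  rw [← Finset.mul_sum] at hd
  have hpi : (2 * Real.pi : ℂ) ≠ 0 := by simp [Real.pi_ne_zero]
  have hX : ∀ X : ℂ, 2 * Real.pi * (-Complex.I * κ * ((2 * Real.pi : ℂ)⁻¹ *
      (Complex.I * κ⁻¹ * X))) = X := by
    intro X
    field_simp
    linear_combination -X * Complex.I_sq
  beta_reduce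
  rw [hd.deriv, ← mul_sub, hX]

end Scat

/-! ### Scattering structure from bound states in the upper half-plane -/

section GI

variable {q r : 𝓢(ℝ, ℂ)} {D : GI.BoundStateData}

lemma T_zeta {l : ℂ} (hl : 0 ≤ l.im) : GI.T q r (GI.zeta l) = 1 / aCoef (potUp q r) r l := by
  rw [GI.T, wronskian_phi_psi q r hl]

lemma TBar_zeta {l : ℂ} (hl : l.im ≤ 0) : GI.TBar q r (GI.zeta l) = 1 / aCoef (potLow q r) q (-l) := by
  rw [GI.TBar, wronskian_psiBar_phiBar q r hl]

lemma ne_zero_of_im {l : ℂ} (hl : l.im ≠ 0) : l ≠ 0 := fun h => hl (by rw [h, Complex.zero_im])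

/-- The scattering structure of the system with bound-state data `D`. -/
lemma exists_scat (hreg : GI.NoSpectralSingularity q r) (hD : GI.IsBoundStateInfo q r D) :
    ∃ (S : Finset ℂ) (ρ : ℂ → ℝ) (Γ Γ' : ℂ → ℂ → ℂ),
      Scat (potUp q r) r S ρ Γ ∧ Scat q (potLow q r) S ρ Γ' ∧
      Scat.IsKernelFun (potUp q r) r S ρ Γ (GI.Om q r D) ∧
      Scat.IsKernelFun q (potLow q r) S ρ Γ' (fun t => -Complex.I * deriv (GI.Om q r D) t) := by
  obtain ⟨Γ, hΓd, hΓe, hΓs⟩ := exists_depFun hD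
  obtain ⟨hinj, hrange, -⟩ := hD
  set τ : ℂ → ℂ := fun l => GI.T q r (GI.zeta l) with hτ
  have him : ∀ j, 0 < (D.lam j).im := fun j => by
    have : D.lam j ∈ {l | l ∈ {l : ℂ | 0 < l.im} ∧ meromorphicOrderAt τ l < 0} :=
      hrange ▸ mem_range_self j
    exact this.1
  have hτe : ∀ l : ℂ, 0 < l.im → τ =ᶠ[𝓝 l] fun w => 1 / aCoef (potUp q r) r w := fun l hl => by
    filter_upwards [Scat.isOpen_im.mem_nhds hl] with w hw using T_zeta (le_of_lt hw)
  -- Finiteness of the zero set of a is part of the data: the range of `D.lam` contains every pole.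
  set S : Finset ℂ := Finset.univ.image D.lam with hS
  have hSm : ∀ b ∈ S, ∃ j, D.lam j = b := by simp [hS]
  obtain ⟨ρ, hρ, hball, hsep⟩ := exists_isolating_radii (S := S) (fun b hb => by
    obtain ⟨j, rfl⟩ := hSm b hb
    exact him j)
  have hjS : ∀ j, D.lam j ∈ S := by simp [hS]
  have hzero : ∀ z : ℂ, 0 < z.im → aCoef (potUp q r) r z = 0 → z ∈ S := by
    intro z hz h0
    have h1 : z ∈ range D.lam := by
      rw [hrange]
      refine ⟨hz, ?_⟩
      rw [meromorphicOrderAt_congr ((hτe z hz).filter_mono nhdsWithin_le_nhds)]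
      exact meromorphicOrderAt_inv_neg (analyticAt_aCoef _ _ hz) h0
        (not_eventually_aCoef_eq_zero _ _ hz)
    obtain ⟨j, rfl⟩ := h1
    exact hjS j
  have hz0 : ∀ {z : ℂ}, 0 < z.im → GI.zeta z ≠ 0 := fun hz => zeta_ne_zero (ne_zero_of_im hz.ne')
  have hext : ∀ j (f g f' g' : ℂ → ℂ) , (∀ z : ℂ, 0 < z.im → f z = f' z) →
      (∀ z : ℂ, 0 < z.im → g z = g' z) →
      (∃ h : ℂ → ℂ, AnalyticAt ℂ h (D.lam j) ∧ ∀ᶠ z in 𝓝[≠] (D.lam j),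
        τ z * (f' z - Γ (D.lam j) z * g' z) = h z) →
      ∃ h : ℂ → ℂ, AnalyticAt ℂ h (D.lam j) ∧ ∀ᶠ z in 𝓝[≠] (D.lam j),
        (f z - Γ (D.lam j) z * g z) / aCoef (potUp q r) r z = h z := by
    rintro j f g f' g' hf hg ⟨h, hh, he⟩
    refine ⟨h, hh, ?_⟩
    filter_upwards [he, eventually_nhdsWithin_of_eventually_nhds (hτe _ (him j)),
      eventually_nhdsWithin_of_eventually_nhds (Scat.isOpen_im.mem_nhds (him j))] with z h1 h2 h3
    rw [← h1, h2, hf z h3, hg z h3]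
    ring
  have hzim : ∀ {z : ℂ}, 0 < z.im → 0 ≤ (GI.zeta z ^ 2).im := fun hz => by
    rw [zeta_sq]
    exact hz.le
  have p1 : ∀ (x : ℝ) (z : ℂ), 0 < z.im → leftOne q (potLow q r) z x = GI.phi q r (GI.zeta z) x 0 :=
    fun x z hz => by rw [(phi_spec q r (hzim hz) x).1, zeta_sq]
  have p2 : ∀ (x : ℝ) (z : ℂ), 0 < z.im →
      leftTwo (potUp q r) r z x = GI.phi q r (GI.zeta z) x 1 / GI.zeta z := fun x z hz => by
    rw [(phi_spec q r (hzim hz) x).2, zeta_sq, mul_div_cancel_left₀ _ (hz0 hz)]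
  have p3 : ∀ (x : ℝ) (z : ℂ), 0 < z.im →
      z * jostOne q (potLow q r) z x = GI.zeta z * GI.psi q r (GI.zeta z) x 0 := fun x z hz => by
    rw [((psi_spec q r (hzim hz)).2 x).1, zeta_sq, ← mul_assoc, ← sq, zeta_sq]
  have p4 : ∀ (x : ℝ) (z : ℂ), 0 < z.im →
      jostTwo (potUp q r) r z x = GI.psi q r (GI.zeta z) x 1 := fun x z hz => by
    rw [((psi_spec q r (hzim hz)).2 x).2, zeta_sq]
  have hev : ∀ {f g : ℂ → ℂ}, (∀ z : ℂ, 0 < z.im → f z = g z) → ∀ j, AnalyticAt ℂ f (D.lam j) →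
      AnalyticAt ℂ g (D.lam j) := fun h j hf => hf.congr (by
    filter_upwards [Scat.isOpen_im.mem_nhds (him j)] with z hz using h z hz)
  -- For c = i/2 the gauge constant is 1, so the related system has the dependency function zΓ,
  -- which matches the relation between φ₁ and ζψ₁.
  have hκ : -2 * Complex.I * (Complex.I / 2) = 1 := by
    linear_combination -Complex.I_sq
  have hs : Scat (potUp q r) r S ρ Γ ∧
      Scat q (potLow q r) S ρ (fun b z => -2 * Complex.I * (Complex.I / 2) * z * Γ b z) := by
    refine scat_pair (Complex.I / 2) q r (fun l => ?_) hzero hρ hball hsep ?_ ?_ ?_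
    · have := (hreg l).1
      rwa [wronskian_phi_psi q r (by simp)] at this
    · intro b hb
      obtain ⟨j, rfl⟩ := hSm b hb
      exact hΓd j
    · intro b hb x
      obtain ⟨j, rfl⟩ := hSm b hb
      simp only [hκ, one_mul, mul_comm _ (Γ _ _), mul_assoc]
      refine hext j _ _ _ _ (p1 x) (p3 x) (hΓe j x 0 ?_ ?_)
      · exact hev (p1 x) j (analyticAt_left _ _ x (him j)).1
      · exact hev (p3 x) j (AnalyticAt.fun_mul (by fun_prop) (analyticAt_jost _ _ x (him j)).1)
    · intro b hb x
      obtain ⟨j, rfl⟩ := hSm b hb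
      refine hext j _ _ _ _ (p2 x) (p4 x) (hΓe j x 1 ?_ ?_)
      · exact hev (p2 x) j (analyticAt_left _ _ x (him j)).2
      · exact hev (p4 x) j (analyticAt_jost _ _ x (him j)).2
  obtain ⟨s1, s2⟩ := hs
  have k1 : Scat.IsKernelFun (potUp q r) r S ρ Γ (GI.Om q r D) := by
    intro t
    have h1 := hΓs ρ (Complex.I * t) (fun j => hρ _ (hjS j)) (fun j l hl hne => by
      have hl0 := hball _ (hjS j) l hl
      refine DifferentiableAt.congr_of_eventuallyEq ?_ (hτe l hl0)
      exact (differentiableAt_const _).div (Scat.differentiableAt_aCoef hl0)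
        (s1.ne_zero_of_mem_ball (hjS j) hl hne))
    have h2 : 2 * Real.pi * GI.RHat q r t =
        expT volume (fun l : ℝ => (l : ℂ)) (reflCoef (potUp q r) r) t := by
      have hpi : (2 * Real.pi : ℂ) ≠ 0 := by simp [Real.pi_ne_zero]
      rw [GI.RHat, ← mul_assoc, mul_one_div_cancel hpi, one_mul]
      unfold expT
      refine integral_congr_ae ?_
      have : ∀ᵐ l : ℝ, l ≠ 0 := by simp [ae_iff, measure_singleton]
      filter_upwards [this] with l hl
      rw [R_div_zeta q r hl]
    rw [GI.Om, mul_add, h1, h2, sub_eq_add_neg, Finset.sum_image fun i _ j _ h => hinj h]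
    congr 1
    -- The factor -i in the normalization constants produces the minus sign in front of the residue
    -- sum.
    rw [show -Complex.I * -Complex.I = -1 by linear_combination Complex.I_sq, neg_one_mul]
    congr 1
    refine Finset.sum_congr rfl fun j _ => ?_
    refine circleIntegral.integral_congr (hρ _ (hjS j)).le fun z hz => ?_
    have hz0 := hball _ (hjS j) z (Metric.sphere_subset_closedBall hz)
    rw [T_zeta hz0.le, mul_right_comm Complex.I]
    ring
  refine ⟨S, ρ, Γ, _, s1, s2, k1, ?_⟩
  have := s1.isKernelFun_deriv k1 s2 (by rw [hκ]; exact one_ne_zero)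
    (fun l => reflCoef_gauge (Complex.I / 2) q r l)
    (fun z hz => aCoef_gauge (Complex.I / 2) q r hz)
  have e : (fun t => -Complex.I * (-2 * Complex.I * (Complex.I / 2)) * deriv (GI.Om q r D) t) =
      fun t => -Complex.I * deriv (GI.Om q r D) t := by
    rw [hκ, mul_one]
  rwa [e] at this

end GI

/-! ### Scattering structure from bound states in the lower half-plane -/

section GI

variable {q r : 𝓢(ℝ, ℂ)} {D : GI.BoundStateData}

lemma tendsto_neg_punctured (c : ℂ) : Tendsto (fun z : ℂ => -z) (𝓝[≠] (-c)) (𝓝[≠] c) := by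
  refine tendsto_nhdsWithin_of_tendsto_nhds_of_eventually_within _ ?_ ?_
  · have : Tendsto (fun z : ℂ => -z) (𝓝 (-c)) (𝓝 (- -c)) := continuous_neg.tendsto _
    rw [neg_neg] at this
    exact this.mono_left nhdsWithin_le_nhds
  · filter_upwards [self_mem_nhdsWithin] with z hz h
    exact hz (by rw [mem_singleton_iff] at h ⊢; rw [← h, neg_neg])

/-- The scattering structure, in the variable `-ζ²`, of the system with bound-state data `D` in the
lower half-plane. -/
lemma exists_scat_bar (hreg : GI.NoSpectralSingularity q r) (hD : GI.IsBoundStateInfoBar q r D) :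
    ∃ (S : Finset ℂ) (ρ : ℂ → ℝ) (Γ Γ' : ℂ → ℂ → ℂ),
      Scat (potLow q r) q S ρ Γ ∧ Scat r (potUp q r) S ρ Γ' ∧
      Scat.IsKernelFun (potLow q r) q S ρ Γ (GI.OmBar q r D) ∧
      Scat.IsKernelFun r (potUp q r) S ρ Γ' (fun t => Complex.I * deriv (GI.OmBar q r D) t) := by
  obtain ⟨Γ, hΓd, hΓe, hΓs⟩ := exists_depFun hD
  obtain ⟨hinj, hrange, -⟩ := hD
  set τ : ℂ → ℂ := fun l => GI.TBar q r (GI.zeta l) with hτ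
  have him : ∀ j, (D.lam j).im < 0 := fun j => by
    have : D.lam j ∈ {l | l ∈ {l : ℂ | l.im < 0} ∧ meromorphicOrderAt τ l < 0} :=
      hrange ▸ mem_range_self j
    exact this.1
  have hop : IsOpen {l : ℂ | l.im < 0} := isOpen_lt Complex.continuous_im continuous_const
  have hneg : ∀ {l : ℂ}, l.im < 0 → 0 < (-l).im := fun h => by simpa using h
  have hneg' : ∀ {l : ℂ}, 0 < l.im → (-l).im < 0 := fun h => by simpa using h
  have hτe : ∀ l : ℂ, l.im < 0 → τ =ᶠ[𝓝 l] fun w => 1 / aCoef (potLow q r) q (-w) := fun l hl => by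
    filter_upwards [hop.mem_nhds hl] with w hw using TBar_zeta (le_of_lt hw)
  -- The AKNS systems of the barred solutions have spectral parameter -λ, so the poles are reflected
  -- into the upper half-plane.
  set S : Finset ℂ := Finset.univ.image fun j => -D.lam j with hS
  have hSm : ∀ b ∈ S, ∃ j, -D.lam j = b := by simp [hS]
  obtain ⟨ρ, hρ, hball, hsep⟩ := exists_isolating_radii (S := S) (fun b hb => by
    obtain ⟨j, rfl⟩ := hSm b hb
    exact hneg (him j))
  have hjS : ∀ j, -D.lam j ∈ S := by simp [hS]
  have hzero : ∀ z : ℂ, 0 < z.im → aCoef (potLow q r) q z = 0 → z ∈ S := by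
    intro z hz h0
    have h1 : -z ∈ range D.lam := by
      rw [hrange]
      refine ⟨hneg' hz, ?_⟩
      have hz' : 0 < (- -z).im := by rwa [neg_neg]
      have ha : AnalyticAt ℂ (fun w => aCoef (potLow q r) q (-w)) (-z) :=
        (analyticAt_aCoef (potLow q r) q hz').fun_comp (f := fun w : ℂ => -w) (by fun_prop)
      rw [meromorphicOrderAt_congr ((hτe _ (hneg' hz)).filter_mono nhdsWithin_le_nhds)]
      refine meromorphicOrderAt_inv_neg ha (by rwa [neg_neg]) fun h => ?_
      refine not_eventually_aCoef_eq_zero (potLow q r) q hz ?_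
      have h2 := (continuous_neg.tendsto z).eventually h
      simpa using h2
    obtain ⟨j, hj⟩ := h1
    rw [← neg_neg z, ← hj]
    exact hjS j
  have hz0 : ∀ {z : ℂ}, z.im < 0 → GI.zeta z ≠ 0 := fun hz => zeta_ne_zero (ne_zero_of_im hz.ne)
  have hext : ∀ j (f g f' g' : ℂ → ℂ) , (∀ z : ℂ, z.im < 0 → f (-z) = f' z) →
      (∀ z : ℂ, z.im < 0 → g (-z) = g' z) →
      (∃ h : ℂ → ℂ, AnalyticAt ℂ h (D.lam j) ∧ ∀ᶠ z in 𝓝[≠] (D.lam j),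
        τ z * (f' z - Γ (D.lam j) z * g' z) = h z) →
      ∃ h : ℂ → ℂ, AnalyticAt ℂ h (-D.lam j) ∧ ∀ᶠ z in 𝓝[≠] (-D.lam j),
        (f z - Γ (D.lam j) (-z) * g z) / aCoef (potLow q r) q z = h z := by
    rintro j f g f' g' hf hg ⟨h, hh, he⟩
    refine ⟨fun z => h (-z), ?_, ?_⟩
    · exact AnalyticAt.fun_comp (by rwa [neg_neg]) (f := fun w : ℂ => -w) (by fun_prop)
    · filter_upwards [(tendsto_neg_punctured _).eventually he, (tendsto_neg_punctured _).eventually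
          (eventually_nhdsWithin_of_eventually_nhds (hτe _ (him j))),
        (tendsto_neg_punctured _).eventually
          (eventually_nhdsWithin_of_eventually_nhds (hop.mem_nhds (him j)))] with z h1 h2 h3
      rw [← h1, h2, ← hf _ h3, ← hg _ h3, neg_neg]
      ring
  have hzim : ∀ {z : ℂ}, z.im < 0 → (GI.zeta z ^ 2).im ≤ 0 := fun hz => by
    rw [zeta_sq]
    exact hz.le
  have p1 : ∀ (x : ℝ) (z : ℂ), z.im < 0 →
      leftOne r (potUp q r) (-z) x = GI.phiBar q r (GI.zeta z) x 1 :=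
    fun x z hz => by rw [(phiBar_spec q r (hzim hz) x).1, zeta_sq]
  have p2 : ∀ (x : ℝ) (z : ℂ), z.im < 0 →
      leftTwo (potLow q r) q (-z) x = GI.phiBar q r (GI.zeta z) x 0 / GI.zeta z := fun x z hz => by
    rw [(phiBar_spec q r (hzim hz) x).2, zeta_sq, mul_div_cancel_left₀ _ (hz0 hz)]
  have p3 : ∀ (x : ℝ) (z : ℂ), z.im < 0 →
      - -z * jostOne r (potUp q r) (-z) x = GI.zeta z * GI.psiBar q r (GI.zeta z) x 1 :=
    fun x z hz => by
      rw [((psiBar_spec q r (hzim hz)).2 x).1, zeta_sq, ← mul_assoc, ← sq, zeta_sq, neg_neg]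
  have p4 : ∀ (x : ℝ) (z : ℂ), z.im < 0 →
      jostTwo (potLow q r) q (-z) x = GI.psiBar q r (GI.zeta z) x 0 := fun x z hz => by
    rw [((psiBar_spec q r (hzim hz)).2 x).2, zeta_sq]
  have hev : ∀ {f g : ℂ → ℂ}, (∀ z : ℂ, z.im < 0 → f (-z) = g z) → ∀ j, AnalyticAt ℂ f (-D.lam j) →
      AnalyticAt ℂ g (D.lam j) := fun h j hf => by
    refine (hf.fun_comp (f := fun w : ℂ => -w) (by fun_prop)).congr ?_
    filter_upwards [hop.mem_nhds (him j)] with z hz using h z hz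
  have hκ : -2 * Complex.I * (-(Complex.I / 2)) = -1 := by
    linear_combination Complex.I_sq
  have hup : gaugePot (- -(Complex.I / 2)) q r = potUp q r := by rw [neg_neg, potUp]
  have hs : Scat (potLow q r) q S ρ (fun b z => Γ (-b) (-z)) ∧
      Scat r (gaugePot (- -(Complex.I / 2)) q r) S ρ
        (fun b z => -2 * Complex.I * (-(Complex.I / 2)) * z * Γ (-b) (-z)) := by
    refine scat_pair (-(Complex.I / 2)) r q (fun l => ?_) hzero hρ hball hsep ?_ ?_ ?_
    · have := (hreg (-l)).2
      rw [wronskian_psiBar_phiBar q r (by simp)] at this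
      simpa [potLow] using this
    · intro b hb
      obtain ⟨j, rfl⟩ := hSm b hb
      rw [neg_neg]
      exact (hΓd j).comp differentiable_neg
    · intro b hb x
      obtain ⟨j, rfl⟩ := hSm b hb
      simp only [hκ, hup, neg_neg (D.lam j), neg_one_mul, mul_comm _ (Γ _ _), mul_assoc]
      refine hext j _ (fun z => -z * jostOne r (potUp q r) z x) _ _ (p1 x) (p3 x)
        (hΓe j x 1 ?_ ?_)
      · exact hev (p1 x) j (analyticAt_left _ _ x (hneg (him j))).1
      · exact hev (f := fun z => -z * jostOne r (potUp q r) z x) (p3 x) j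
          (AnalyticAt.fun_mul (by fun_prop) (analyticAt_jost _ _ x (hneg (him j))).1)
    · intro b hb x
      obtain ⟨j, rfl⟩ := hSm b hb
      simp only [neg_neg (D.lam j)]
      refine hext j _ _ _ _ (p2 x) (p4 x) (hΓe j x 0 ?_ ?_)
      · exact hev (p2 x) j (analyticAt_left _ _ x (hneg (him j))).2
      · exact hev (p4 x) j (analyticAt_jost _ _ x (hneg (him j))).2
  obtain ⟨s1, s2⟩ := hs
  have k1 : Scat.IsKernelFun (potLow q r) q S ρ (fun b z => Γ (-b) (-z)) (GI.OmBar q r D) := by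
    intro t
    have h1 := hΓs (fun b => ρ (-b)) (-Complex.I * t) (fun j => hρ _ (hjS j)) (fun j l hl hne => by
      have hl' : -l ∈ Metric.closedBall (-D.lam j) (ρ (-D.lam j)) := by
        rwa [Metric.mem_closedBall, dist_neg_neg]
      have hl0 := hball _ (hjS j) _ hl'
      refine DifferentiableAt.congr_of_eventuallyEq ?_ (hτe l (by simpa using hl0))
      exact (differentiableAt_const _).fun_div
        ((Scat.differentiableAt_aCoef hl0).fun_comp' l differentiableAt_id.fun_neg)
        (s1.ne_zero_of_mem_ball (hjS j) hl' fun h => hne (neg_injective h)))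
    have h2 : 2 * Real.pi * GI.RBarHat q r t =
        expT volume (fun l : ℝ => (l : ℂ)) (reflCoef (potLow q r) q) t := by
      have hpi : (2 * Real.pi : ℂ) ≠ 0 := by simp [Real.pi_ne_zero]
      rw [GI.RBarHat, ← mul_assoc, mul_one_div_cancel hpi, one_mul]
      unfold expT
      -- The substitution l ↦ -l matches the opposite sign in the exponent with the spectral
      -- parameter -λ.
      rw [← integral_neg_eq_self]
      refine integral_congr_ae ?_
      have : ∀ᵐ l : ℝ, l ≠ 0 := by simp [ae_iff, measure_singleton]
      filter_upwards [this] with l hl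
      rw [RBar_div_zeta q r (neg_ne_zero.2 hl), neg_neg]
      push_cast
      ring_nf
    rw [GI.OmBar, mul_add, h1, h2, sub_eq_add_neg,
      Finset.sum_image fun i _ j _ h => hinj (neg_injective h)]
    congr 1
    -- With the factor +i the constant is 1; here the minus sign comes from reflecting the circles
    -- instead.
    rw [show -Complex.I * Complex.I = 1 by linear_combination -Complex.I_sq, one_mul,
      ← Finset.sum_neg_distrib]
    refine Finset.sum_congr rfl fun j _ => ?_
    rw [← neg_neg (∮ z in C(D.lam j, _), _), ← circleIntegral_comp_neg]
    congr 1
    refine circleIntegral.integral_congr (hρ _ (hjS j)).le fun z hz => ?_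
    have hz0 := hball _ (hjS j) z (Metric.sphere_subset_closedBall hz)
    simp only [neg_neg]
    rw [TBar_zeta (hneg' hz0).le, neg_neg,
      show -Complex.I * t * -z = Complex.I * z * t by ring]
    ring
  refine ⟨S, ρ, _, _, s1, hup ▸ s2, k1, ?_⟩
  have := s1.isKernelFun_deriv k1 s2 (by rw [hκ]; simp)
    (fun l => reflCoef_gauge (-(Complex.I / 2)) r q l)
    (fun z hz => aCoef_gauge (-(Complex.I / 2)) r q hz)
  rw [hup] at this
  have e : (fun t => -Complex.I * (-2 * Complex.I * (-(Complex.I / 2))) *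
      deriv (GI.OmBar q r D) t) = fun t => Complex.I * deriv (GI.OmBar q r D) t := by
    ext t
    rw [hκ, mul_neg_one, neg_neg]
  rwa [e] at this

end GI

/-! ### Reconstruction from the transformation kernels -/

lemma tendsto_of_eq_kernel {C : ℝ} {k : ℝ × ℝ → ℂ} (h : Decay C k) {x : ℝ} {f : ℝ → ℂ}
    (hf : ∀ y, x < y → f y = k (x, y - x)) : Tendsto f (𝓝[>] x) (𝓝 (k (x, 0))) := by
  have h1 : Tendsto (fun y => k (x, y - x)) (𝓝 x) (𝓝 (k (x, x - x))) :=
    (h.cont.comp (by fun_prop : Continuous fun y : ℝ => (x, y - x))).tendsto x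
  rw [sub_self] at h1
  refine (h1.mono_left nhdsWithin_le_nhds).congr' ?_
  filter_upwards [self_mem_nhdsWithin] with y hy
  exact (hf y hy).symm

lemma integral_eq_lap {k : ℝ × ℝ → ℂ} {x : ℝ} {f : ℝ → ℂ} (z : ℂ)
    (hf : ∀ y, x < y → f y = k (x, y - x)) :
    ∫ y in Ioi x, f y * Complex.exp (Complex.I * z * y) =
      Complex.exp (Complex.I * z * x) * lap k z x := by
  rw [← integral_Ioi_comp_add (f := fun y => f y * Complex.exp (Complex.I * z * y)) x, lap,
    ← integral_const_mul]
  refine setIntegral_congr_fun measurableSet_Ioi fun s hs => ?_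
  rw [hf _ (by linarith [mem_Ioi.1 hs]), add_sub_cancel_left]
  push_cast
  rw [mul_add, Complex.exp_add]
  ring

/-- The solution of the Marchenko system consists of the transformation kernels. -/
lemma eq_ker {q r : 𝓢(ℝ, ℂ)} (hreg : GI.NoSpectralSingularity q r) {D Dbar : GI.BoundStateData}
    (hD : GI.IsBoundStateInfo q r D) (hDbar : GI.IsBoundStateInfoBar q r Dbar)
    {K : ℝ → ℝ → Matrix (Fin 2) (Fin 2) ℂ}
    (hK : GI.IsMarchenkoSolution (GI.Om q r D) (GI.OmBar q r Dbar) K) (x y : ℝ) (hxy : x < y) :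
    (K x y 0 0 = kerTwo (potLow q r) q (x, y - x) ∧ K x y 0 1 = kerOne q (potLow q r) (x, y - x)) ∧
      K x y 1 1 = kerTwo (potUp q r) r (x, y - x) ∧ K x y 1 0 = kerOne r (potUp q r) (x, y - x) := by
  obtain ⟨S, ρ, Γ, Γ', s1, s2, k1, k2⟩ := exists_scat hreg hD
  obtain ⟨S', ρ', Γb, Γb', s1', s2', k1', k2'⟩ := exists_scat_bar hreg hDbar
  obtain ⟨hint, heq⟩ := hK
  have e := fun y hy i j => congrFun (congrFun (heq x y hy) i) j
  -- The system decouples into rows: the first is the Marchenko system of (q, `potLow`) with kernels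
  -- -iΩ' and Ω̄, the second that of (r, `potUp`) with kernels iΩ̄' and Ω.
  constructor
  · refine s2.eq_ker_of_marchenko k2 s1' k1' (hint x 0 0) (hint x 0 1) (fun y hy => ?_)
      (fun y hy => ?_) hxy
    · have := e y hy 0 0
      simp only [Matrix.zero_apply, Matrix.add_apply, Matrix.of_apply, Matrix.cons_val',
        Matrix.cons_val_zero, Matrix.cons_val_fin_one, add_zero] at this
      rw [this]
      congr 2
      ext z
      ring
    · exact (e y hy 0 1).symm
  · refine s2'.eq_ker_of_marchenko k2' s1 k1 (hint x 1 1) (hint x 1 0) (fun y hy => ?_)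
      (fun y hy => ?_) hxy
    · have := e y hy 1 1
      simp only [Matrix.zero_apply, Matrix.add_apply, Matrix.of_apply, Matrix.cons_val',
        Matrix.cons_val_one, Matrix.cons_val_fin_one, add_zero] at this
      rw [this]
      congr 2
      ext z
      ring
    · exact (e y hy 1 0).symm

end AKNS

theorem theorem5p4 (q r : SchwartzMap ℝ ℂ)
    (hreg : GI.NoSpectralSingularity q r)
    (D Dbar : GI.BoundStateData)
    (hD : GI.IsBoundStateInfo q r D) (hDbar : GI.IsBoundStateInfoBar q r Dbar)
    (K : ℝ → ℝ → Matrix (Fin 2) (Fin 2) ℂ)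
    (hK : GI.IsMarchenkoSolution (GI.Om q r D) (GI.OmBar q r Dbar) K) :
    -- the diagonal values `K₁(x,x) = K₁(x,x⁺)` and `K̄₂(x,x) = K̄₂(x,x⁺)`, and their product
    ∃ k₁ k₂bar P : ℝ → ℂ,
      (∀ x : ℝ, Tendsto (fun y => K x y 0 1) (𝓝[>] x) (𝓝 (k₁ x))) ∧
      (∀ x : ℝ, Tendsto (fun y => K x y 1 0) (𝓝[>] x) (𝓝 (k₂bar x))) ∧
      (∀ x : ℝ, P x = k₁ x * k₂bar x) ∧
      -- (a)
      Integrable P ∧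
      (∀ x : ℝ, GI.E q r x = Complex.exp (2 * Complex.I * ∫ z in Iic x, P z)) ∧
      GI.mu q r = 4 * ∫ z : ℝ, P z ∧
      -- (b)
      (∀ x : ℝ, q x = -2 * k₁ x) ∧
      (∀ x : ℝ, r x = -2 * k₂bar x) ∧
      -- (c)
      (∀ ζ : ℂ, 0 ≤ (ζ ^ 2).im →
        GI.IsJostPsi q r ζ (GI.psi q r ζ) ∧
        ∀ x : ℝ,
          GI.psi q r ζ x 0 = ζ * ∫ y in Ioi x, K x y 0 1 * Complex.exp (Complex.I * ζ ^ 2 * y) ∧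
          GI.psi q r ζ x 1 = Complex.exp (Complex.I * ζ ^ 2 * x) +
            ∫ y in Ioi x, K x y 1 1 * Complex.exp (Complex.I * ζ ^ 2 * y)) ∧
      (∀ ζ : ℂ, (ζ ^ 2).im ≤ 0 →
        GI.IsJostPsiBar q r ζ (GI.psiBar q r ζ) ∧
        ∀ x : ℝ,
          GI.psiBar q r ζ x 0 = Complex.exp (-Complex.I * ζ ^ 2 * x) +
            ∫ y in Ioi x, K x y 0 0 * Complex.exp (-Complex.I * ζ ^ 2 * y) ∧
          GI.psiBar q r ζ x 1 =
            ζ * ∫ y in Ioi x, K x y 1 0 * Complex.exp (-Complex.I * ζ ^ 2 * y)) := by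
  have hker := AKNS.eq_ker hreg hD hDbar hK
  obtain ⟨C, h1⟩ := AKNS.isKernel_ker q (AKNS.potLow q r)
  obtain ⟨C', h2⟩ := AKNS.isKernel_ker r (AKNS.potUp q r)
  have hqr : Integrable fun x => q x * r x :=
    (SchwartzMap.pairing (ContinuousLinearMap.mul ℂ ℂ) q r).integrable
  have hI : ∀ s : Set ℝ, ∫ z in s, -(1 / 2) * q z * (-(1 / 2) * r z) =
      1 / 4 * ∫ z in s, q z * r z := fun s => by
    rw [← integral_const_mul]
    congr 1
    ext z
    ring
  -- The diagonal values are those of the first kernels at s = 0. The product qr/4 accounts for the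
  -- constants in (a): 2i/4 = i/2 in the exponent and 4/4 = 1 for μ.
  refine ⟨fun x => -(1 / 2) * q x, fun x => -(1 / 2) * r x,
    fun x => -(1 / 2) * q x * (-(1 / 2) * r x), fun x => ?_, fun x => ?_, fun x => rfl, ?_,
    fun x => ?_, ?_, fun x => by ring, fun x => by ring, fun ζ hζ => ?_, fun ζ hζ => ?_⟩
  · have := AKNS.tendsto_of_eq_kernel h1.decay₁ fun y hy => (hker x y hy).1.2
    rwa [AKNS.kerOne_zero] at this
  · have := AKNS.tendsto_of_eq_kernel h2.decay₁ fun y hy => (hker x y hy).2.2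
    rwa [AKNS.kerOne_zero] at this
  · exact (hqr.const_mul (1 / 4)).congr (Eventually.of_forall fun x => by simp only; ring)
  · rw [hI, GI.E]
    congr 1
    ring
  · have := hI univ
    rw [setIntegral_univ, setIntegral_univ] at this
    rw [this, GI.mu]
    ring
  · obtain ⟨hψ, h⟩ := AKNS.psi_spec q r hζ
    refine ⟨hψ, fun x => ?_⟩
    rw [(h x).1, (h x).2, AKNS.integral_eq_lap _ fun y hy => (hker x y hy).1.2,
      AKNS.integral_eq_lap _ fun y hy => (hker x y hy).2.1]
    exact ⟨rfl, by rw [AKNS.jostTwo, AKNS.mTwo, mul_add, mul_one]⟩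
  · obtain ⟨hψ, h⟩ := AKNS.psiBar_spec q r hζ
    refine ⟨hψ, fun x => ?_⟩
    rw [(h x).1, (h x).2, neg_mul, ← mul_neg, AKNS.integral_eq_lap _ fun y hy => (hker x y hy).1.1,
      AKNS.integral_eq_lap _ fun y hy => (hker x y hy).2.2]
    exact ⟨by rw [AKNS.jostTwo, AKNS.mTwo, mul_add, mul_one], rfl⟩
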